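/- All algebras are over $\mathbb C$, finite-dimensional, associative and unital. A *Frobenius $\star$-algebra* is such an algebra $A$ with a conjugate-linear anti-involution $\star$ and a linear functional $\lambda:A\to\mathbb C$ with $\lambda(ab)=\lambda(ba)$ and $\lambda(a^\star)=\overline{\lambda(a)}$, such that the Hermitian form $\langle a,b\rangle=\lambda(ab^\star)$ admits an orthonormal basis; homomorphisms are the unital algebra homomorphisms that preserve $\lambda$ and $\star$. Let $G$ be a finite group. A *$G$-crossed Frobenius $\star$-algebra* is a Frobenius $\star$-algebra with a grading $A=\bigoplus_{g\in G}A_g$, $A_gA_h\subseteq A_{gh}$, $(A_g)^\star=A_{g^{-1}}$, $\lambda|_{A_g}=0$ for $g\neq1$, and an action of $G$ by Frobenius $\star$-algebra automorphisms with $g(A_h)\subseteq A_{ghg^{-1}}$ and $ab=g(b)a$ for all $a\in A_g$, $b\in A$. (Then $A_1$ is commutative and central in $A$.) Let $\mathrm{Sim}(A_1)$ be the set of unital algebra homomorphisms $\chi:A_1\to\mathbb C$, and $\mathbb C_\chi$ the corresponding $A_1$-module. $A$ is *strict* if for all $g\in G$ and $\chi\in\mathrm{Sim}(A_1)$: $A_g\otimes_{A_1}\mathbb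 C_\chi\cong\mathbb C_\chi$ as $A_1$-modules if and only if $\chi\circ g^{-1}=\chi$. Let $R$ be a commutative Frobenius $\star$-algebra on which $G$ acts by Frobenius $\star$-algebra automorphisms. A *strict $G$-crossed extension* of $R$ is a strict $G$-crossed Frobenius $\star$-algebra $A$ with an injective $G$-equivariant Frobenius $\star$-algebra homomorphism $j:R\to A$ with image $A_1$; an isomorphism of extensions is a grade-preserving $G$-equivariant isomorphism of Frobenius $\star$-algebras commuting with the maps $j$. Identify $R$ with $A_1$ via $j$. Let $G$ act on $\mathrm{Sim}(R)$ by ${}^g\chi=\chi\circ g^{-1}$, let $G_\chi$ be the stabilizer of $\chi$ and $\mathrm{Sim}(R)^g=\{\chi : {}^g\chi=\chi\}$. For $\chi\in \mathrm{Sim}(R)^g$, a *$g$-twisted character* is an element $\alpha_\chi^g\in A_{g^{-1}}$ such that $\lambda(\alpha_\chi^g a)=\tilde\chi(a)$ for all $a\in A_g$, for some algebra homomorphism $\tilde\chi:\bigoplus_{h\in\langle g\rangle}A_h\to\mathbb C$ extending $\chi$; write $\alpha_\chi=\alpha_\chi^1$. A *normalized twisted-character family* of $A$ consists of elements $e_\chi^g\in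 A_g$ ($g\in G$, $\chi\in\mathrm{Sim}(R)^g$), where $e_\chi^g=\alpha_\chi^{g^{-1}}/\chi(\alpha_\chi)$ for some $g^{-1}$-twisted character $\alpha_\chi^{g^{-1}}$. For any elements $e_\chi^g\in A_g$ ($g\in G$, $\chi\in\mathrm{Sim}(R)^g$) and any $\varphi:G\times G\to R^\times$ consider the conditions (B) for each $g$, $\{e_\chi^g:\chi\in\mathrm{Sim}(R)^g\}$ is a basis of $A_g$, and $re_\chi^g=e_\chi^gr=\chi(r)e_\chi^g$ for all $r\in R$; (P) $e_\chi^ge_\chi^h=\varphi(g,h)\,e_\chi^{gh}$ for all $\chi$ and $g,h\in G_\chi$; (A) $g(e_\chi^h)=\dfrac{\varphi(g,h)}{\varphi(ghg^{-1},g)}\,e_{{}^g\chi}^{ghg^{-1}}$ for all $\chi$, $h\in G_\chi$ and $g\in G$. **Theorem.** Let $\mathrm{Frob}(G,R)$ be the set of isomorphism classes of strict $G$-crossed extensions of $R$. There is a bijection $F:\mathrm{Frob}(G,R)\to H^2(G,R^\times)$ with the following properties. 1. Every strict $G$-crossed extension $A$ of $R$ has a normalized twisted-character family. Every such family satisfies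 (B), and it satisfies (P) and (A) for some normalized 2-cocycle $\varphi$ of $G$ with values in $R^\times$ (normalized: $\varphi(1,g)=\varphi(g,1)=1$ for all $g$). For every 2-cocycle $\varphi$ with which it satisfies (P), $F([A])=[\varphi]$. 2. For every normalized 2-cocycle $\varphi:G\times G\to R^\times$ there are a strict $G$-crossed extension $A^\varphi$ of $R$ and elements $e_\chi^g\in A^\varphi_g$ that satisfy (B), (P) and (A), and $F([A^\varphi])=[\varphi]$. Moreover there is a function $\eta:G\to R^\times$ such that $\chi(\eta(g))>0$ for all $g\in G$, $\chi\in\mathrm{Sim}(R)$, and $\varphi(g,h)\varphi(g,h)^\star=\eta(g)\,g(\eta(h))\,\eta(gh)^{-1}$ for all $g,h\in G$; and for every such $\eta$ the involution of $A^\varphi$ is given by $(e_\chi^g)^\star=\eta(g)\varphi(g,g^{-1})^{-1}e_\chi^{g^{-1}}$ for all $g\in G$, $\chi\in\mathrm{Sim}(R)^g$. (In particular $(e_\chi^g)^\star=e_\chi^{g^{-1}}$ if $\varphi\varphi^\star=1$ and $\varphi(g,g^{-1})=1$ for all $g$.) -/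

import Mathlib

open scoped TensorProduct

/-! ### Frobenius ⋆-algebras -/

/-- A Frobenius ⋆-algebra: a finite-dimensional associative unital `ℂ`-algebra with a semilinear
anti-involution `⋆` and a class functional `lam` compatible with it, such that the Hermitian form
`⟨a, b⟩ = lam (a * star b)` admits an orthonormal basis. -/
class FrobeniusStarAlgebra (A : Type*) [Ring A] [Algebra ℂ A] extends StarRing A where
  finiteDimensional : FiniteDimensional ℂ A
  star_smul' : ∀ (c : ℂ) (a : A), star (c • a) = (starRingEnd ℂ c) • star a
  /-- the class functional -/
  lam : A →ₗ[ℂ] ℂ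
  lam_mul_comm : ∀ a b : A, lam (a * b) = lam (b * a)
  lam_star : ∀ a : A, lam (star a) = starRingEnd ℂ (lam a)
  exists_orthonormal_basis : ∃ b : Module.Basis (Fin (Module.finrank ℂ A)) ℂ A,
    ∀ i k, lam (b i * star (b k)) = if i = k then 1 else 0

open FrobeniusStarAlgebra (lam)

/-- The property of an algebra homomorphism of being a Frobenius ⋆-algebra homomorphism. -/
def IsFrobeniusStarHom {A B : Type*} [Ring A] [Algebra ℂ A] [FrobeniusStarAlgebra A]
    [Ring B] [Algebra ℂ B] [FrobeniusStarAlgebra B] (f : A →ₐ[ℂ] B) : Prop :=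
  (∀ a, lam (f a) = lam a) ∧ (∀ a, f (star a) = star (f a))

/-- The group of Frobenius ⋆-algebra automorphisms of `A`. -/
def frobAut (A : Type*) [Ring A] [Algebra ℂ A] [FrobeniusStarAlgebra A] :
    Subgroup (A ≃ₐ[ℂ] A) where
  carrier := {f | IsFrobeniusStarHom (f : A →ₐ[ℂ] A)}
  one_mem' := ⟨fun _ => rfl, fun _ => rfl⟩
  mul_mem' := by
    rintro f g ⟨hf, hf'⟩ ⟨hg, hg'⟩
    refine ⟨fun a => (hf (g a)).trans (hg a), fun a => ?_⟩
    exact (congrArg f (hg' a)).trans (hf' (g a))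
  inv_mem' := by
    rintro f ⟨hf, hf'⟩
    refine ⟨fun a => ?_, fun a => ?_⟩
    · have h := hf (f.symm a)
      rw [AlgEquiv.coe_toAlgHom, AlgEquiv.apply_symm_apply] at h
      exact h.symm
    · apply f.injective
      have h := hf' (f.symm a)
      rw [AlgEquiv.coe_toAlgHom, AlgEquiv.apply_symm_apply] at h
      exact (f.apply_symm_apply (star a)).trans h.symm

/-! ### Graded and crossed Frobenius ⋆-algebras -/

open Classical in
/-- A `G`-graded Frobenius ⋆-algebra structure on the Frobenius ⋆-algebra `A`. The functional `lam`
of `A` is the extension by zero of its restriction to the trivial component. -/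
structure GradedFrobeniusStarAlgebra (G : Type*) [Group G]
    (A : Type*) [Ring A] [Algebra ℂ A] [FrobeniusStarAlgebra A] where
  /-- the homogeneous components -/
  comp : G → Submodule ℂ A
  isInternal : DirectSum.IsInternal comp
  one_mem : (1 : A) ∈ comp 1
  mul_mem : ∀ {g h : G} {a b : A}, a ∈ comp g → b ∈ comp h → a * b ∈ comp (g * h)
  lam_eq_zero : ∀ {g : G} {a : A}, g ≠ 1 → a ∈ comp g → lam a = 0
  star_mem : ∀ {g : G} {a : A}, a ∈ comp g → star a ∈ comp g⁻¹

namespace GradedFrobeniusStarAlgebra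

variable {G : Type*} [Group G] {A : Type*} [Ring A] [Algebra ℂ A] [FrobeniusStarAlgebra A]

/-- The subalgebra `A_H = ⨁_{h ∈ H} A_h` for a subgroup `H` of `G`. -/
def sub (C : GradedFrobeniusStarAlgebra G A) (H : Subgroup G) : Subalgebra ℂ A :=
  Submodule.toSubalgebra (⨆ h : H, C.comp h)
    (le_iSup (fun h : H => C.comp h) 1 C.one_mem) (by
      intro x y hx hy
      have hle : (⨆ h : H, C.comp h) * (⨆ h : H, C.comp h) ≤ ⨆ h : H, C.comp h := by
        rw [Submodule.iSup_mul]
        refine iSup_le fun h => ?_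
        rw [Submodule.mul_iSup]
        refine iSup_le fun k => Submodule.mul_le.2 fun a ha b hb => ?_
        exact le_iSup (fun h : H => C.comp h) (h * k) (C.mul_mem ha hb)
      exact hle (Submodule.mul_mem_mul hx hy))

/-- The trivial component `A_1` as a subalgebra. -/
def one (C : GradedFrobeniusStarAlgebra G A) : Subalgebra ℂ A :=
  Submodule.toSubalgebra (C.comp 1) C.one_mem fun x y hx hy => by
    simpa using C.mul_mem hx hy

end GradedFrobeniusStarAlgebra

/-- A `G`-crossed Frobenius ⋆-algebra structure on the Frobenius ⋆-algebra `A`. -/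
structure CrossedFrobeniusStarAlgebra (G : Type*) [Group G]
    (A : Type*) [Ring A] [Algebra ℂ A] [FrobeniusStarAlgebra A] extends
    GradedFrobeniusStarAlgebra G A where
  /-- the action of `G` by Frobenius ⋆-algebra automorphisms -/
  act : G →* frobAut A
  act_mem : ∀ (g : G) {h : G} {a : A}, a ∈ comp h → (act g : A ≃ₐ[ℂ] A) a ∈ comp (g * h * g⁻¹)
  crossed_comm : ∀ {g : G} {a : A}, a ∈ comp g → ∀ b : A, a * b = (act g : A ≃ₐ[ℂ] A) b * a

namespace CrossedFrobeniusStarAlgebra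

variable {G : Type*} [Group G] {A : Type*} [Ring A] [Algebra ℂ A] [FrobeniusStarAlgebra A]

/-- Elements of the trivial component are central. -/
theorem one_comm (C : CrossedFrobeniusStarAlgebra G A) {a : A} (ha : a ∈ C.comp 1) (b : A) :
    a * b = b * a := by
  simpa using C.crossed_comm ha b

/-- The trivial component is a commutative ring. -/
instance instCommRingOne (C : CrossedFrobeniusStarAlgebra G A) : CommRing C.one :=
  { C.one.toRing with
    mul_comm := fun a b => Subtype.ext (C.one_comm a.2 b) }

/-- The set `Sim(A_1)` of irreducible characters of the commutative algebra `A_1`. -/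
abbrev Sim (C : CrossedFrobeniusStarAlgebra G A) := C.one →ₐ[ℂ] ℂ

/-- The homogeneous component `A_g` as an `A_1`-module. Since `A_1` is central in `A`, the left and
right actions of `A_1` on `A_g` coincide. -/
def compModule (C : CrossedFrobeniusStarAlgebra G A) (g : G) : Submodule C.one A where
  carrier := C.comp g
  add_mem' := (C.comp g).add_mem
  zero_mem' := (C.comp g).zero_mem
  smul_mem' a x hx := by
    have h := C.mul_mem a.2 hx
    rw [one_mul] at h
    exact h

/-- The simple `A_1`-module `ℂ` on which `A_1` acts through `χ`. -/
def SimpleModule (C : CrossedFrobeniusStarAlgebra G A) (_χ : C.Sim) : Type := ℂ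

noncomputable instance (C : CrossedFrobeniusStarAlgebra G A) (χ : C.Sim) :
    AddCommGroup (C.SimpleModule χ) := inferInstanceAs (AddCommGroup ℂ)

noncomputable instance (C : CrossedFrobeniusStarAlgebra G A) (χ : C.Sim) :
    Module C.one (C.SimpleModule χ) := Module.compHom ℂ χ.toRingHom

/-- The module `ᵍM = (A ⊗_{A_1} M)_g = A_g ⊗_{A_1} M` given by the partial action of `g` on the
simple module `M` with character `χ`. -/
abbrev PartialAction (C : CrossedFrobeniusStarAlgebra G A) (g : G) (χ : C.Sim) : Type _ :=
  C.compModule g ⊗[C.one] C.SimpleModule χ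

/-- The automorphism `g` of `A` restricted to the trivial component. -/
def actOne (C : CrossedFrobeniusStarAlgebra G A) (g : G) : C.one →ₐ[ℂ] C.one :=
  (((C.act g : A ≃ₐ[ℂ] A) : A →ₐ[ℂ] A).comp C.one.val).codRestrict C.one fun a => by
    have h := C.act_mem g a.2
    rw [mul_one, mul_inv_cancel] at h
    exact h

/-- `A` is strict: for each `g`, the fixed points of the partial action of `g` on `Sim(A_1)` are
exactly the fixed points of the action `χ ↦ χ ∘ g⁻¹`. -/
def IsStrict (C : CrossedFrobeniusStarAlgebra G A) : Prop :=
  ∀ g : G, {χ : C.Sim | Nonempty (C.PartialAction g χ ≃ₗ[C.one] C.SimpleModule χ)} =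
    {χ : C.Sim | χ.comp (C.actOne g⁻¹) = χ}

/-- `α ∈ A_{g⁻¹}` is a `g`-twisted character associated with `χ`: there is an extension `χt` of `χ`
to a (one-dimensional) representation of `A_{⟨g⟩}` such that the linear functional `lam (α * ·)` on
`A_g` is the restriction of the character of `χt`. -/
def IsTwistedCharacter (C : CrossedFrobeniusStarAlgebra G A) (χ : C.Sim) (g : G) (α : A) : Prop :=
  α ∈ C.comp g⁻¹ ∧ ∃ χt : C.sub (Subgroup.zpowers g) →ₐ[ℂ] ℂ,
    (∀ (a : C.sub (Subgroup.zpowers g)) (ha : (a : A) ∈ C.comp 1), χt a = χ ⟨a, ha⟩) ∧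
    (∀ a : C.sub (Subgroup.zpowers g), (a : A) ∈ C.comp g → lam (α * a) = χt a)

/-- `x = α_χ^g / χ(α_χ)` for a `g`-twisted character `α_χ^g` associated with `χ`, where `α_χ` is the
`1`-twisted character associated with `χ`. -/
def IsNormalizedTwistedCharacter (C : CrossedFrobeniusStarAlgebra G A) (χ : C.Sim) (g : G)
    (x : A) : Prop :=
  ∃ (α : A) (α₁ : C.one), C.IsTwistedCharacter χ g α ∧ C.IsTwistedCharacter χ 1 α₁ ∧
    x = (χ α₁)⁻¹ • α

end CrossedFrobeniusStarAlgebra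

/-! ### Strict crossed extensions -/

section Extensions

variable {G R : Type} [Group G] [CommRing R] [Algebra ℂ R] [FrobeniusStarAlgebra R]

/-- A strict `G`-crossed extension `(A, j)` of the commutative Frobenius ⋆-algebra `R` with the
action `ρ` of `G`. -/
structure StrictCrossedExtension (ρ : G →* frobAut R) where
  /-- the underlying type of the algebra `A` -/
  carrier : Type
  [ring : Ring carrier]
  [algebra : Algebra ℂ carrier]
  [frobenius : FrobeniusStarAlgebra carrier]
  /-- the `G`-crossed structure on `A` -/
  crossed : CrossedFrobeniusStarAlgebra G carrier
  strict : crossed.IsStrict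
  /-- the embedding of `R` -/
  j : R →ₐ[ℂ] carrier
  j_hom : IsFrobeniusStarHom j
  j_injective : Function.Injective j
  j_range : j.range = crossed.one
  j_act : ∀ (g : G) (r : R), (crossed.act g : carrier ≃ₐ[ℂ] carrier) (j r) =
    j ((ρ g : R ≃ₐ[ℂ] R) r)

attribute [instance] StrictCrossedExtension.ring StrictCrossedExtension.algebra
  StrictCrossedExtension.frobenius

/-- The action `χ ↦ χ ∘ g⁻¹` of `G` on `Sim(R)`. -/
def simAct (ρ : G →* frobAut R) (g : G) (χ : R →ₐ[ℂ] ℂ) : R →ₐ[ℂ] ℂ :=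
  χ.comp ((ρ g⁻¹ : R ≃ₐ[ℂ] R) : R →ₐ[ℂ] R)

namespace StrictCrossedExtension

variable {ρ : G →* frobAut R}

/-- An isomorphism of extensions: a grade-preserving, `G`-equivariant isomorphism of Frobenius
⋆-algebras that commutes with the embeddings of `R`. -/
def IsIso (A B : StrictCrossedExtension ρ) (f : A.carrier ≃ₐ[ℂ] B.carrier) : Prop :=
  IsFrobeniusStarHom (f : A.carrier →ₐ[ℂ] B.carrier) ∧
  (∀ (g : G) (a : A.carrier), f a ∈ B.crossed.comp g ↔ a ∈ A.crossed.comp g) ∧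
  (∀ (g : G) (a : A.carrier), f ((A.crossed.act g : A.carrier ≃ₐ[ℂ] A.carrier) a) =
    (B.crossed.act g : B.carrier ≃ₐ[ℂ] B.carrier) (f a)) ∧
  (∀ r : R, f (A.j r) = B.j r)

/-- The relation of being isomorphic as extensions. -/
instance setoid (ρ : G →* frobAut R) : Setoid (StrictCrossedExtension ρ) where
  r A B := ∃ f : A.carrier ≃ₐ[ℂ] B.carrier, IsIso A B f
  iseqv :=
    { refl := fun _ => ⟨AlgEquiv.refl, ⟨fun _ => rfl, fun _ => rfl⟩, fun _ _ => Iff.rfl,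
        fun _ _ => rfl, fun _ => rfl⟩
      symm := by
        rintro A B ⟨f, ⟨h1, h2⟩, h3, h4, h5⟩
        refine ⟨f.symm, ⟨fun b => ?_, fun b => ?_⟩, fun g b => ?_, fun g b => ?_, fun r => ?_⟩
        · have h := h1 (f.symm b)
          rw [AlgEquiv.coe_toAlgHom, AlgEquiv.apply_symm_apply] at h
          exact h.symm
        · apply f.injective
          have h := h2 (f.symm b)
          rw [AlgEquiv.coe_toAlgHom, AlgEquiv.apply_symm_apply] at h
          exact (f.apply_symm_apply (star b)).trans h.symm
        · rw [← h3, AlgEquiv.apply_symm_apply]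
        · apply f.injective
          rw [h4, AlgEquiv.apply_symm_apply, AlgEquiv.apply_symm_apply]
        · apply f.injective
          rw [h5, AlgEquiv.apply_symm_apply]
      trans := by
        rintro A B C ⟨f, ⟨h1, h2⟩, h3, h4, h5⟩ ⟨f', ⟨h1', h2'⟩, h3', h4', h5'⟩
        refine ⟨f.trans f', ⟨fun a => (h1' (f a)).trans (h1 a), fun a => ?_⟩,
          fun g a => (h3' g (f a)).trans (h3 g a), fun g a => ?_, fun r => ?_⟩
        · exact (congrArg f' (h2 a)).trans (h2' (f a))
        · exact (congrArg f' (h4 g a)).trans (h4' g (f a))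
        · exact (congrArg f' (h5 r)).trans (h5' r) }

/-- The isomorphism `R ≃ A_1` induced by `j`. -/
noncomputable def jEquiv (A : StrictCrossedExtension ρ) : R ≃ₐ[ℂ] A.crossed.one :=
  (AlgEquiv.ofInjective A.j A.j_injective).trans (Subalgebra.equivOfEq _ _ A.j_range)

/-- The character of `A_1` corresponding to a character of `R` under `R ≃ A_1`. -/
noncomputable def sim (A : StrictCrossedExtension ρ) (χ : R →ₐ[ℂ] ℂ) : A.crossed.Sim :=
  χ.comp (A.jEquiv.symm : A.crossed.one →ₐ[ℂ] R)

/-- `e χ g ∈ A_g`, for `χ` ranging over the characters of `R` fixed by `g`, form a basis of `A_g`,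
and `R` acts on `e χ g` through `χ` (so `e_χ e_χ'^g = e_χ'^g e_χ = δ_{χ,χ'} e_χ'^g` for the primitive
idempotents `e_χ` of `R`). The values `e χ g` for `χ` not fixed by `g` are irrelevant. -/
def IsAdaptedBasis (A : StrictCrossedExtension ρ) (e : (R →ₐ[ℂ] ℂ) → G → A.carrier) : Prop :=
  (∀ g : G, ∃ b : Module.Basis {χ : R →ₐ[ℂ] ℂ // simAct ρ g χ = χ} ℂ (A.crossed.comp g),
    ∀ χ, (b χ : A.carrier) = e χ g) ∧
  (∀ (g : G) (χ : R →ₐ[ℂ] ℂ), simAct ρ g χ = χ → ∀ r : R,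
    A.j r * e χ g = χ r • e χ g ∧ e χ g * A.j r = χ r • e χ g)

/-- `e_χ^g e_χ^h = φ(g,h) e_χ^{gh}` for `g`, `h` in the stabilizer of `χ`. -/
def HasProduct (A : StrictCrossedExtension ρ) (e : (R →ₐ[ℂ] ℂ) → G → A.carrier)
    (φ : G × G → Rˣ) : Prop :=
  ∀ (χ : R →ₐ[ℂ] ℂ) (g h : G), simAct ρ g χ = χ → simAct ρ h χ = χ →
    e χ g * e χ h = A.j (φ (g, h) : R) * e χ (g * h)

/-- `g(e_χ^h) = φ(g,h) / φ(ghg⁻¹,g) e_{gχ}^{ghg⁻¹}` for all `g` and all `h` in the stabilizer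
of `χ`. -/
def HasAction (A : StrictCrossedExtension ρ) (e : (R →ₐ[ℂ] ℂ) → G → A.carrier)
    (φ : G × G → Rˣ) : Prop :=
  ∀ (χ : R →ₐ[ℂ] ℂ) (g h : G), simAct ρ h χ = χ →
    (A.crossed.act g : A.carrier ≃ₐ[ℂ] A.carrier) (e χ h) =
      A.j ((φ (g, h) / φ (g * h * g⁻¹, g) : Rˣ) : R) * e (simAct ρ g χ) (g * h * g⁻¹)

/-- `(e_χ^g)⋆ = η(g) φ(g,g⁻¹)⁻¹ e_χ^{g⁻¹}` for `g` in the stabilizer of `χ`. -/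
def HasStar (A : StrictCrossedExtension ρ) (e : (R →ₐ[ℂ] ℂ) → G → A.carrier)
    (φ : G × G → Rˣ) (η : G → Rˣ) : Prop :=
  ∀ (χ : R →ₐ[ℂ] ℂ) (g : G), simAct ρ g χ = χ →
    star (e χ g) = A.j ((η g * (φ (g, g⁻¹))⁻¹ : Rˣ) : R) * e χ g⁻¹

end StrictCrossedExtension

/-- The set `Frob(G, R)` of isomorphism classes of strict `G`-crossed extensions of `R`. -/
def Frob (ρ : G →* frobAut R) : Type 1 := Quotient (StrictCrossedExtension.setoid ρ)

/-- The isomorphism class of a strict `G`-crossed extension. -/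
def Frob.mk {ρ : G →* frobAut R} (A : StrictCrossedExtension ρ) : Frob ρ :=
  Quotient.mk (StrictCrossedExtension.setoid ρ) A

/-! ### Cohomology with coefficients in `Rˣ` -/

/-- The action of `G` on the unit group `Rˣ` induced by `ρ`. -/
abbrev unitsAction (ρ : G →* frobAut R) : MulDistribMulAction G Rˣ :=
  MulDistribMulAction.compHom Rˣ ((frobAut R).subtype.comp ρ)

/-- The group cohomology `H²(G, Rˣ)`. -/
noncomputable abbrev H2Units (ρ : G →* frobAut R) : Type :=
  letI := unitsAction ρ
  groupCohomology.H2 (Rep.ofMulDistribMulAction G Rˣ)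

/-- `φ` is a 2-cocycle of `G` with values in `Rˣ`. -/
def IsUnitsCocycle (ρ : G →* frobAut R) (φ : G × G → Rˣ) : Prop :=
  letI := unitsAction ρ
  groupCohomology.IsMulCocycle₂ φ

/-- The class in `H²(G, Rˣ)` of a 2-cocycle. -/
noncomputable def H2Units.mk {ρ : G →* frobAut R} {φ : G × G → Rˣ} (hφ : IsUnitsCocycle ρ φ) :
    H2Units ρ :=
  letI := unitsAction ρ
  groupCohomology.H2π (Rep.ofMulDistribMulAction G Rˣ)
    (groupCohomology.cocyclesOfIsMulCocycle₂ (f := φ) hφ)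

/-- `φ(1,g) = φ(g,1) = 1` for all `g`. -/
def IsNormalizedCochain (φ : G × G → Rˣ) : Prop :=
  ∀ g : G, φ (1, g) = 1 ∧ φ (g, 1) = 1

/-- `η : G → Rˣ` takes positive values at all characters of `R` and satisfies
`φ(g,h) φ(g,h)⋆ = η(g) g(η(h)) / η(gh)`. -/
def IsPositiveTrivialization (ρ : G →* frobAut R) (φ : G × G → Rˣ) (η : G → Rˣ) : Prop :=
  (∀ (g : G) (χ : R →ₐ[ℂ] ℂ), ∃ t : ℝ, 0 < t ∧ χ (η g : R) = (t : ℂ)) ∧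
  (∀ g h : G, (φ (g, h) : R) * star (φ (g, h) : R) * (η (g * h) : R) =
    (η g : R) * (ρ g : R ≃ₐ[ℂ] R) (η h : R))

end Extensions

/-! ### Positivity in Frobenius ⋆-algebras -/

/-! Positivity of the form makes `R` reduced, so `R` is a product of copies of ℂ indexed by its
characters, and a unit of `R` is an arbitrary nowhere zero function on characters. In an extension
`A` the images `E χ` of the primitive idempotents are central and cut each `A_g` into isotypic
parts. If g moves χ, the part at χ vanishes, because `ab = g(b)a` and centrality give `E χ * a = E
(gχ) * a`. If g fixes χ, strictness makes it a line. For x ≠ 0 in a line, `x * star x` is a positive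
multiple of `E χ`, so products of nonzero elements of lines over the same χ do not vanish. After a
choice of generators, `A` is thus encoded by scalars: those of the products over the stabilizer of
χ, and those by which G permutes the generators.

A 2-cocycle of G in `Rˣ` is the same as a ℂˣ-valued 2-cocycle on the action groupoid of G on
characters, and this groupoid is equivalent to the disjoint union of one stabilizer per orbit. Two
explicit forms of Shapiro's lemma exploit this. `exists_actionCocycle_of_inertia` extends the
scalars of `A` to a groupoid cocycle that also describes the action.
`IsActionCocycle.exists_trivialization` shows that the class depends only on the restrictions to
stabilizers, hence only on the products in `A`.

The functional and the involution add no invariants. The first is determined on `A_1 = R`. For the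
second, `IsLineFamily.hasStar` compares the norms of the generators with η: their ratio is a
positive character of a finite group, hence 1. Therefore extensions of equal class are isomorphic
(`IsLineFamily.exists_isIso`).

Conversely, a cocycle φ defines a crossed product with `u_g u_h = φ(g,h) u_{gh}`, and the extension
is the centralizer of `R` in it, with G acting by conjugation by `u_g`. The involution `u_g⋆ = u_g⁻¹
η(g)` needs a positive η trivializing `φφ⋆`, obtained by averaging logarithms over G. -/

theorem exists_orthonormal_basis_of_pos {A : Type*} [Ring A] [Algebra ℂ A] [FiniteDimensional ℂ A]
    [StarRing A] (hsmul : ∀ (c : ℂ) (a : A), star (c • a) = (starRingEnd ℂ c) • star a)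
    (l : A →ₗ[ℂ] ℂ) (hstar : ∀ a : A, l (star a) = starRingEnd ℂ (l a))
    (hpos : ∀ a : A, a ≠ 0 → 0 < (l (a * star a)).re) :
    ∃ b : Module.Basis (Fin (Module.finrank ℂ A)) ℂ A,
      ∀ i k, l (b i * star (b k)) = if i = k then 1 else 0 := by
  -- The inner product is conjugate-linear in its first argument, hence the swapped order of `x` and
  -- `y`.
  let core : InnerProductSpace.Core ℂ A :=
    { inner := fun x y => l (y * star x)
      conj_inner_symm := fun x y => by rw [← hstar, star_mul, star_star]
      re_inner_nonneg := fun x => by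
        by_cases hx : x = 0
        · simp [hx]
        · exact (hpos x hx).le
      add_left := fun x y z => by rw [star_add, mul_add, map_add]
      smul_left := fun x y r => by rw [hsmul, mul_smul_comm, map_smul, smul_eq_mul]
      definite := fun x hx => by
        by_contra h
        have := hpos x h
        rw [show l (x * star x) = 0 from hx] at this
        simp at this }
  let _ : NormedAddCommGroup A := core.toNormedAddCommGroup
  let _ : InnerProductSpace ℂ A := InnerProductSpace.ofCore core.toCore
  refine ⟨(stdOrthonormalBasis ℂ A).toBasis, fun i k => ?_⟩
  have h := orthonormal_iff_ite.1 (stdOrthonormalBasis ℂ A).orthonormal k i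
  rw [OrthonormalBasis.coe_toBasis]
  refine Eq.trans ?_ (h.trans ?_)
  · rfl
  · simp only [eq_comm]

namespace FrobeniusStarAlgebra

instance (priority := 100) instFiniteDimensional (A : Type*) [Ring A] [Algebra ℂ A]
    [FrobeniusStarAlgebra A] : FiniteDimensional ℂ A := FrobeniusStarAlgebra.finiteDimensional

section

variable {A : Type*} [Ring A] [Algebra ℂ A] [FrobeniusStarAlgebra A]

theorem star_smul_conj (c : ℂ) (a : A) : star (c • a) = (starRingEnd ℂ c) • star a :=
  FrobeniusStarAlgebra.star_smul' c a

/-- In an orthonormal basis the value is the sum of the squared moduli of the coordinates. This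
turns the basis axiom into positive definiteness. -/
theorem lam_mul_star_self_eq (a : A) : ∃ t : ℝ, lam (a * star a) = t ∧ (a ≠ 0 → 0 < t) := by
  obtain ⟨b, hb⟩ := FrobeniusStarAlgebra.exists_orthonormal_basis (A := A)
  refine ⟨∑ i, Complex.normSq (b.repr a i), ?_, fun ha => ?_⟩
  · conv_lhs => rw [← b.sum_repr a]
    rw [star_sum, Finset.sum_mul, map_sum]
    push_cast
    refine Finset.sum_congr rfl fun i _ => ?_
    rw [Finset.mul_sum, map_sum, Finset.sum_eq_single i]
    · rw [star_smul_conj, smul_mul_smul_comm, map_smul, hb, if_pos rfl, smul_eq_mul, mul_one,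
        Complex.mul_conj]
    · intro k _ hk
      rw [star_smul_conj, smul_mul_smul_comm, map_smul, hb, if_neg hk.symm, smul_zero]
    · simp
  · obtain ⟨i, hi⟩ : ∃ i, b.repr a i ≠ 0 := by
      by_contra! h
      exact ha (b.repr.map_eq_zero_iff.1 (Finsupp.ext h))
    exact Finset.sum_pos' (fun i _ => Complex.normSq_nonneg _)
      ⟨i, Finset.mem_univ i, Complex.normSq_pos.2 hi⟩

/-- The squared norm `lam (a * star a)` of `a`. -/
noncomputable def sqNorm (a : A) : ℝ := (lam (a * star a)).re

theorem lam_mul_star_self (a : A) : lam (a * star a) = (sqNorm a : ℂ) := by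
  obtain ⟨t, ht, -⟩ := lam_mul_star_self_eq a
  rw [sqNorm, ht, Complex.ofReal_re]

theorem sqNorm_pos {a : A} (ha : a ≠ 0) : 0 < sqNorm a := by
  obtain ⟨t, ht, h⟩ := lam_mul_star_self_eq a
  rw [sqNorm, ht, Complex.ofReal_re]
  exact h ha

theorem mul_star_self_ne_zero {a : A} (ha : a ≠ 0) : a * star a ≠ 0 := fun h => by
  have := sqNorm_pos ha
  rw [sqNorm, h] at this
  simp at this

end

/-- The value at `χ` of a unit of `R`, as a unit of `ℂ`. -/
def unitVal {R : Type*} [CommRing R] [Algebra ℂ R] (χ : R →ₐ[ℂ] ℂ) : Rˣ →* ℂˣ := Units.map (χ : R →* ℂ)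

@[simp] theorem coe_unitVal {R : Type*} [CommRing R] [Algebra ℂ R] (χ : R →ₐ[ℂ] ℂ)
    (u : Rˣ) : (unitVal χ u : ℂ) = χ (u : R) := rfl

/-! ### Commutative Frobenius ⋆-algebras as products of copies of ℂ -/

section Commutative

variable {R : Type*} [CommRing R] [Algebra ℂ R] [FrobeniusStarAlgebra R]

/-- If a² = 0, then b = a a⋆ satisfies b b⋆ = a² (a⋆)² = 0, and definiteness kills first b, then a.
-/
theorem isReduced : IsReduced R := by
  rw [isReduced_iff_pow_one_lt 2 one_lt_two]
  intro a ha
  by_contra h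
  refine mul_star_self_ne_zero (mul_star_self_ne_zero h) ?_
  rw [star_mul, star_star]
  linear_combination (star a * star a) * ha

/-- The nilradical is zero, so some prime avoids r; over an Artinian ring it is maximal, and its
residue field, being finite over ℂ, is ℂ. -/
theorem exists_character_ne_zero {r : R} (hr : r ≠ 0) : ∃ χ : R →ₐ[ℂ] ℂ, χ r ≠ 0 := by
  have : IsReduced R := isReduced
  have : IsArtinianRing R := IsArtinianRing.of_finite ℂ R
  have hn : r ∉ nilradical R := by
    rw [nilradical_eq_zero]
    exact hr
  rw [nilradical_eq_sInf, Submodule.mem_sInf] at hn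
  push Not at hn
  obtain ⟨I, hI, hrI⟩ : ∃ I : Ideal R, I.IsPrime ∧ r ∉ I := hn
  have : I.IsMaximal := IsArtinianRing.isMaximal_of_isPrime I
  let _ : Field (R ⧸ I) := Ideal.Quotient.field I
  have hb : Function.Bijective (algebraMap ℂ (R ⧸ I)) :=
    IsAlgClosed.algebraMap_bijective_of_isIntegral
  let f : ℂ ≃ₐ[ℂ] R ⧸ I := AlgEquiv.ofBijective (Algebra.ofId ℂ (R ⧸ I)) hb
  refine ⟨(f.symm : (R ⧸ I) →ₐ[ℂ] ℂ).comp (Ideal.Quotient.mkₐ ℂ I), fun h => hrI ?_⟩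
  have h' : f.symm (Ideal.Quotient.mkₐ ℂ I r) = 0 := h
  rw [map_eq_zero_iff _ f.symm.injective] at h'
  exact Ideal.Quotient.eq_zero_iff_mem.1 h'

theorem ext_characters {r s : R} (h : ∀ χ : R →ₐ[ℂ] ℂ, χ r = χ s) : r = s := by
  by_contra hne
  obtain ⟨χ, hχ⟩ := exists_character_ne_zero (sub_ne_zero.2 hne)
  exact hχ (by rw [map_sub, h, sub_self])

noncomputable instance instFintypeCharacters : Fintype (R →ₐ[ℂ] ℂ) := Fintype.ofFinite _

/-- Lagrange interpolation on the finite set of characters: a product of elements each separating χ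
from one other character. -/
theorem exists_idempotent (χ : R →ₐ[ℂ] ℂ) :
    ∃ e : R, χ e = 1 ∧ ∀ χ' : R →ₐ[ℂ] ℂ, χ' ≠ χ → χ' e = 0 := by
  classical
  have h : ∀ χ' : R →ₐ[ℂ] ℂ, χ' ≠ χ → ∃ r : R, χ r = 1 ∧ χ' r = 0 := by
    intro χ' hne
    obtain ⟨r, hr⟩ : ∃ r, χ' r ≠ χ r := by
      by_contra! h
      exact hne (AlgHom.ext h)
    have hr' : χ r - χ' r ≠ 0 := sub_ne_zero.2 hr.symm
    refine ⟨(χ r - χ' r)⁻¹ • (r - algebraMap ℂ R (χ' r)), ?_, ?_⟩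
    · rw [map_smul, map_sub, AlgHom.commutes, smul_eq_mul]
      exact inv_mul_cancel₀ hr'
    · rw [map_smul, map_sub, AlgHom.commutes, smul_eq_mul]
      simp
  choose r hr hr' using h
  refine ⟨∏ χ' : {χ' : R →ₐ[ℂ] ℂ // χ' ≠ χ}, r χ'.1 χ'.2, ?_, fun χ' hne => ?_⟩
  · rw [map_prod]
    exact Finset.prod_eq_one fun χ' _ => hr _ _
  · rw [map_prod]
    exact Finset.prod_eq_zero (Finset.mem_univ ⟨χ', hne⟩) (hr' _ _)

/-- The primitive idempotent of `R` at the character `χ`. -/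
noncomputable def idem (χ : R →ₐ[ℂ] ℂ) : R := (exists_idempotent χ).choose

@[simp] theorem apply_idem_self (χ : R →ₐ[ℂ] ℂ) : χ (idem χ) = 1 :=
  (exists_idempotent χ).choose_spec.1

theorem apply_idem_of_ne {χ χ' : R →ₐ[ℂ] ℂ} (h : χ' ≠ χ) : χ' (idem χ) = 0 :=
  (exists_idempotent χ).choose_spec.2 χ' h

open Classical in
theorem apply_idem (χ χ' : R →ₐ[ℂ] ℂ) : χ' (idem χ) = if χ' = χ then 1 else 0 := by
  split_ifs with h
  · rw [h, apply_idem_self]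
  · exact apply_idem_of_ne h

theorem mul_idem (r : R) (χ : R →ₐ[ℂ] ℂ) : r * idem χ = χ r • idem χ := by
  refine ext_characters fun χ' => ?_
  rw [map_mul, map_smul, smul_eq_mul, apply_idem]
  split_ifs with h
  · rw [h]
  · simp

theorem idem_mul_self (χ : R →ₐ[ℂ] ℂ) : idem χ * idem χ = idem χ := by
  rw [mul_idem, apply_idem_self, one_smul]

theorem idem_mul_of_ne {χ χ' : R →ₐ[ℂ] ℂ} (h : χ ≠ χ') : idem χ * idem χ' = 0 := by
  rw [mul_idem, apply_idem_of_ne h.symm, zero_smul]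

theorem idem_ne_zero (χ : R →ₐ[ℂ] ℂ) : idem χ ≠ 0 := fun h => by
  have := apply_idem_self χ
  rw [h, map_zero] at this
  exact zero_ne_one this

theorem sum_smul_idem (f : (R →ₐ[ℂ] ℂ) → ℂ) (χ : R →ₐ[ℂ] ℂ) :
    χ (∑ χ', f χ' • idem χ') = f χ := by
  rw [map_sum, Finset.sum_eq_single χ]
  · rw [map_smul, apply_idem_self, smul_eq_mul, mul_one]
  · intro χ' _ h
    rw [map_smul, apply_idem_of_ne h.symm, smul_zero]
  · simp

theorem eq_sum_idem (r : R) : r = ∑ χ : R →ₐ[ℂ] ℂ, χ r • idem χ :=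
  ext_characters fun χ => (sum_smul_idem (fun χ' => χ' r) χ).symm

theorem sum_idem : ∑ χ : R →ₐ[ℂ] ℂ, idem χ = 1 := by
  rw [eq_sum_idem (1 : R)]
  simp

theorem exists_unit_apply (f : (R →ₐ[ℂ] ℂ) → ℂˣ) : ∃ u : Rˣ, ∀ χ, χ (u : R) = f χ := by
  refine ⟨⟨∑ χ, (f χ : ℂ) • idem χ, ∑ χ, ((f χ)⁻¹ : ℂˣ) • idem χ, ?_, ?_⟩, fun χ => ?_⟩
  · refine ext_characters fun χ => ?_
    rw [map_mul, sum_smul_idem (fun χ => (f χ : ℂ)), map_one]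
    have := sum_smul_idem (fun χ => ((f χ)⁻¹ : ℂˣ)) χ
    rw [show χ (∑ χ, (f χ)⁻¹ • idem χ) = ((f χ)⁻¹ : ℂˣ) from this, Units.mul_inv]
  · refine ext_characters fun χ => ?_
    rw [map_mul, sum_smul_idem (fun χ => (f χ : ℂ)), map_one]
    have := sum_smul_idem (fun χ => ((f χ)⁻¹ : ℂˣ)) χ
    rw [show χ (∑ χ, (f χ)⁻¹ • idem χ) = ((f χ)⁻¹ : ℂˣ) from this, Units.inv_mul]
  · exact sum_smul_idem (fun χ => (f χ : ℂ)) χ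

theorem unit_ext {u v : Rˣ} (h : ∀ χ : R →ₐ[ℂ] ℂ, unitVal χ u = unitVal χ v) : u = v :=
  Units.ext (ext_characters fun χ => congrArg Units.val (h χ))

theorem exists_unit (f : (R →ₐ[ℂ] ℂ) → ℂˣ) : ∃ u : Rˣ, ∀ χ, unitVal χ u = f χ := by
  obtain ⟨u, hu⟩ := exists_unit_apply f
  exact ⟨u, fun χ => Units.ext (hu χ)⟩

/-- The character `r ↦ conj (χ (star r))`. -/
noncomputable def conjChar (χ : R →ₐ[ℂ] ℂ) : R →ₐ[ℂ] ℂ where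
  toFun r := starRingEnd ℂ (χ (star r))
  map_one' := by simp
  map_mul' a b := by simp
  map_zero' := by simp
  map_add' a b := by simp
  commutes' c := by
    rw [Algebra.algebraMap_eq_smul_one, star_smul_conj, star_one, map_smul, map_one]
    simp

theorem conjChar_apply (χ : R →ₐ[ℂ] ℂ) (r : R) :
    conjChar χ r = starRingEnd ℂ (χ (star r)) := rfl

/-- Positivity prevents `⋆` from permuting the characters: if `conjChar χ` differed from χ, then
`idem χ * star (idem χ)` would vanish at every character. -/
theorem apply_star (χ : R →ₐ[ℂ] ℂ) (r : R) : χ (star r) = starRingEnd ℂ (χ r) := by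
  have h : conjChar χ = χ := by
    by_contra hne
    refine mul_star_self_ne_zero (idem_ne_zero χ) (ext_characters fun χ' => ?_)
    rw [map_mul, map_zero]
    by_cases hχ : χ' = χ
    · have h0 := conjChar_apply χ (idem χ)
      rw [apply_idem_of_ne hne] at h0
      rw [hχ, (map_eq_zero (starRingEnd ℂ)).1 h0.symm, mul_zero]
    · rw [apply_idem_of_ne hχ, zero_mul]
  have h2 := conjChar_apply χ r
  rw [h] at h2
  rw [h2, Complex.conj_conj]

theorem star_idem (χ : R →ₐ[ℂ] ℂ) : star (idem χ) = idem χ := by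
  refine ext_characters fun χ' => ?_
  rw [apply_star, apply_idem]
  split_ifs <;> simp

theorem lam_idem (χ : R →ₐ[ℂ] ℂ) : lam (idem χ) = (sqNorm (idem χ) : ℂ) := by
  rw [← lam_mul_star_self, star_idem, idem_mul_self]

theorem lam_idem_ne_zero (χ : R →ₐ[ℂ] ℂ) : lam (idem χ) ≠ 0 := by
  rw [lam_idem]
  exact_mod_cast (sqNorm_pos (idem_ne_zero χ)).ne'

end Commutative

end FrobeniusStarAlgebra

open FrobeniusStarAlgebra

/-! ### The action of G on the characters of R -/

section SimAct

variable {G R : Type} [Group G] [CommRing R] [Algebra ℂ R] [FrobeniusStarAlgebra R]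
  (ρ : G →* frobAut R)

theorem simAct_apply (g : G) (χ : R →ₐ[ℂ] ℂ) (r : R) :
    simAct ρ g χ r = χ ((ρ g⁻¹ : R ≃ₐ[ℂ] R) r) := rfl

/-- The action of `G` on the characters of `R`. -/
@[reducible] def simMulAction : MulAction G (R →ₐ[ℂ] ℂ) where
  smul := simAct ρ
  one_smul χ := AlgHom.ext fun r => by
    change simAct ρ 1 χ r = χ r
    rw [simAct_apply, inv_one, map_one]
    rfl
  mul_smul g h χ := AlgHom.ext fun r => by
    change simAct ρ (g * h) χ r = simAct ρ g (simAct ρ h χ) r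
    rw [simAct_apply, simAct_apply, simAct_apply, mul_inv_rev, map_mul]
    rfl

theorem simAct_one (χ : R →ₐ[ℂ] ℂ) : simAct ρ 1 χ = χ := (simMulAction ρ).one_smul χ

theorem simAct_mul (g h : G) (χ : R →ₐ[ℂ] ℂ) :
    simAct ρ (g * h) χ = simAct ρ g (simAct ρ h χ) := (simMulAction ρ).mul_smul g h χ

theorem apply_act (g : G) (χ : R →ₐ[ℂ] ℂ) (r : R) :
    χ ((ρ g : R ≃ₐ[ℂ] R) r) = simAct ρ g⁻¹ χ r := by
  rw [simAct_apply, inv_inv]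

theorem simAct_inv_eq {g : G} {χ χ' : R →ₐ[ℂ] ℂ} : simAct ρ g⁻¹ χ = χ' ↔ χ = simAct ρ g χ' := by
  let _ := simMulAction ρ
  exact inv_smul_eq_iff (g := g) (a := χ) (b := χ')

theorem simAct_inv_fixed {g : G} {χ : R →ₐ[ℂ] ℂ} (h : simAct ρ g χ = χ) : simAct ρ g⁻¹ χ = χ :=
  (simAct_inv_eq ρ).2 h.symm

theorem simAct_mul_fixed {g h : G} {χ : R →ₐ[ℂ] ℂ} (hg : simAct ρ g χ = χ)
    (hh : simAct ρ h χ = χ) : simAct ρ (g * h) χ = χ := by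
  rw [simAct_mul, hh, hg]

theorem simAct_conj_fixed (g : G) {h : G} {χ : R →ₐ[ℂ] ℂ} (hh : simAct ρ h χ = χ) :
    simAct ρ (g * h * g⁻¹) (simAct ρ g χ) = simAct ρ g χ := by
  rw [← simAct_mul, inv_mul_cancel_right, simAct_mul, hh]

theorem act_idem (g : G) (χ : R →ₐ[ℂ] ℂ) : (ρ g : R ≃ₐ[ℂ] R) (idem χ) = idem (simAct ρ g χ) := by
  classical
  refine ext_characters fun χ' => ?_
  rw [apply_act, apply_idem, apply_idem]
  simp only [simAct_inv_eq]

end SimAct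

/-! ### 2-cocycles on the action groupoid of a `G`-set -/

section GroupoidCocycle

variable {G X M : Type*} [Group G] [MulAction G X] [CommGroup M]

/-- A 2-cocycle with values in `M` on the action groupoid of the `G`-set `X`. -/
def IsActionCocycle (f : X → G → G → M) : Prop :=
  ∀ x g h k, f x (g * h) k * f x g h = f (g⁻¹ • x) h k * f x g (h * k)

variable (G X) in
-- `r x` represents the orbit of x and `t x` transports it to x. The element t(x)⁻¹ g t(g⁻¹x) then
-- fixes `r x`, which retracts the action groupoid onto stabilizers of representatives.
theorem exists_orbit_section : ∃ (r : X → X) (t : X → G),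
    (∀ x, t x • r x = x) ∧ ∀ (g : G) (x : X), r (g • x) = r x := by
  have h : ∀ x : X, ∃ g : G, g • (Quotient.out (Quotient.mk (MulAction.orbitRel G X) x)) = x := by
    intro x
    have h1 : (MulAction.orbitRel G X).r x
        (Quotient.out (Quotient.mk (MulAction.orbitRel G X) x)) :=
      Quotient.exact (Quotient.out_eq (Quotient.mk (MulAction.orbitRel G X) x)).symm
    exact h1
  choose t ht using h
  refine ⟨_, t, ht, fun g x => ?_⟩
  have : Quotient.mk (MulAction.orbitRel G X) (g • x) = Quotient.mk (MulAction.orbitRel G X) x :=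
    Quotient.sound ⟨g, rfl⟩
  rw [this]

/-- An action groupoid cocycle that is trivial on all stabilizers is a coboundary. -/
theorem IsActionCocycle.exists_trivialization {f : X → G → G → M} (hf : IsActionCocycle f)
    (htriv : ∀ x g h, g • x = x → h • x = x → f x g h = 1) :
    ∃ τ : X → G → M, ∀ x g h, f x g h * τ x (g * h) = τ x g * τ (g⁻¹ • x) h := by
  obtain ⟨r, t, ht, hr⟩ := exists_orbit_section G X
  have ht' : ∀ x, (t x)⁻¹ • x = r x := fun x => inv_smul_eq_iff.2 (ht x).symm
  -- With σ = t(x)⁻¹ g t(g⁻¹x) in the stabilizer of `r x`, the cochain compares the two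
  -- factorizations g · t(g⁻¹x) = t(x) · σ of one arrow.
  refine ⟨fun x g => f x g (t (g⁻¹ • x)) / f x (t x) ((t x)⁻¹ * g * t (g⁻¹ • x)),
    fun x g h => ?_⟩
  have hx : (g * h)⁻¹ • x = h⁻¹ • g⁻¹ • x := by rw [mul_inv_rev, mul_smul]
  dsimp only
  rw [hx]
  set x' := g⁻¹ • x with hx'
  set x'' := h⁻¹ • x' with hx''
  have hgx : g • x' = x := by simp [x']
  have hhx : h • x'' = x' := by simp [x'']
  have hrx : r x' = r x := hr _ _
  have hrx' : r x'' = r x := (hr _ _).trans hrx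
  have e1 := hf x g h (t x'')
  have e2 := hf x g (t x') ((t x')⁻¹ * h * t x'')
  have e3 := hf x (t x) ((t x)⁻¹ * g * t x') ((t x')⁻¹ * h * t x'')
  -- Triviality on stabilizers enters only here, at the representative `r x`.
  have e4 : f (r x) ((t x)⁻¹ * g * t x') ((t x')⁻¹ * h * t x'') = 1 := by
    apply htriv
    · rw [mul_smul, mul_smul, ← hrx, ht, hgx, ht', hrx]
    · rw [mul_smul, mul_smul, ← hrx', ht, hhx, ht', hrx', hrx]
  have a1 : t x * ((t x)⁻¹ * g * t x') = g * t x' := by group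
  have a2 : t x' * ((t x')⁻¹ * h * t x'') = h * t x'' := by group
  have a3 : (t x)⁻¹ * g * t x' * ((t x')⁻¹ * h * t x'') = (t x)⁻¹ * (g * h) * t x'' := by group
  rw [a1, a3, ht', e4, one_mul] at e3
  rw [a2, ← hx'] at e2
  rw [← hx'] at e1
  apply Additive.ofMul.injective
  replace e1 := congrArg Additive.ofMul e1
  replace e2 := congrArg Additive.ofMul e2
  replace e3 := congrArg Additive.ofMul e3
  simp only [ofMul_mul, ofMul_div] at *
  linear_combination (norm := module) e1 - e2 + e3

/-- Compatible cocycles on the stabilizers and a compatible action of `G` on a family of lines over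
the inertia groupoid come from an action groupoid cocycle. -/
theorem exists_actionCocycle_of_inertia (c : X → G → G → M) (m : X → G → G → M)
    (hc : ∀ x g h k, g • x = x → h • x = x → k • x = x →
      c x (g * h) k * c x g h = c x h k * c x g (h * k))
    (hc1 : ∀ x g, g • x = x → c x 1 g = 1 ∧ c x g 1 = 1)
    (hm1 : ∀ x g, m x g 1 = 1)
    (hmm : ∀ x g g' h, h • x = x →
      m x (g * g') h = m x g' h * m (g' • x) g (g' * h * g'⁻¹))
    (hmc : ∀ x g h k, h • x = x → k • x = x →
      m x g (h * k) * c x h k = m x g h * m x g k * c (g • x) (g * h * g⁻¹) (g * k * g⁻¹))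
    (hcr : ∀ x g h, g • x = x → h • x = x → c x g h = m x g h * c x (g * h * g⁻¹) g) :
    ∃ f : X → G → G → M, IsActionCocycle f ∧
      (∀ x g h, g • x = x → h • x = x → f x g h = c x g h) ∧
      (∀ x g h, h • x = x → m x g h * f (g • x) (g * h * g⁻¹) g = f (g • x) g h) ∧
      (∀ x g, f x 1 g = 1 ∧ f x g 1 = 1) := by
  classical
  obtain ⟨r, t, ht, hr⟩ := exists_orbit_section G X
  have ht' : ∀ x, (t x)⁻¹ • x = r x := fun x => inv_smul_eq_iff.2 (ht x).symm
  have hr' : ∀ (g : G) x, r (g⁻¹ • x) = r x := fun g x => hr _ _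
  -- `σ` retracts arrows into the stabilizer of the representative. `μ x g` is the scalar by which
  -- transport along `t x` carries the generator at `r x` to the one at x; it defaults to 1 if g
  -- does not fix x.
  let σ : G → X → G := fun g x => (t x)⁻¹ * g * t (g⁻¹ • x)
  let μ : X → G → M := fun x g => if g • x = x then m (r x) (t x) ((t x)⁻¹ * g * t x) else 1
  have hσ : ∀ g x, σ g x • r x = r x := by
    intro g x
    change ((t x)⁻¹ * g * t (g⁻¹ • x)) • r x = r x
    rw [mul_smul, mul_smul, ← hr' g, ht, smul_inv_smul, ht', hr']
  have hσm : ∀ g h x, σ (g * h) x = σ g x * σ h (g⁻¹ • x) := by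
    intro g h x
    simp only [σ, mul_inv_rev, mul_smul]
    group
  have hσf : ∀ g x, g • x = x → σ g x = (t x)⁻¹ * g * t x := by
    intro g x h
    simp only [σ]
    rw [inv_smul_eq_iff.2 h.symm]
  have hσ1 : ∀ x, σ 1 x = 1 := by
    intro x
    simp [σ]
  have hμ1 : ∀ x, μ x 1 = 1 := by
    intro x
    simp [μ, hm1]
  -- Pull `c` back along the retraction and divide by the coboundary of `μ`; on stabilizers this
  -- undoes the change of generators caused by transport.
  refine ⟨fun x g h => c (r x) (σ g x) (σ h (g⁻¹ • x)) * μ x (g * h) / (μ x g * μ (g⁻¹ • x) h),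
    ?_, ?_, ?_, ?_⟩
  · intro x g h k
    have e := hc (r x) (σ g x) (σ h (g⁻¹ • x)) (σ k (h⁻¹ • g⁻¹ • x)) (hσ _ _)
      (by rw [← hr' g]; exact hσ _ _)
      (by rw [← hr' g, ← hr' h]; exact hσ _ _)
    have hx : (g * h)⁻¹ • x = h⁻¹ • g⁻¹ • x := by rw [mul_inv_rev, mul_smul]
    dsimp only
    rw [hx, hσm, hσm, hr', mul_assoc g h k]
    apply Additive.ofMul.injective
    replace e := congrArg Additive.ofMul e
    simp only [ofMul_mul, ofMul_div] at *
    linear_combination (norm := module) e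
  · intro x g h hg hh
    have hgh : (g * h) • x = x := by rw [mul_smul, hh, hg]
    have hgi : g⁻¹ • x = x := inv_smul_eq_iff.2 hg.symm
    dsimp only
    rw [hgi, hσf g x hg, hσf h x hh]
    simp only [μ, if_pos hg, if_pos hh, if_pos hgh]
    have f1 : ∀ k : G, k • x = x → ((t x)⁻¹ * k * t x) • r x = r x := by
      intro k hk
      rw [mul_smul, mul_smul, ht, hk, ht']
    have e := hmc (r x) (t x) ((t x)⁻¹ * g * t x) ((t x)⁻¹ * h * t x) (f1 g hg) (f1 h hh)
    have a1 : (t x)⁻¹ * g * t x * ((t x)⁻¹ * h * t x) = (t x)⁻¹ * (g * h) * t x := by group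
    have a2 : ∀ k, t x * ((t x)⁻¹ * k * t x) * (t x)⁻¹ = k := fun k => by group
    rw [a1, a2, a2, ht] at e
    apply Additive.ofMul.injective
    replace e := congrArg Additive.ofMul e
    simp only [ofMul_mul, ofMul_div] at *
    linear_combination (norm := module) e
  · intro x g h hh
    have hhi : h⁻¹ • x = x := inv_smul_eq_iff.2 hh.symm
    have hgh : (g * h * g⁻¹) • g • x = g • x := by
      rw [← mul_smul, inv_mul_cancel_right, mul_smul, hh]
    have hghi : (g * h * g⁻¹)⁻¹ • g • x = g • x := inv_smul_eq_iff.2 hgh.symm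
    dsimp only
    rw [inv_smul_smul, hghi, hσf _ _ hgh, hσf h x hh, inv_mul_cancel_right, hr]
    have hσg : σ g (g • x) = (t (g • x))⁻¹ * g * t x := by
      simp only [σ, inv_smul_smul]
    rw [hσg]
    simp only [μ, if_pos hgh, if_pos hh, hr]
    have f1 : ((t x)⁻¹ * h * t x) • r x = r x := by
      rw [mul_smul, mul_smul, ht, hh, ht']
    have f2 : ((t (g • x))⁻¹ * g * t x) • r x = r x := by
      rw [mul_smul, mul_smul, ht, ht', hr]
    have e1 := hcr (r x) ((t (g • x))⁻¹ * g * t x) ((t x)⁻¹ * h * t x) f2 f1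
    have e2 := hmm (r x) g (t x) ((t x)⁻¹ * h * t x) f1
    have e3 := hmm (r x) (t (g • x)) ((t (g • x))⁻¹ * g * t x) ((t x)⁻¹ * h * t x) f1
    have a1 : (t (g • x))⁻¹ * g * t x * ((t x)⁻¹ * h * t x) * ((t (g • x))⁻¹ * g * t x)⁻¹ =
      (t (g • x))⁻¹ * (g * h * g⁻¹) * t (g • x) := by group
    have a2 : t x * ((t x)⁻¹ * h * t x) * (t x)⁻¹ = h := by group
    have a3 : t (g • x) * ((t (g • x))⁻¹ * g * t x) = g * t x := by group
    rw [a1] at e1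
    rw [a2, ht] at e2
    rw [a1, a3, f2] at e3
    apply Additive.ofMul.injective
    replace e1 := congrArg Additive.ofMul e1
    replace e2 := congrArg Additive.ofMul e2
    replace e3 := congrArg Additive.ofMul e3
    simp only [ofMul_mul, ofMul_div] at *
    linear_combination (norm := module) e3 - e2 - e1
  · intro x g
    dsimp only
    constructor
    · rw [hσ1, hμ1, one_mul, inv_one, one_smul, (hc1 _ _ (hσ _ _)).1]
      simp
    · rw [hσ1, hμ1, mul_one, (hc1 _ _ (hσ _ _)).2]
      simp

end GroupoidCocycle

/-! ### The partial action in terms of isotypic lines -/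

namespace CrossedFrobeniusStarAlgebra

variable {G : Type*} [Group G] {A : Type*} [Ring A] [Algebra ℂ A] [FrobeniusStarAlgebra A]

/-- `A_g ⊗ ℂ_χ` is isomorphic to `ℂ_χ` if and only if the `χ`-isotypic part of `A_g` is a line. -/
theorem partialAction_iso_iff (C : CrossedFrobeniusStarAlgebra G A) (g : G) (χ : C.Sim)
    {E : C.one} (hE : χ E = 1) (hmul : ∀ s : C.one, s * E = χ s • E) :
    Nonempty (C.PartialAction g χ ≃ₗ[C.one] C.SimpleModule χ) ↔
      ∃ v ∈ C.comp g, v ≠ 0 ∧ (E : A) * v = v ∧ ∀ m ∈ C.comp g, ∃ c : ℂ, (E : A) * m = c • v := by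
  have hsm : ∀ (s : C.one) (a : A), (s : A) * ((E : A) * a) = χ s • ((E : A) * a) := by
    intro s a
    rw [← mul_assoc, ← smul_mul_assoc]
    exact congrArg (fun x : C.one => (x : A) * a) (hmul s)
  constructor
  · rintro ⟨φ⟩
    -- The map m ⊗ d ↦ d E m carries the tensor product into the isotypic part of `A_g`; the image
    -- of the generator `φ.symm one` serves as v.
    let L : C.PartialAction g χ →ₗ[C.one] C.compModule g := TensorProduct.lift
      (LinearMap.mk₂ C.one (fun (m : C.compModule g) (d : C.SimpleModule χ) =>
          (⟨(show ℂ from d) • ((E : A) * m), (C.comp g).smul_mem _ (E • m).2⟩ : C.compModule g))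
        (fun m₁ m₂ d => Subtype.ext (by
          change (show ℂ from d) • ((E : A) * (m₁ + m₂)) = _
          rw [mul_add, smul_add]; rfl))
        (fun s m d => Subtype.ext (by
          change (show ℂ from d) • ((E : A) * (s * m)) = (s : A) * ((show ℂ from d) • ((E : A) * m))
          rw [mul_smul_comm, ← mul_assoc, ← mul_assoc, C.one_comm E.2]))
        (fun m d₁ d₂ => Subtype.ext (add_smul (show ℂ from d₁) (show ℂ from d₂) ((E : A) * m)))
        (fun s m d => Subtype.ext (by
          change (χ s * (show ℂ from d)) • ((E : A) * m) =
            (s : A) * ((show ℂ from d) • ((E : A) * m))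
          rw [mul_smul_comm, hsm, smul_smul, mul_comm])))
    have hL : ∀ (m : C.compModule g) (d : C.SimpleModule χ),
        (L (m ⊗ₜ d) : A) = (show ℂ from d) • ((E : A) * m) := fun m d => rfl
    let one : C.SimpleModule χ := (1 : ℂ)
    have key : ∀ z, z = (algebraMap ℂ C.one (show ℂ from φ z)) • φ.symm one := by
      intro z
      apply φ.injective
      rw [map_smul, LinearEquiv.apply_symm_apply]
      change φ z = (χ (algebraMap ℂ C.one (show ℂ from φ z)) * (1 : ℂ) : ℂ)
      rw [AlgHom.commutes, mul_one]
      rfl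
    have hEz : E • φ.symm one = φ.symm one := by
      rw [← map_smul]
      refine congrArg _ ?_
      change (χ E * (1 : ℂ) : ℂ) = (1 : ℂ)
      rw [hE, mul_one]
    have hm : ∀ m : C.compModule g, ∃ c : ℂ, (E : A) * m = c • (L (φ.symm one) : A) := by
      intro m
      refine ⟨show ℂ from φ (m ⊗ₜ one), ?_⟩
      have h1 := congrArg (fun z => (L z : A)) (key (m ⊗ₜ one))
      simp only [hL, map_smul] at h1
      rw [← one_smul ℂ ((E : A) * m)]
      refine h1.trans ?_
      exact (Algebra.smul_def (show ℂ from φ (m ⊗ₜ one)) (L (φ.symm one) : A)).symm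
    refine ⟨L (φ.symm one), (L _).2, fun h0 => ?_, ?_, fun m hm' => hm ⟨m, hm'⟩⟩
    -- If the generator had image 0, then E would kill `A_g`; since E acts as 1 on the simple
    -- module, moving it across the tensor sign makes every tensor vanish.
    · have hz : ∀ z : C.PartialAction g χ, z = 0 := by
        intro z
        induction z using TensorProduct.induction_on with
        | zero => rfl
        | add x y hx hy => rw [hx, hy, add_zero]
        | tmul m d =>
          obtain ⟨c, hc⟩ := hm m
          have h2 : E • m = 0 := Subtype.ext (by
            change (E : A) * m = 0
            rw [hc, h0, smul_zero])
          have h3 : E • d = d := by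
            change χ E * (show ℂ from d) = (show ℂ from d)
            rw [hE, one_mul]
          rw [← h3, ← TensorProduct.smul_tmul, h2, TensorProduct.zero_tmul]
      have h1 : one = φ 0 := by rw [← hz (φ.symm one), LinearEquiv.apply_symm_apply]
      rw [map_zero] at h1
      exact one_ne_zero (α := ℂ) h1
    · have := congrArg (fun z => (L z : A)) hEz
      simp only [map_smul] at this
      exact this
  · rintro ⟨v, hv, hv0, hEv, hvm⟩
    have hc0 : lam (v * star v) ≠ 0 := by
      rw [lam_mul_star_self]
      exact_mod_cast (sqNorm_pos hv0).ne'
    -- The coordinate along v is written through the Hermitian form, so that its linearity in m is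
    -- evident.
    let c : A → ℂ := fun m => lam ((E : A) * m * star v) / lam (v * star v)
    have hc : ∀ m ∈ C.comp g, (E : A) * m = c m • v := by
      intro m hm
      obtain ⟨d, hd⟩ := hvm m hm
      have : c m = d := by
        change lam ((E : A) * m * star v) / lam (v * star v) = d
        rw [hd, smul_mul_assoc, map_smul, smul_eq_mul, mul_div_assoc, div_self hc0, mul_one]
      rw [hd, this]
    have hcs : ∀ (s : C.one) (m : A), c (s * m) = χ s * c m := by
      intro s m
      have : (E : A) * (s * m) = χ s • ((E : A) * m) := by
        rw [← hsm, ← mul_assoc, ← mul_assoc, C.one_comm E.2]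
      change lam ((E : A) * (s * m) * star v) / lam (v * star v) =
        χ s * (lam ((E : A) * m * star v) / lam (v * star v))
      rw [this, smul_mul_assoc, map_smul, smul_eq_mul, mul_div_assoc]
    have hca : ∀ m m' : A, c (m + m') = c m + c m' := by
      intro m m'
      change lam ((E : A) * (m + m') * star v) / lam (v * star v) =
        lam ((E : A) * m * star v) / lam (v * star v) +
        lam ((E : A) * m' * star v) / lam (v * star v)
      rw [mul_add, add_mul, map_add, add_div]
    have hcv : c v = 1 := by
      change lam ((E : A) * v * star v) / lam (v * star v) = 1
      rw [hEv, div_self hc0]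
    let f : C.PartialAction g χ →ₗ[C.one] C.SimpleModule χ := TensorProduct.lift
      (LinearMap.mk₂ C.one (fun (m : C.compModule g) (d : C.SimpleModule χ) =>
          (show C.SimpleModule χ from (c m * (show ℂ from d) : ℂ)))
        (fun m₁ m₂ d => by
          change c (m₁ + m₂) * (show ℂ from d) = c m₁ * (show ℂ from d) + c m₂ * (show ℂ from d)
          rw [hca, add_mul])
        (fun s m d => by
          change c (s * m) * (show ℂ from d) = χ s * (c m * (show ℂ from d))
          rw [hcs, mul_assoc])
        (fun m d₁ d₂ => mul_add (c m) (show ℂ from d₁) (show ℂ from d₂))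
        (fun s m d => mul_left_comm (c m) (χ s) (show ℂ from d)))
    have hf : ∀ (m : C.compModule g) (d : C.SimpleModule χ),
        f (m ⊗ₜ d) = (c m * (show ℂ from d) : ℂ) := fun m d => rfl
    refine ⟨LinearEquiv.ofLinearMap f (TensorProduct.mk C.one (C.compModule g) (C.SimpleModule χ)
      ⟨v, hv⟩) ?_ ?_⟩
    · refine LinearMap.ext fun d => ?_
      change (c v * (show ℂ from d) : ℂ) = d
      rw [hcv, one_mul]
    · refine TensorProduct.ext' fun m d => ?_
      change (⟨v, hv⟩ : C.compModule g) ⊗ₜ[C.one] (f (m ⊗ₜ d)) = m ⊗ₜ d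
      have h1 : f (m ⊗ₜ d) = (algebraMap ℂ C.one (c m)) • d := by
        change (c m * (show ℂ from d) : ℂ) = χ (algebraMap ℂ C.one (c m)) * (show ℂ from d)
        rw [AlgHom.commutes]
        rfl
      have h2 : (algebraMap ℂ C.one (c m)) • (⟨v, hv⟩ : C.compModule g) = E • m :=
        Subtype.ext (by
          change (algebraMap ℂ A (c m)) * v = (E : A) * m
          rw [hc m m.2, ← Algebra.smul_def])
      have h3 : E • d = d := by
        change χ E * (show ℂ from d) = (show ℂ from d)
        rw [hE, one_mul]
      rw [h1, ← TensorProduct.smul_tmul, h2, TensorProduct.smul_tmul, h3]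

end CrossedFrobeniusStarAlgebra

/-! ### Isotypic lines of a strict extension -/

namespace StrictCrossedExtension

variable {G R : Type} [Group G] [CommRing R] [Algebra ℂ R] [FrobeniusStarAlgebra R]
  {ρ : G →* frobAut R} (A : StrictCrossedExtension ρ)

theorem j_mem (r : R) : A.j r ∈ A.crossed.comp 1 := by
  have h : A.j r ∈ A.crossed.one := by
    rw [← A.j_range]
    exact ⟨r, rfl⟩
  exact h

theorem exists_j_eq {x : A.carrier} (hx : x ∈ A.crossed.comp 1) : ∃ r, A.j r = x := by
  have h : x ∈ A.j.range := by
    rw [A.j_range]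
    exact hx
  exact h

theorem j_comm (r : R) (x : A.carrier) : A.j r * x = x * A.j r := A.crossed.one_comm (A.j_mem r) x

theorem sim_apply (χ : R →ₐ[ℂ] ℂ) (r : R) (s : A.crossed.one) (h : (s : A.carrier) = A.j r) :
    A.sim χ s = χ r := by
  have : s = A.jEquiv r := Subtype.ext h
  rw [this]
  exact congrArg χ (A.jEquiv.symm_apply_apply r)

theorem sim_fixed_iff (g : G) (χ : R →ₐ[ℂ] ℂ) :
    (A.sim χ).comp (A.crossed.actOne g⁻¹) = A.sim χ ↔ simAct ρ g χ = χ := by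
  have h1 : ∀ r, A.sim χ (A.crossed.actOne g⁻¹ (A.jEquiv r)) = simAct ρ g χ r := fun r =>
    A.sim_apply χ ((ρ g⁻¹ : R ≃ₐ[ℂ] R) r) _ (A.j_act g⁻¹ r)
  constructor
  · intro h
    refine AlgHom.ext fun r => ?_
    rw [← h1, ← A.sim_apply χ r (A.jEquiv r) rfl]
    exact DFunLike.congr_fun h (A.jEquiv r)
  · intro h
    refine AlgHom.ext fun s => ?_
    obtain ⟨r, rfl⟩ := A.jEquiv.surjective s
    rw [A.sim_apply χ r (A.jEquiv r) rfl, ← h]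
    rw [← h1, h]
    rfl

/-- The image of the primitive idempotent at `χ`. -/
noncomputable def E (χ : R →ₐ[ℂ] ℂ) : A.carrier := A.j (idem χ)

theorem E_mem (χ : R →ₐ[ℂ] ℂ) : A.E χ ∈ A.crossed.comp 1 := A.j_mem _

theorem E_comm (χ : R →ₐ[ℂ] ℂ) (x : A.carrier) : A.E χ * x = x * A.E χ := A.j_comm _ x

theorem E_mul_self (χ : R →ₐ[ℂ] ℂ) : A.E χ * A.E χ = A.E χ := by
  rw [E, ← map_mul, idem_mul_self]

theorem E_mul_of_ne {χ χ' : R →ₐ[ℂ] ℂ} (h : χ ≠ χ') : A.E χ * A.E χ' = 0 := by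
  rw [E, E, ← map_mul, idem_mul_of_ne h, map_zero]

theorem j_mul_E (χ : R →ₐ[ℂ] ℂ) (r : R) : A.j r * A.E χ = χ r • A.E χ := by
  rw [E, ← map_mul, mul_idem, map_smul]

theorem sum_E : ∑ χ, A.E χ = 1 := by
  simp only [E]
  rw [← map_sum, sum_idem, map_one]

theorem star_E (χ : R →ₐ[ℂ] ℂ) : star (A.E χ) = A.E χ := by
  have h : A.j (star (idem χ)) = star (A.j (idem χ)) := A.j_hom.2 _
  rw [star_idem] at h
  exact h.symm

theorem lam_E (χ : R →ₐ[ℂ] ℂ) : lam (A.E χ) = lam (idem χ) := A.j_hom.1 _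

theorem lam_E_ne_zero (χ : R →ₐ[ℂ] ℂ) : lam (A.E χ) ≠ 0 := by
  rw [lam_E]
  exact lam_idem_ne_zero χ

theorem E_ne_zero (χ : R →ₐ[ℂ] ℂ) : A.E χ ≠ 0 := fun h => A.lam_E_ne_zero χ (by rw [h, map_zero])

theorem act_E (g : G) (χ : R →ₐ[ℂ] ℂ) :
    (A.crossed.act g : A.carrier ≃ₐ[ℂ] A.carrier) (A.E χ) = A.E (simAct ρ g χ) := by
  rw [E, A.j_act, act_idem, E]

/-- The `χ`-isotypic part of `A_g`. -/
noncomputable def line (χ : R →ₐ[ℂ] ℂ) (g : G) : Submodule ℂ A.carrier :=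
  A.crossed.comp g ⊓ LinearMap.ker (LinearMap.mulLeft ℂ (A.E χ) - LinearMap.id)

variable {A}

theorem mem_line {χ : R →ₐ[ℂ] ℂ} {g : G} {x : A.carrier} :
    x ∈ A.line χ g ↔ x ∈ A.crossed.comp g ∧ A.E χ * x = x := by
  simp [line, sub_eq_zero]

theorem E_mul_mem_line (χ : R →ₐ[ℂ] ℂ) {g : G} {x : A.carrier} (hx : x ∈ A.crossed.comp g) :
    A.E χ * x ∈ A.line χ g := by
  rw [mem_line, ← mul_assoc, E_mul_self]
  refine ⟨?_, rfl⟩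
  simpa using A.crossed.mul_mem (A.E_mem χ) hx

theorem j_mul_of_mem_line {χ : R →ₐ[ℂ] ℂ} {g : G} {x : A.carrier} (hx : x ∈ A.line χ g) (r : R) :
    A.j r * x = χ r • x := by
  rw [← (mem_line.1 hx).2, ← mul_assoc, j_mul_E, smul_mul_assoc]

variable (A) in
theorem E_mem_line (χ : R →ₐ[ℂ] ℂ) : A.E χ ∈ A.line χ 1 :=
  mem_line.2 ⟨A.E_mem χ, A.E_mul_self χ⟩

theorem mul_mem_line {χ : R →ₐ[ℂ] ℂ} {g h : G} {x y : A.carrier} (hx : x ∈ A.line χ g)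
    (hy : y ∈ A.line χ h) : x * y ∈ A.line χ (g * h) := by
  rw [mem_line] at *
  exact ⟨A.crossed.mul_mem hx.1 hy.1, by rw [← mul_assoc, hx.2]⟩

theorem mul_eq_zero_of_mem_line {χ χ' : R →ₐ[ℂ] ℂ} (hne : χ ≠ χ') {g h : G} {x y : A.carrier}
    (hx : x ∈ A.line χ g) (hy : y ∈ A.line χ' h) : x * y = 0 := by
  rw [mem_line] at *
  rw [← hx.2, ← hy.2, E_comm, mul_assoc, ← mul_assoc (A.E χ), E_mul_of_ne A hne, zero_mul, mul_zero]

theorem E_mul_of_mem_line_of_ne {χ χ' : R →ₐ[ℂ] ℂ} (hne : χ ≠ χ') {g : G} {x : A.carrier}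
    (hx : x ∈ A.line χ' g) : A.E χ * x = 0 :=
  mul_eq_zero_of_mem_line hne (A.E_mem_line χ) hx

theorem star_mem_line {χ : R →ₐ[ℂ] ℂ} {g : G} {x : A.carrier} (hx : x ∈ A.line χ g) :
    star x ∈ A.line χ g⁻¹ := by
  rw [mem_line] at *
  refine ⟨A.crossed.star_mem hx.1, ?_⟩
  have h := congrArg star hx.2
  rw [star_mul, star_E] at h
  rw [E_comm, h]

theorem act_mem_line {χ : R →ₐ[ℂ] ℂ} (g : G) {h : G} {x : A.carrier} (hx : x ∈ A.line χ h) :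
    (A.crossed.act g : A.carrier ≃ₐ[ℂ] A.carrier) x ∈ A.line (simAct ρ g χ) (g * h * g⁻¹) := by
  rw [mem_line] at *
  refine ⟨A.crossed.act_mem g hx.1, ?_⟩
  rw [← act_E, ← map_mul, hx.2]

/-- The factor `A.E χ` matters for k = 0, where x⁰ = 1 need not lie in the line. -/
theorem pow_mem_line {χ : R →ₐ[ℂ] ℂ} {g : G} {x : A.carrier} (hx : x ∈ A.line χ g) (k : ℕ) :
    A.E χ * x ^ k ∈ A.line χ (g ^ k) := by
  induction k with
  | zero => simpa using A.E_mem_line χ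
  | succ k ih =>
    rw [pow_succ, pow_succ, ← mul_assoc]
    exact mul_mem_line ih hx

/-- Crossed commutation moves `E χ` past x as `E (gχ)`, centrality moves it unchanged, and distinct
primitive idempotents are orthogonal. -/
theorem line_eq_zero {χ : R →ₐ[ℂ] ℂ} {g : G} (hg : simAct ρ g χ ≠ χ) {x : A.carrier}
    (hx : x ∈ A.line χ g) : x = 0 := by
  rw [mem_line] at hx
  have h := A.crossed.crossed_comm hx.1 (A.E χ)
  rw [act_E, ← E_comm, hx.2] at h
  rw [h, ← hx.2, ← mul_assoc, E_mul_of_ne A hg, zero_mul]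

/-- This is where strictness enters: for g fixing χ it makes the isotypic part a line. -/
theorem exists_line_generator {χ : R →ₐ[ℂ] ℂ} {g : G} (hg : simAct ρ g χ = χ) :
    ∃ v ∈ A.line χ g, v ≠ 0 ∧ ∀ x ∈ A.line χ g, ∃ c : ℂ, x = c • v := by
  have h1 : A.sim χ ∈ {χ : A.crossed.Sim | χ.comp (A.crossed.actOne g⁻¹) = χ} :=
    (A.sim_fixed_iff g χ).2 hg
  rw [← A.strict g] at h1
  have h2 := (A.crossed.partialAction_iso_iff g (A.sim χ) (E := A.jEquiv (idem χ))
    (by rw [A.sim_apply χ (idem χ) _ rfl, apply_idem_self]) (by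
      intro s
      obtain ⟨r, rfl⟩ := A.jEquiv.surjective s
      rw [A.sim_apply χ r _ rfl, ← map_mul, mul_idem, map_smul])).1 h1
  obtain ⟨v, hv, hv0, hEv, hvm⟩ := h2
  refine ⟨v, mem_line.2 ⟨hv, hEv⟩, hv0, fun x hx => ?_⟩
  obtain ⟨c, hc⟩ := hvm x (mem_line.1 hx).1
  exact ⟨c, (mem_line.1 hx).2.symm.trans hc⟩

theorem exists_smul_of_mem_line {χ : R →ₐ[ℂ] ℂ} {g : G} {x y : A.carrier} (hx : x ∈ A.line χ g)
    (hx0 : x ≠ 0) (hy : y ∈ A.line χ g) : ∃ c : ℂ, y = c • x := by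
  by_cases hg : simAct ρ g χ = χ
  · obtain ⟨v, -, -, hvm⟩ := exists_line_generator (A := A) hg
    obtain ⟨c, rfl⟩ := hvm x hx
    obtain ⟨d, rfl⟩ := hvm y hy
    refine ⟨d / c, ?_⟩
    rw [smul_smul, div_mul_cancel₀]
    rintro rfl
    exact hx0 (zero_smul _ _)
  · exact absurd (line_eq_zero hg hx) hx0

/-- The product lies in the line at g = 1, which `E χ` spans; applying `lam` exhibits the scalar as
a quotient of two squared norms. -/
theorem mul_star_of_mem_line {χ : R →ₐ[ℂ] ℂ} {g : G} {x : A.carrier} (hx : x ∈ A.line χ g)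
    (hx0 : x ≠ 0) : ∃ t : ℝ, 0 < t ∧ x * star x = (t : ℂ) • A.E χ := by
  have h := mul_mem_line hx (star_mem_line hx)
  rw [mul_inv_cancel] at h
  obtain ⟨c, hc⟩ := exists_smul_of_mem_line (A.E_mem_line χ) (A.E_ne_zero χ) h
  have h2 := congrArg lam hc
  rw [lam_mul_star_self, map_smul, lam_E, lam_idem, smul_eq_mul] at h2
  have hp := sqNorm_pos (idem_ne_zero χ)
  refine ⟨sqNorm x / sqNorm (idem χ), div_pos (sqNorm_pos hx0) hp, ?_⟩
  rw [hc]
  congr 1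
  push_cast
  rw [h2, mul_div_cancel_right₀]
  exact_mod_cast hp.ne'

/-- Since x⋆x is a positive multiple of `E χ`, left multiplication by x is injective on the lines
over χ. -/
theorem mul_ne_zero_of_mem_line {χ : R →ₐ[ℂ] ℂ} {g h : G} {x y : A.carrier} (hx : x ∈ A.line χ g)
    (hx0 : x ≠ 0) (hy : y ∈ A.line χ h) (hy0 : y ≠ 0) : x * y ≠ 0 := by
  intro h0
  obtain ⟨t, ht, h1⟩ := mul_star_of_mem_line (star_mem_line hx) (star_ne_zero.2 hx0)
  rw [star_star] at h1
  have h2 : star x * (x * y) = (t : ℂ) • y := by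
    rw [← mul_assoc, h1, smul_mul_assoc, (mem_line.1 hy).2]
  rw [h0, mul_zero] at h2
  rcases smul_eq_zero.1 h2.symm with h3 | h3
  · exact ht.ne' (by exact_mod_cast h3)
  · exact hy0 h3

theorem E_mul_pow_ne_zero {χ : R →ₐ[ℂ] ℂ} {g : G} {x : A.carrier} (hx : x ∈ A.line χ g)
    (hx0 : x ≠ 0) (k : ℕ) : A.E χ * x ^ k ≠ 0 := by
  induction k with
  | zero => simpa using A.E_ne_zero χ
  | succ k ih =>
    rw [pow_succ, ← mul_assoc]
    exact mul_ne_zero_of_mem_line (pow_mem_line hx k) ih hx hx0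

theorem eq_zero_of_lam_mul {g : G} {x : A.carrier} (hx : x ∈ A.crossed.comp g)
    (h : ∀ y ∈ A.crossed.comp g⁻¹, lam (x * y) = 0) : x = 0 := by
  by_contra hx0
  have h1 := sqNorm_pos hx0
  rw [sqNorm, h _ (A.crossed.star_mem hx)] at h1
  simp at h1

/-! ### Twisted characters -/

theorem mem_sub_of_mem_comp {H : Subgroup G} {g : G} (hg : g ∈ H) {x : A.carrier}
    (hx : x ∈ A.crossed.comp g) : x ∈ A.crossed.sub H :=
  le_iSup (fun h : H => A.crossed.comp h) ⟨g, hg⟩ hx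

/-- Because `E u^n = E`, the sum w of the elements `E u^k`, k < n, absorbs u and spans a
one-dimensional right module over `A_⟨g⟩`. The required extension of χ is x ↦ λ(wx)/λ(w); only k = 0
contributes to λ(w), which is thus nonzero. -/
theorem isTwistedCharacter_of_pow [Finite G] {χ : R →ₐ[ℂ] ℂ} {g : G} {u : A.carrier}
    (hu : u ∈ A.line χ g) (hpow : A.E χ * u ^ orderOf g = A.E χ) :
    A.crossed.IsTwistedCharacter (A.sim χ) g⁻¹ ((lam (A.E χ))⁻¹ • u) := by
  have hn : 0 < orderOf g := orderOf_pos g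
  have hlE := A.lam_E_ne_zero χ
  set w : A.carrier := ∑ k ∈ Finset.range (orderOf g), A.E χ * u ^ k with hw
  have hEw : w * A.E χ = w := by
    rw [← E_comm, hw, Finset.mul_sum]
    refine Finset.sum_congr rfl fun k _ => ?_
    rw [← mul_assoc, E_mul_self]
  have hwu : w * u = w := by
    rw [hw, Finset.sum_mul]
    have h1 : ∀ k ∈ Finset.range (orderOf g), A.E χ * u ^ k * u = A.E χ * u ^ (k + 1) :=
      fun k _ => by rw [pow_succ, mul_assoc]
    rw [Finset.sum_congr rfl h1]
    have h2 := Finset.sum_range_succ' (fun k => A.E χ * u ^ k) (orderOf g)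
    rw [Finset.sum_range_succ, hpow, pow_zero, mul_one] at h2
    exact (add_right_cancel h2).symm
  have hwuk : ∀ k : ℕ, w * u ^ k = w := by
    intro k
    induction k with
    | zero => simp
    | succ k ih => rw [pow_succ, ← mul_assoc, ih, hwu]
  have hu0 : u ≠ 0 := by
    rintro rfl
    rw [zero_pow hn.ne', mul_zero] at hpow
    exact A.E_ne_zero χ hpow.symm
  have hlw : lam w = lam (A.E χ) := by
    rw [hw, map_sum, Finset.sum_eq_single 0]
    · simp
    · intro k hk hk0
      refine A.crossed.lam_eq_zero ?_ (mem_line.1 (pow_mem_line hu k)).1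
      exact pow_ne_one_of_lt_orderOf hk0 (Finset.mem_range.1 hk)
    · exact fun h => absurd (Finset.mem_range.2 hn) h
  have hlw0 : lam w ≠ 0 := hlw ▸ hlE
  have hcomp : ∀ (k : ℕ) (x : A.carrier), x ∈ A.crossed.comp (g ^ k) →
      ∃ c : ℂ, A.E χ * x = c • (A.E χ * u ^ k) ∧ w * x = c • w := by
    intro k x hx
    obtain ⟨c, hc⟩ := exists_smul_of_mem_line (pow_mem_line hu k) (E_mul_pow_ne_zero hu hu0 k)
      (E_mul_mem_line χ hx)
    refine ⟨c, hc, ?_⟩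
    rw [← hEw, mul_assoc, hc, mul_smul_comm, ← mul_assoc, hEw, hwuk]
  have hinvpow : ∀ h ∈ Subgroup.zpowers g⁻¹, ∃ k : ℕ, g ^ k = h := by
    intro h hh
    rw [Subgroup.zpowers_inv, ← mem_powers_iff_mem_zpowers] at hh
    exact hh
  have hsub : ∀ x ∈ A.crossed.sub (Subgroup.zpowers g⁻¹), ∃ c : ℂ, w * x = c • w := by
    intro x hx
    replace hx : x ∈ ⨆ h : Subgroup.zpowers g⁻¹, A.crossed.comp h := hx
    induction hx using Submodule.iSup_induction' with
    | mem h x hx =>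
      obtain ⟨k, hk⟩ := hinvpow h h.2
      rw [← hk] at hx
      obtain ⟨c, -, hc⟩ := hcomp k x hx
      exact ⟨c, hc⟩
    | zero => exact ⟨0, by simp⟩
    | add x y hx hy hcx hcy =>
      obtain ⟨c, hc⟩ := hcx
      obtain ⟨d, hd⟩ := hcy
      exact ⟨c + d, by rw [mul_add, hc, hd, add_smul]⟩
  have hval : ∀ (x : A.carrier) (c : ℂ), w * x = c • w → lam (w * x) / lam w = c := by
    intro x c hc
    rw [hc, map_smul, smul_eq_mul, mul_div_assoc, div_self hlw0, mul_one]
  refine ⟨?_, ⟨{ toFun := fun x => lam (w * x) / lam w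
                 map_one' := ?_
                 map_mul' := ?_
                 map_zero' := ?_
                 map_add' := ?_
                 commutes' := ?_ }, ?_, ?_⟩⟩
  · rw [inv_inv]
    exact Submodule.smul_mem _ _ (mem_line.1 hu).1
  · exact hval _ _ (by simp)
  · intro x y
    obtain ⟨c, hc⟩ := hsub x x.2
    obtain ⟨d, hd⟩ := hsub y y.2
    rw [hval _ c hc, hval _ d hd]
    refine hval _ _ ?_
    rw [Subalgebra.coe_mul, ← mul_assoc, hc, smul_mul_assoc, hd, smul_smul]
  · simp
  · intro x y
    rw [Subalgebra.coe_add, mul_add, map_add, add_div]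
  · intro c
    refine hval _ _ ?_
    rw [Subalgebra.coe_algebraMap, Algebra.algebraMap_eq_smul_one, mul_smul_comm, mul_one]
    rfl
  · intro a ha
    obtain ⟨r, hr⟩ := A.exists_j_eq ha
    rw [A.sim_apply χ r _ hr.symm]
    refine hval _ _ ?_
    rw [← hr, ← hEw, mul_assoc, ← j_comm, j_mul_E, mul_smul_comm]
  · intro a ha
    -- As g⁻¹ = g^(n-1), the element `E a` is a multiple c of `E u^(n-1)`. The same c is the value
    -- of the extension at a and satisfies `u a = c E`.
    have hinv : g⁻¹ = g ^ (orderOf g - 1) := by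
      rw [inv_eq_iff_mul_eq_one, ← pow_succ', Nat.sub_add_cancel hn, pow_orderOf_eq_one]
    obtain ⟨c, hc1, hc2⟩ := hcomp (orderOf g - 1) a (hinv ▸ ha)
    refine Eq.trans ?_ (hval _ c hc2).symm
    have h1 : u * (a : A.carrier) = c • A.E χ := by
      rw [← (mem_line.1 hu).2, E_comm, mul_assoc, hc1, mul_smul_comm, ← mul_assoc, ← E_comm,
        mul_assoc, ← pow_succ', Nat.sub_add_cancel hn, hpow]
    rw [smul_mul_assoc, h1, map_smul, map_smul, smul_eq_mul, smul_eq_mul, mul_comm c,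
      inv_mul_cancel_left₀ hlE]

/-- A generator v of the line has `E v^n = c E` with c ≠ 0; rescaling it by an n-th root of c⁻¹
makes its n-th power trivial. -/
theorem exists_normalizedTwistedCharacter [Finite G] {χ : R →ₐ[ℂ] ℂ} {g : G}
    (hg : simAct ρ g χ = χ) :
    ∃ x, A.crossed.IsNormalizedTwistedCharacter (A.sim χ) g⁻¹ x := by
  obtain ⟨v, hv, hv0, -⟩ := exists_line_generator (A := A) hg
  have h1 := pow_mem_line hv (orderOf g)
  rw [pow_orderOf_eq_one] at h1
  obtain ⟨c, hc⟩ := exists_smul_of_mem_line (A.E_mem_line χ) (A.E_ne_zero χ) h1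
  have hc0 : c ≠ 0 := by
    rintro rfl
    rw [zero_smul] at hc
    exact E_mul_pow_ne_zero hv hv0 _ hc
  obtain ⟨z, hz⟩ := IsAlgClosed.exists_pow_nat_eq c⁻¹ (orderOf_pos g)
  have ht := isTwistedCharacter_of_pow (u := z • v) (Submodule.smul_mem _ z hv) (by
    rw [smul_pow, mul_smul_comm, hc, hz, smul_smul, inv_mul_cancel₀ hc0, one_smul])
  have ht1 := isTwistedCharacter_of_pow (A.E_mem_line χ) (by simp [E_mul_self])
  rw [inv_one] at ht1
  exact ⟨_, _, ⟨(lam (A.E χ))⁻¹ • A.E χ, Submodule.smul_mem _ _ (A.E_mem χ)⟩, ht, ht1, rfl⟩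

/-- The extension takes the value 1 at `E χ`, so α and `E χ * α` define the same functional on
`A_g`; the pairing by `lam` is nondegenerate. -/
theorem twisted_mem_line {χ : R →ₐ[ℂ] ℂ} {g : G} {α : A.carrier}
    (h : A.crossed.IsTwistedCharacter (A.sim χ) g α) : α ∈ A.line χ g⁻¹ := by
  obtain ⟨hα, χt, h1, h2⟩ := h
  refine mem_line.2 ⟨hα, ?_⟩
  have hE : χt ⟨A.E χ, mem_sub_of_mem_comp (one_mem _) (A.E_mem χ)⟩ = 1 := by
    rw [h1 _ (A.E_mem χ), A.sim_apply χ (idem χ) _ rfl, apply_idem_self]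
  refine sub_eq_zero.1 (eq_zero_of_lam_mul (g := g⁻¹) (Submodule.sub_mem _ ?_ hα) fun y hy => ?_)
  · exact (mem_line.1 (E_mul_mem_line χ hα)).1
  · rw [inv_inv] at hy
    have hy' : y ∈ A.crossed.sub (Subgroup.zpowers g) :=
      mem_sub_of_mem_comp (Subgroup.mem_zpowers g) hy
    have e1 := h2 ⟨y, hy'⟩ hy
    have e2 := h2 (⟨A.E χ, mem_sub_of_mem_comp (one_mem _) (A.E_mem χ)⟩ * ⟨y, hy'⟩)
      (mem_line.1 (E_mul_mem_line χ hy)).1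
    rw [map_mul χt, hE, one_mul, ← e1] at e2
    rw [sub_mul, map_sub, E_comm, mul_assoc]
    exact sub_eq_zero.2 e2

/-- If α = 0, the extension kills `A_g`; but for a generator v its values at v and v⋆ multiply to
χ(v v⋆) > 0. -/
theorem twisted_ne_zero {χ : R →ₐ[ℂ] ℂ} {g : G} {α : A.carrier}
    (h : A.crossed.IsTwistedCharacter (A.sim χ) g α) (hg : simAct ρ g χ = χ) : α ≠ 0 := by
  rintro rfl
  obtain ⟨-, χt, h1, h2⟩ := h
  obtain ⟨v, hv, hv0, -⟩ := exists_line_generator (A := A) hg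
  obtain ⟨t, ht, hvt⟩ := mul_star_of_mem_line hv hv0
  have hv' := (mem_line.1 hv).1
  have e1 := h2 ⟨v, mem_sub_of_mem_comp (Subgroup.mem_zpowers g) hv'⟩ hv'
  rw [zero_mul, map_zero] at e1
  have e2 := h1 (⟨v, mem_sub_of_mem_comp (Subgroup.mem_zpowers g) hv'⟩ *
    ⟨star v, mem_sub_of_mem_comp (inv_mem (Subgroup.mem_zpowers g)) (A.crossed.star_mem hv')⟩)
    (by
      change v * star v ∈ _
      rw [hvt]
      exact Submodule.smul_mem _ _ (A.E_mem χ))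
  rw [map_mul χt, ← e1, zero_mul, A.sim_apply χ ((t : ℂ) • idem χ) _ (by
    change v * star v = _
    rw [hvt, map_smul]
    rfl), map_smul, apply_idem_self, smul_eq_mul, mul_one] at e2
  exact ht.ne (by exact_mod_cast e2)

theorem twisted_one_eq {χ : R →ₐ[ℂ] ℂ} {α : A.carrier}
    (h : A.crossed.IsTwistedCharacter (A.sim χ) 1 α) : α = (lam (A.E χ))⁻¹ • A.E χ := by
  have h0 := twisted_mem_line h
  rw [inv_one] at h0
  obtain ⟨c, hc⟩ := exists_smul_of_mem_line (A.E_mem_line χ) (A.E_ne_zero χ) h0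
  obtain ⟨-, χt, h1, h2⟩ := h
  have e1 := h2 ⟨A.E χ, mem_sub_of_mem_comp (one_mem _) (A.E_mem χ)⟩ (A.E_mem χ)
  rw [h1 _ (A.E_mem χ), A.sim_apply χ (idem χ) _ rfl, apply_idem_self, hc] at e1
  change lam (c • A.E χ * A.E χ) = 1 at e1
  rw [smul_mul_assoc, E_mul_self, map_smul, smul_eq_mul] at e1
  rw [hc, eq_inv_of_mul_eq_one_left e1]

theorem normalizedTwisted_eq_smul {χ : R →ₐ[ℂ] ℂ} {g : G} {x : A.carrier}
    (h : A.crossed.IsNormalizedTwistedCharacter (A.sim χ) g x) :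
    ∃ α, A.crossed.IsTwistedCharacter (A.sim χ) g α ∧ x = lam (A.E χ) • α := by
  obtain ⟨α, α₁, h1, h2, rfl⟩ := h
  refine ⟨α, h1, ?_⟩
  have e := twisted_one_eq h2
  rw [A.sim_apply χ ((lam (A.E χ))⁻¹ • idem χ) _ (by rw [e, map_smul]; rfl), map_smul,
    apply_idem_self, smul_eq_mul, mul_one, inv_inv]

theorem normalizedTwisted_mem_line {χ : R →ₐ[ℂ] ℂ} {g : G} {x : A.carrier}
    (h : A.crossed.IsNormalizedTwistedCharacter (A.sim χ) g⁻¹ x) : x ∈ A.line χ g := by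
  obtain ⟨α, h1, rfl⟩ := normalizedTwisted_eq_smul h
  have := twisted_mem_line h1
  rw [inv_inv] at this
  exact Submodule.smul_mem _ _ this

theorem normalizedTwisted_ne_zero {χ : R →ₐ[ℂ] ℂ} {g : G} {x : A.carrier}
    (h : A.crossed.IsNormalizedTwistedCharacter (A.sim χ) g⁻¹ x) (hg : simAct ρ g χ = χ) :
    x ≠ 0 := by
  obtain ⟨α, h1, rfl⟩ := normalizedTwisted_eq_smul h
  exact smul_ne_zero (A.lam_E_ne_zero χ) (twisted_ne_zero h1 (simAct_inv_fixed ρ hg))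

/-- Division by χ(α_χ), which equals λ(E χ)⁻¹, is what produces the primitive idempotent here, and
hence a normalized cocycle later. -/
theorem normalizedTwisted_one_eq {χ : R →ₐ[ℂ] ℂ} {x : A.carrier}
    (h : A.crossed.IsNormalizedTwistedCharacter (A.sim χ) 1 x) : x = A.E χ := by
  obtain ⟨α, h1, rfl⟩ := normalizedTwisted_eq_smul h
  rw [twisted_one_eq h1, smul_smul, mul_inv_cancel₀ (A.lam_E_ne_zero χ), one_smul]

end StrictCrossedExtension

/-! ### 2-cocycles with values in `Rˣ` -/

section UnitsCohomology

variable {G R : Type} [Group G] [CommRing R] [Algebra ℂ R] [FrobeniusStarAlgebra R]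
  {ρ : G →* frobAut R}

theorem unitVal_smul (g : G) (χ : R →ₐ[ℂ] ℂ) (u : Rˣ) :
    unitVal χ (letI := unitsAction ρ; g • u) = unitVal (simAct ρ g⁻¹ χ) u :=
  Units.ext (apply_act ρ g χ u)

/-- Read at each character, an `Rˣ`-valued cocycle becomes a ℂˣ-valued cocycle on the action
groupoid. -/
theorem isUnitsCocycle_iff {φ : G × G → Rˣ} : IsUnitsCocycle ρ φ ↔ ∀ χ g h k,
    unitVal χ (φ (g * h, k)) * unitVal χ (φ (g, h)) =
      unitVal (simAct ρ g⁻¹ χ) (φ (h, k)) * unitVal χ (φ (g, h * k)) := by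
  let _ := unitsAction ρ
  constructor
  · intro h χ g g' k
    rw [← map_mul, h g g' k, map_mul]
    exact congrArg (· * _) (unitVal_smul g χ _)
  · intro h g g' k
    refine unit_ext fun χ => ?_
    rw [map_mul, h, map_mul]
    exact congrArg (· * _) (unitVal_smul g χ _).symm

theorem H2Units.mk_eq_mk_iff {φ φ' : G × G → Rˣ} (hφ : IsUnitsCocycle ρ φ)
    (hφ' : IsUnitsCocycle ρ φ') : H2Units.mk hφ = H2Units.mk hφ' ↔
    ∃ s : G → Rˣ, ∀ χ g h, unitVal χ (φ' (g, h)) * unitVal χ (s (g * h)) =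
      unitVal χ (φ (g, h)) * unitVal χ (s g) * unitVal (simAct ρ g⁻¹ χ) (s h) := by
  let _ := unitsAction ρ
  rw [eq_comm]
  refine (groupCohomology.H2π_eq_iff _ _).trans ?_
  constructor
  · intro h
    obtain ⟨s, hs⟩ := groupCohomology.isMulCoboundary₂_of_mem_coboundaries₂ _ h
    refine ⟨s, fun χ g k => ?_⟩
    have h1 : g • s k / s (g * k) * s g = φ' (g, k) / φ (g, k) := hs g k
    have h2 := congrArg (unitVal χ) h1
    have h3 := unitVal_smul (ρ := ρ) g χ (s k)
    rw [map_mul, map_div, map_div, div_mul_eq_mul_div, div_eq_div_iff_mul_eq_mul] at h2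
    rw [← h2, ← h3, mul_assoc (unitVal χ (φ (g, k))), mul_comm (unitVal χ (φ (g, k))),
      mul_comm (unitVal χ (s g))]
  · rintro ⟨s, hs⟩
    have hc : groupCohomology.IsMulCoboundary₂ (fun p : G × G => φ' p / φ p) := by
      refine ⟨s, fun g k => unit_ext fun χ => ?_⟩
      have h3 := unitVal_smul (ρ := ρ) g χ (s k)
      rw [map_mul, map_div, map_div, div_mul_eq_mul_div, div_eq_div_iff_mul_eq_mul, hs, ← h3]
      rw [mul_assoc (unitVal χ (φ (g, k))), mul_comm (unitVal χ (φ (g, k))),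
        mul_comm (unitVal χ (s g))]
    exact (groupCohomology.coboundariesOfIsMulCoboundary₂ hc).2

theorem exists_unit_cocycle {f : (R →ₐ[ℂ] ℂ) → G → G → ℂˣ}
    (hf : letI := simMulAction ρ; IsActionCocycle f) :
    ∃ φ : G × G → Rˣ, IsUnitsCocycle ρ φ ∧ ∀ χ g h, unitVal χ (φ (g, h)) = f χ g h := by
  have h1 := fun p : G × G => exists_unit fun χ => f χ p.1 p.2
  choose φ hφ using h1
  refine ⟨φ, isUnitsCocycle_iff.2 fun χ g h k => ?_, fun χ g h => hφ (g, h) χ⟩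
  simp only [hφ]
  exact hf χ g h k

theorem exists_normalized_cocycle (c : H2Units ρ) :
    ∃ (φ : G × G → Rˣ) (hφ : IsUnitsCocycle ρ φ), IsNormalizedCochain φ ∧ H2Units.mk hφ = c := by
  let _ := unitsAction ρ
  induction c using groupCohomology.H2_induction_on with
  | h x =>
    have hψ : IsUnitsCocycle ρ (Additive.toMul ∘ x.1) :=
      groupCohomology.isMulCocycle₂_of_mem_cocycles₂ (M := Rˣ) x.1 x.2
    set ψ : G × G → Rˣ := Additive.toMul ∘ x.1 with hψdef
    -- The divisor is the coboundary of the constant cochain ψ(1,1), whose value at (g,h) is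
    -- g·ψ(1,1).
    have hφ : IsUnitsCocycle ρ (fun p => ψ p / (p.1 • ψ (1, 1))) := by
      rw [isUnitsCocycle_iff] at *
      intro χ g h k
      simp only [map_div]
      have e := hψ χ g h k
      have e1 := unitVal_smul (ρ := ρ) g χ (ψ (1, 1))
      have e2 := unitVal_smul (ρ := ρ) h (simAct ρ g⁻¹ χ) (ψ (1, 1))
      have e3 := unitVal_smul (ρ := ρ) (g * h) χ (ψ (1, 1))
      rw [mul_inv_rev, simAct_mul, ← e2] at e3
      rw [e3, div_mul_div_comm, e, div_mul_div_comm]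
    refine ⟨_, hφ, fun g => ?_, ?_⟩
    · dsimp only
      rw [groupCohomology.map_one_fst_of_isMulCocycle₂ hψ,
        groupCohomology.map_one_snd_of_isMulCocycle₂ hψ g, one_smul, div_self', div_self']
      exact ⟨rfl, rfl⟩
    · have h2 : H2Units.mk hφ = H2Units.mk hψ := by
        rw [H2Units.mk_eq_mk_iff]
        refine ⟨fun _ => ψ (1, 1), fun χ g h => ?_⟩
        have e1 := unitVal_smul (ρ := ρ) g χ (ψ (1, 1))
        rw [map_div, ← e1, mul_right_comm, div_mul_cancel]
      rw [h2]
      rfl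

variable (ρ) in
/-- The squared absolute value of a 2-cocycle is the coboundary of a positive cochain. -/
theorem exists_positiveTrivialization [Finite G] {φ : G × G → Rˣ} (hφ : IsUnitsCocycle ρ φ) :
    ∃ η : G → Rˣ, IsPositiveTrivialization ρ φ η := by
  have : Fintype G := Fintype.ofFinite G
  rw [isUnitsCocycle_iff] at hφ
  -- Logarithms turn the squared absolute value into an additive real cocycle.
  let L : (R →ₐ[ℂ] ℂ) → G → G → ℝ := fun χ g h => Real.log (Complex.normSq (χ (φ (g, h) : R)))
  have hne : ∀ (χ : R →ₐ[ℂ] ℂ) (p : G × G), 0 < Complex.normSq (χ (φ p : R)) := fun χ p =>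
    Complex.normSq_pos.2 (unitVal χ (φ p)).ne_zero
  have hL : ∀ χ g h k, L χ (g * h) k + L χ g h = L (simAct ρ g⁻¹ χ) h k + L χ g (h * k) := by
    intro χ g h k
    have h1 := congrArg (fun u : ℂˣ => Real.log (Complex.normSq (u : ℂ))) (hφ χ g h k)
    simp only [Units.val_mul, coe_unitVal, map_mul] at h1
    rwa [Real.log_mul (hne _ _).ne' (hne _ _).ne', Real.log_mul (hne _ _).ne' (hne _ _).ne'] at h1
  let n : ℝ := Fintype.card G
  have hn : n ≠ 0 := Nat.cast_ne_zero.2 Fintype.card_ne_zero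
  -- Averaging over the last variable trivializes L: sum its cocycle identity over k and reindex by
  -- k ↦ hk. Exponentiating p gives a positive η.
  let p : (R →ₐ[ℂ] ℂ) → G → ℝ := fun χ g => (∑ k, L χ g k) / n
  have hp : ∀ χ g h, L χ g h + p χ (g * h) = p χ g + p (simAct ρ g⁻¹ χ) h := by
    intro χ g h
    have h1 := Finset.sum_congr rfl fun k (_ : k ∈ (Finset.univ : Finset G)) => hL χ g h k
    rw [Finset.sum_add_distrib, Finset.sum_add_distrib, Finset.sum_const, Finset.card_univ,
      nsmul_eq_mul, Fintype.sum_equiv (Equiv.mulLeft h) (fun k => L χ g (h * k)) (fun k => L χ g k)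
        (fun k => rfl)] at h1
    simp only [p]
    field_simp
    linear_combination h1
  have hu := fun g => exists_unit fun χ : R →ₐ[ℂ] ℂ =>
    Units.mk0 ((Real.exp (p χ g) : ℝ) : ℂ) (by exact_mod_cast (Real.exp_pos _).ne')
  choose η hη using hu
  have hη' : ∀ (χ : R →ₐ[ℂ] ℂ) g, χ (η g : R) = ((Real.exp (p χ g) : ℝ) : ℂ) := fun χ g =>
    congrArg Units.val (hη g χ)
  refine ⟨η, fun g χ => ⟨_, Real.exp_pos _, hη' χ g⟩, fun g h => ext_characters fun χ => ?_⟩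
  rw [map_mul, map_mul, map_mul, apply_star, apply_act, Complex.mul_conj, hη', hη', hη']
  norm_cast
  rw [← Real.exp_log (hne χ (g, h)), ← Real.exp_add, ← Real.exp_add]
  exact congrArg _ (hp χ g h)

end UnitsCohomology

namespace StrictCrossedExtension

variable {G R : Type} [Group G] [CommRing R] [Algebra ℂ R] [FrobeniusStarAlgebra R]
  {ρ : G →* frobAut R} {A B : StrictCrossedExtension ρ}

/-! ### Families of generators of the isotypic lines -/

variable (A) in
/-- The element `e χ g` generates the `χ`-isotypic part of `A_g` whenever `g` fixes `χ`. -/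
def IsLineFamily (e : (R →ₐ[ℂ] ℂ) → G → A.carrier) : Prop :=
  ∀ χ g, simAct ρ g χ = χ → e χ g ∈ A.line χ g ∧ e χ g ≠ 0

section LineFamily

variable {e : (R →ₐ[ℂ] ℂ) → G → A.carrier} (he : A.IsLineFamily e)
include he

theorem IsLineFamily.eq_smul {χ : R →ₐ[ℂ] ℂ} {g : G} (hg : simAct ρ g χ = χ) {x : A.carrier}
    (hx : x ∈ A.line χ g) : ∃ c : ℂ, x = c • e χ g :=
  exists_smul_of_mem_line (he χ g hg).1 (he χ g hg).2 hx

theorem IsLineFamily.eq_unit_smul {χ : R →ₐ[ℂ] ℂ} {g : G} (hg : simAct ρ g χ = χ) {x : A.carrier}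
    (hx : x ∈ A.line χ g) (hx0 : x ≠ 0) : ∃ c : ℂˣ, x = (c : ℂ) • e χ g := by
  obtain ⟨c, hc⟩ := he.eq_smul hg hx
  have hc0 : c ≠ 0 := by
    rintro rfl
    exact hx0 (by rw [hc, zero_smul])
  exact ⟨Units.mk0 c hc0, hc⟩

theorem IsLineFamily.smul_inj {χ : R →ₐ[ℂ] ℂ} {g : G} (hg : simAct ρ g χ = χ) {c d : ℂˣ}
    (h : (c : ℂ) • e χ g = (d : ℂ) • e χ g) : c = d :=
  Units.ext (smul_left_injective ℂ (he χ g hg).2 h)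

theorem IsLineFamily.j_mul {χ : R →ₐ[ℂ] ℂ} {g : G} (hg : simAct ρ g χ = χ) (u : Rˣ) :
    A.j u * e χ g = (unitVal χ u : ℂ) • e χ g :=
  j_mul_of_mem_line (he χ g hg).1 u

/-- An element of `A_g` is a combination of the generators in `A_g`. -/
theorem IsLineFamily.induction_comp {g : G} {p : A.carrier → Prop}
    (hgen : ∀ χ, simAct ρ g χ = χ → p (e χ g)) (hzero : p 0)
    (hadd : ∀ x y, p x → p y → p (x + y)) (hsmul : ∀ (c : ℂ) x, p x → p (c • x))
    {x : A.carrier} (hx : x ∈ A.crossed.comp g) : p x := by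
  have h1 : x = ∑ χ, A.E χ * x := by rw [← Finset.sum_mul, sum_E, one_mul]
  rw [h1]
  refine Finset.sum_induction _ p hadd hzero fun χ _ => ?_
  have h2 := E_mul_mem_line χ hx
  by_cases hg : simAct ρ g χ = χ
  · obtain ⟨c, hc⟩ := he.eq_smul hg h2
    rw [hc]
    exact hsmul _ _ (hgen χ hg)
  · rw [line_eq_zero hg h2]
    exact hzero

theorem IsLineFamily.induction {p : A.carrier → Prop}
    (hgen : ∀ χ g, simAct ρ g χ = χ → p (e χ g)) (hzero : p 0)
    (hadd : ∀ x y, p x → p y → p (x + y)) (hsmul : ∀ (c : ℂ) x, p x → p (c • x))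
    (x : A.carrier) : p x := by
  classical
  have hx : x ∈ ⨆ g, A.crossed.comp g := by
    rw [A.crossed.isInternal.submodule_iSup_eq_top]
    trivial
  induction hx using Submodule.iSup_induction' with
  | mem g x hx => exact he.induction_comp (fun χ hg => hgen χ g hg) hzero hadd hsmul hx
  | zero => exact hzero
  | add x y _ _ hx hy => exact hadd x y hx hy

theorem IsLineFamily.exists_basis_comp (g : G) :
    ∃ b : Module.Basis {χ : R →ₐ[ℂ] ℂ // simAct ρ g χ = χ} ℂ (A.crossed.comp g),
      ∀ χ, (b χ : A.carrier) = e χ g := by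
  classical
  let v : {χ : R →ₐ[ℂ] ℂ // simAct ρ g χ = χ} → A.crossed.comp g := fun χ =>
    ⟨e χ g, (mem_line.1 (he χ g χ.2).1).1⟩
  have hli : LinearIndependent ℂ v := by
    rw [Fintype.linearIndependent_iff]
    intro c hc χ
    have h1 := congrArg (fun x : A.crossed.comp g => A.E χ * (x : A.carrier)) hc
    simp only [AddSubmonoidClass.coe_finsetSum, Submodule.coe_smul, Submodule.coe_zero, mul_zero,
      Finset.mul_sum, mul_smul_comm] at h1
    rw [Finset.sum_eq_single χ] at h1
    · change c χ • (A.E χ * e χ g) = 0 at h1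
      rw [(mem_line.1 (he χ g χ.2).1).2] at h1
      exact (smul_eq_zero.1 h1).resolve_right (he χ g χ.2).2
    · intro χ' _ hne
      change c χ' • (A.E χ * e χ' g) = 0
      rw [E_mul_of_mem_line_of_ne (fun h => hne (Subtype.ext h.symm)) (he χ' g χ'.2).1, smul_zero]
    · simp
  have hspan : ⊤ ≤ Submodule.span ℂ (Set.range v) := by
    rintro ⟨x, hx⟩ -
    have h2 : x ∈ (Submodule.span ℂ (Set.range v)).map (A.crossed.comp g).subtype := by
      refine he.induction_comp (p := fun x =>
        x ∈ (Submodule.span ℂ (Set.range v)).map (A.crossed.comp g).subtype) ?_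
        (Submodule.zero_mem _) (fun _ _ => Submodule.add_mem _) (fun c _ => Submodule.smul_mem _ c)
        hx
      intro χ hχ
      exact ⟨v ⟨χ, hχ⟩, Submodule.subset_span ⟨_, rfl⟩, rfl⟩
    obtain ⟨y, hy, hyx⟩ := h2
    have : y = ⟨x, hx⟩ := Subtype.ext hyx
    rwa [← this]
  refine ⟨Module.Basis.mk hli hspan, fun χ => ?_⟩
  rw [Module.Basis.mk_apply]

theorem IsLineFamily.isAdaptedBasis : A.IsAdaptedBasis e := by
  refine ⟨he.exists_basis_comp, fun g χ hg r => ?_⟩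
  rw [← j_comm]
  exact ⟨j_mul_of_mem_line (he χ g hg).1 r, j_mul_of_mem_line (he χ g hg).1 r⟩

theorem IsLineFamily.exists_basis :
    ∃ b : Module.Basis (Σ g : G, {χ : R →ₐ[ℂ] ℂ // simAct ρ g χ = χ}) ℂ A.carrier,
      ∀ p, b p = e p.2 p.1 := by
  classical
  choose b hb using he.exists_basis_comp
  refine ⟨A.crossed.isInternal.collectedBasis b, fun p => ?_⟩
  rw [DirectSum.IsInternal.collectedBasis_coe]
  exact hb p.1 p.2

/-- Normalization makes `e χ 1` a nonzero idempotent in the line spanned by `E χ`. -/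
theorem IsLineFamily.eq_E_of_hasProduct {φ : G × G → Rˣ} (hφ : IsNormalizedCochain φ)
    (hp : A.HasProduct e φ) (χ : R →ₐ[ℂ] ℂ) : e χ 1 = A.E χ := by
  obtain ⟨h1, h0⟩ := he χ 1 (simAct_one ρ χ)
  obtain ⟨c, hc⟩ := exists_smul_of_mem_line (A.E_mem_line χ) (A.E_ne_zero χ) h1
  have h2 := hp χ 1 1 (simAct_one ρ χ) (simAct_one ρ χ)
  rw [(hφ 1).1, Units.val_one, map_one, one_mul, mul_one] at h2
  nth_rw 1 [hc] at h2
  rw [smul_mul_assoc, (mem_line.1 h1).2] at h2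
  rw [hc] at h2 h0 ⊢
  rw [smul_smul] at h2
  have h3 := smul_left_injective ℂ (A.E_ne_zero χ) h2
  have hc0 : c ≠ 0 := by
    rintro rfl
    exact h0 (zero_smul _ _)
  rw [mul_eq_left₀ hc0 |>.1 h3, one_smul]

/-- A family of generators extending the primitive idempotents comes from a normalized cocycle. -/
theorem IsLineFamily.exists_cocycle (h1 : ∀ χ, e χ 1 = A.E χ) :
    ∃ φ : G × G → Rˣ, IsUnitsCocycle ρ φ ∧ IsNormalizedCochain φ ∧
      A.HasProduct e φ ∧ A.HasAction e φ := by
  let _ := simMulAction ρ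
  -- Outside the stabilizers the scalars of products and of the action are irrelevant and set to 1.
  have hc : ∀ χ g h, ∃ c : ℂˣ, simAct ρ g χ = χ → simAct ρ h χ = χ →
      e χ g * e χ h = (c : ℂ) • e χ (g * h) := by
    intro χ g h
    by_cases hg : simAct ρ g χ = χ
    · by_cases hh : simAct ρ h χ = χ
      · obtain ⟨c, hc⟩ := he.eq_unit_smul (simAct_mul_fixed ρ hg hh)
          (mul_mem_line (he χ g hg).1 (he χ h hh).1)
          (mul_ne_zero_of_mem_line (he χ g hg).1 (he χ g hg).2 (he χ h hh).1 (he χ h hh).2)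
        exact ⟨c, fun _ _ => hc⟩
      · exact ⟨1, fun _ h => absurd h hh⟩
    · exact ⟨1, fun h => absurd h hg⟩
  have hm : ∀ χ g h, ∃ m : ℂˣ, simAct ρ h χ = χ →
      (A.crossed.act g : A.carrier ≃ₐ[ℂ] A.carrier) (e χ h) =
        (m : ℂ) • e (simAct ρ g χ) (g * h * g⁻¹) := by
    intro χ g h
    by_cases hh : simAct ρ h χ = χ
    · obtain ⟨c, hc⟩ := he.eq_unit_smul (simAct_conj_fixed ρ g hh)
        (act_mem_line g (he χ h hh).1) (by
          rw [Ne, map_eq_zero_iff _ (AlgEquiv.injective _)]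
          exact (he χ h hh).2)
      exact ⟨c, fun _ => hc⟩
    · exact ⟨1, fun h => absurd h hh⟩
  choose c hc using hc
  choose m hm using hm
  -- The hypotheses to be checked express, in order: associativity, the unit law, g(E χ) = E (gχ),
  -- multiplicativity of the action in g, compatibility of the action with products, and ab = g(b)a.
  obtain ⟨f, hf, hfc, hfm, hf1⟩ := exists_actionCocycle_of_inertia c m
    (fun χ g h k (hg : simAct ρ g χ = χ) (hh : simAct ρ h χ = χ) (hk : simAct ρ k χ = χ) => by
      refine he.smul_inj (simAct_mul_fixed ρ hg (simAct_mul_fixed ρ hh hk)) ?_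
      have e1 := mul_assoc (e χ g) (e χ h) (e χ k)
      rw [hc χ g h hg hh, hc χ h k hh hk, smul_mul_assoc, mul_smul_comm,
        hc χ (g * h) k (simAct_mul_fixed ρ hg hh) hk,
        hc χ g (h * k) hg (simAct_mul_fixed ρ hh hk), smul_smul, smul_smul, mul_assoc] at e1
      rw [Units.val_mul, Units.val_mul, mul_comm, e1])
    (fun χ g (hg : simAct ρ g χ = χ) => by
      have e1 := hc χ 1 g (simAct_one ρ χ) hg
      have e2 := hc χ g 1 hg (simAct_one ρ χ)
      rw [h1, (mem_line.1 (he χ g hg).1).2, one_mul] at e1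
      rw [h1, ← E_comm, (mem_line.1 (he χ g hg).1).2, mul_one] at e2
      constructor
      · refine he.smul_inj hg ?_
        rw [← e1, Units.val_one, one_smul]
      · refine he.smul_inj hg ?_
        rw [← e2, Units.val_one, one_smul])
    (fun χ g => by
      have e1 := hm χ g 1 (simAct_one ρ χ)
      rw [mul_one, mul_inv_cancel] at e1
      refine he.smul_inj (simAct_one ρ (simAct ρ g χ)) ?_
      rw [← e1, h1, h1, act_E, Units.val_one, one_smul])
    (fun χ g g' h (hh : simAct ρ h χ = χ) => by
      have e1 := hm χ (g * g') h hh
      rw [map_mul] at e1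
      have e2 : (A.crossed.act g : A.carrier ≃ₐ[ℂ] A.carrier)
          ((A.crossed.act g' : A.carrier ≃ₐ[ℂ] A.carrier) (e χ h)) = _ := e1
      have a1 : g * g' * h * (g * g')⁻¹ = g * (g' * h * g'⁻¹) * g⁻¹ := by group
      rw [hm χ g' h hh, map_smul, hm _ g _ (simAct_conj_fixed ρ g' hh), smul_smul, simAct_mul,
        a1] at e2
      exact (he.smul_inj (simAct_conj_fixed ρ g (simAct_conj_fixed ρ g' hh)) e2).symm)
    (fun χ g h k (hh : simAct ρ h χ = χ) (hk : simAct ρ k χ = χ) => by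
      have e1 := congrArg (A.crossed.act g : A.carrier ≃ₐ[ℂ] A.carrier) (hc χ h k hh hk)
      have hgh := simAct_conj_fixed ρ g hh
      have hgk := simAct_conj_fixed ρ g hk
      have a1 : g * h * g⁻¹ * (g * k * g⁻¹) = g * (h * k) * g⁻¹ := by group
      rw [map_mul, map_smul, hm χ g h hh, hm χ g k hk, hm χ g _ (simAct_mul_fixed ρ hh hk),
        smul_mul_smul_comm, hc _ _ _ hgh hgk, smul_smul, smul_smul, a1] at e1
      have e2 := he.smul_inj (c := m χ g h * m χ g k * c (simAct ρ g χ) _ _)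
        (d := c χ h k * m χ g (h * k)) (a1 ▸ simAct_mul_fixed ρ hgh hgk) e1
      rw [mul_comm (m χ g (h * k))]
      exact e2.symm)
    (fun χ g h (hg : simAct ρ g χ = χ) (hh : simAct ρ h χ = χ) => by
      have e1 := A.crossed.crossed_comm (mem_line.1 (he χ g hg).1).1 (e χ h)
      have hgh := simAct_conj_fixed ρ g hh
      rw [hg] at hgh
      rw [hm χ g h hh, hg, smul_mul_assoc, hc χ _ _ hgh hg, hc χ g h hg hh, smul_smul,
        inv_mul_cancel_right] at e1
      exact he.smul_inj (d := m χ g h * c χ (g * h * g⁻¹) g) (simAct_mul_fixed ρ hg hh) e1)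
  obtain ⟨φ, hφ, hφf⟩ := exists_unit_cocycle hf
  refine ⟨φ, hφ, fun g => ⟨unit_ext fun χ => ?_, unit_ext fun χ => ?_⟩, ?_, ?_⟩
  · rw [hφf, (hf1 χ g).1, map_one]
  · rw [hφf, (hf1 χ g).2, map_one]
  · intro χ g h hg hh
    rw [he.j_mul (simAct_mul_fixed ρ hg hh), hφf, hfc χ g h hg hh, hc χ g h hg hh]
  · intro χ g h hh
    rw [he.j_mul (simAct_conj_fixed ρ g hh), map_div, hφf, hφf, hm χ g h hh]
    have e1 : m χ g h * f (simAct ρ g χ) (g * h * g⁻¹) g = f (simAct ρ g χ) g h := hfm χ g h hh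
    rw [← e1, mul_div_cancel_right]

/-- The class of a cocycle describing the products of a family of generators does not depend on the
family. -/
theorem IsLineFamily.mk_eq_mk {e' : (R →ₐ[ℂ] ℂ) → G → A.carrier} (he' : A.IsLineFamily e')
    {φ φ' : G × G → Rˣ} (hφ : IsUnitsCocycle ρ φ) (hφ' : IsUnitsCocycle ρ φ')
    (hp : A.HasProduct e φ) (hp' : A.HasProduct e' φ') : H2Units.mk hφ = H2Units.mk hφ' := by
  let _ := simMulAction ρ
  have hk : ∀ χ g, ∃ k : ℂˣ, simAct ρ g χ = χ → e' χ g = (k : ℂ) • e χ g := by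
    intro χ g
    by_cases hg : simAct ρ g χ = χ
    · obtain ⟨k, hk⟩ := he.eq_unit_smul hg (he' χ g hg).1 (he' χ g hg).2
      exact ⟨k, fun _ => hk⟩
    · exact ⟨1, fun h => absurd h hg⟩
  choose k hk using hk
  -- The ratio of the cocycles, corrected by the change of generators k, is 1 on stabilizers and
  -- hence a coboundary. Away from the stabilizers k was chosen as 1, and the trivialization τ
  -- absorbs that choice.
  let f : (R →ₐ[ℂ] ℂ) → G → G → ℂˣ := fun χ g h => unitVal χ (φ' (g, h)) * k χ (g * h) /
    (unitVal χ (φ (g, h)) * k χ g * k (simAct ρ g⁻¹ χ) h)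
  have hf : IsActionCocycle f := by
    intro χ g h l
    have e1 := isUnitsCocycle_iff.1 hφ χ g h l
    have e2 := isUnitsCocycle_iff.1 hφ' χ g h l
    change f χ (g * h) l * f χ g h = f (simAct ρ g⁻¹ χ) h l * f χ g (h * l)
    simp only [f]
    rw [mul_inv_rev, simAct_mul, mul_assoc g h l]
    apply Additive.ofMul.injective
    replace e1 := congrArg Additive.ofMul e1
    replace e2 := congrArg Additive.ofMul e2
    simp only [ofMul_mul, ofMul_div] at *
    linear_combination (norm := module) e2 - e1
  obtain ⟨τ, hτ⟩ := hf.exists_trivialization (by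
    intro χ g h (hg : simAct ρ g χ = χ) (hh : simAct ρ h χ = χ)
    have e1 := hp' χ g h hg hh
    have hgh := simAct_mul_fixed ρ hg hh
    rw [he'.j_mul hgh, hk χ g hg, hk χ h hh, hk χ _ hgh, smul_mul_smul_comm, hp χ g h hg hh,
      he.j_mul hgh, smul_smul, smul_smul] at e1
    have e2 := he.smul_inj (c := k χ g * k χ h * unitVal χ (φ (g, h)))
      (d := unitVal χ (φ' (g, h)) * k χ (g * h)) hgh e1
    simp only [f]
    rw [simAct_inv_fixed ρ hg, ← e2, div_eq_one, mul_comm, mul_assoc])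
  have hs := fun g => exists_unit fun χ : R →ₐ[ℂ] ℂ => k χ g * τ χ g
  choose s hs using hs
  refine (H2Units.mk_eq_mk_iff hφ hφ').2 ⟨s, fun χ g h => ?_⟩
  have e1 : f χ g h * τ χ (g * h) = τ χ g * τ (simAct ρ g⁻¹ χ) h := hτ χ g h
  simp only [f] at e1
  simp only [hs]
  apply Additive.ofMul.injective
  replace e1 := congrArg Additive.ofMul e1
  simp only [ofMul_mul, ofMul_div] at *
  linear_combination (norm := module) e1

/-- The involution is determined by the product. -/
theorem IsLineFamily.hasStar [Finite G] {φ : G × G → Rˣ} (hφ : IsNormalizedCochain φ)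
    (hp : A.HasProduct e φ) {η : G → Rˣ} (hη : IsPositiveTrivialization ρ φ η) :
    A.HasStar e φ η := by
  intro χ g₀ hg₀
  choose p hp0 hpη using fun g => hη.1 g χ
  have hν : ∀ g, ∃ t : ℝ, 0 < t ∧ (simAct ρ g χ = χ → e χ g * star (e χ g) = (t : ℂ) • A.E χ) := by
    intro g
    by_cases hg : simAct ρ g χ = χ
    · obtain ⟨t, ht, h⟩ := mul_star_of_mem_line (he χ g hg).1 (he χ g hg).2
      exact ⟨t, ht, fun _ => h⟩
    · exact ⟨1, one_pos, fun h => absurd h hg⟩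
  choose ν hν0 hν using hν
  have hsq : ∀ g h, simAct ρ g χ = χ → simAct ρ h χ = χ →
      Complex.normSq (χ (φ (g, h) : R)) * ν (g * h) = ν g * ν h := by
    intro g h hg hh
    have hgh := simAct_mul_fixed ρ hg hh
    have e1 := congrArg (fun x => x * star x) (hp χ g h hg hh)
    simp only [he.j_mul hgh] at e1
    rw [star_mul, mul_assoc, ← mul_assoc (e χ h), hν h hh, smul_mul_assoc,
      (mem_line.1 (star_mem_line (he χ g hg).1)).2, mul_smul_comm, hν g hg, star_smul_conj,
      smul_mul_smul_comm, hν _ hgh, smul_smul, smul_smul, coe_unitVal, Complex.mul_conj] at e1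
    have e2 := smul_left_injective ℂ (A.E_ne_zero χ) e1
    rw [mul_comm (ν g)]
    exact_mod_cast e2.symm
  have hsq' : ∀ g h, simAct ρ g χ = χ →
      Complex.normSq (χ (φ (g, h) : R)) * p (g * h) = p g * p h := by
    intro g h hg
    have e1 := congrArg χ (hη.2 g h)
    rw [map_mul, map_mul, map_mul, apply_star, apply_act, simAct_inv_fixed ρ hg, Complex.mul_conj,
      hpη, hpη, hpη] at e1
    exact_mod_cast e1
  -- Both p and ν satisfy |φ(g,h)|² p(gh) = p(g) p(h) on the stabilizer, so p/ν is a positive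
  -- character there; finite order of `g₀` forces the value 1.
  have hκ : ∀ g h, simAct ρ g χ = χ → simAct ρ h χ = χ →
      p (g * h) / ν (g * h) = p g / ν g * (p h / ν h) := by
    intro g h hg hh
    have hN : Complex.normSq (χ (φ (g, h) : R)) ≠ 0 :=
      (Complex.normSq_pos.2 (unitVal χ (φ (g, h))).ne_zero).ne'
    rw [div_mul_div_comm, ← hsq' g h hg, ← hsq g h hg hh, mul_div_mul_left _ _ hN]
  have hκ1 : p 1 / ν 1 = 1 := by
    have h := hκ 1 1 (simAct_one ρ χ) (simAct_one ρ χ)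
    rw [mul_one] at h
    exact (mul_eq_left₀ (div_pos (hp0 1) (hν0 1)).ne').1 h.symm
  have hκpow : ∀ k : ℕ, simAct ρ (g₀ ^ k) χ = χ ∧
      p (g₀ ^ k) / ν (g₀ ^ k) = (p g₀ / ν g₀) ^ k := by
    intro k
    induction k with
    | zero => simpa [simAct_one] using hκ1
    | succ k ih =>
      rw [pow_succ, pow_succ, hκ _ _ ih.1 hg₀, ih.2]
      exact ⟨simAct_mul_fixed ρ ih.1 hg₀, rfl⟩
  have hpν : p g₀ = ν g₀ := by
    have h := (hκpow (orderOf g₀)).2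
    rw [pow_orderOf_eq_one, hκ1] at h
    have h2 := (pow_eq_one_iff_of_nonneg (div_pos (hp0 g₀) (hν0 g₀)).le
      (orderOf_pos g₀).ne').1 h.symm
    exact (div_eq_one_iff_eq (hν0 g₀).ne').1 h2
  have hg₀' := simAct_inv_fixed ρ hg₀
  -- The coefficient of the involution is read off by computing `e χ g₀ * star (e χ g₀)` twice: as
  -- η(g₀) E and as c φ(g₀,g₀⁻¹) E, both at χ.
  obtain ⟨c, hc⟩ := he.eq_unit_smul hg₀' (star_mem_line (he χ g₀ hg₀).1)
    (star_ne_zero.2 (he χ g₀ hg₀).2)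
  have e1 := hν g₀ hg₀
  rw [hc, mul_smul_comm, hp χ g₀ g₀⁻¹ hg₀ hg₀', mul_inv_cancel, he.j_mul (simAct_one ρ χ),
    he.eq_E_of_hasProduct hφ hp, smul_smul] at e1
  have e2 := smul_left_injective ℂ (A.E_ne_zero χ) e1
  rw [← hpν, ← hpη] at e2
  have e3 : c * unitVal χ (φ (g₀, g₀⁻¹)) = unitVal χ (η g₀) := Units.ext e2
  rw [hc, he.j_mul hg₀', map_mul, map_inv, ← e3, mul_inv_cancel_right]

end LineFamily

/-! ### Isomorphisms -/

theorem IsLineFamily.map {e : (R →ₐ[ℂ] ℂ) → G → A.carrier} (he : A.IsLineFamily e)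
    {f : A.carrier ≃ₐ[ℂ] B.carrier} (hf : IsIso A B f) : B.IsLineFamily fun χ g => f (e χ g) := by
  intro χ g hg
  obtain ⟨h1, h2⟩ := he χ g hg
  rw [mem_line] at h1 ⊢
  refine ⟨⟨(hf.2.1 g _).2 h1.1, ?_⟩, ?_⟩
  · have h3 : B.E χ = f (A.E χ) := (hf.2.2.2 _).symm
    rw [h3, ← map_mul, h1.2]
  · rwa [Ne, map_eq_zero_iff _ f.injective]

theorem HasProduct.map {e : (R →ₐ[ℂ] ℂ) → G → A.carrier} {φ : G × G → Rˣ} (hp : A.HasProduct e φ)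
    {f : A.carrier ≃ₐ[ℂ] B.carrier} (hf : IsIso A B f) :
    B.HasProduct (fun χ g => f (e χ g)) φ := by
  intro χ g h hg hh
  rw [← map_mul, hp χ g h hg hh, map_mul, hf.2.2.2]

theorem IsLineFamily.smul {e : (R →ₐ[ℂ] ℂ) → G → A.carrier} (he : A.IsLineFamily e) (s : G → Rˣ) :
    A.IsLineFamily fun χ g => (unitVal χ (s g) : ℂ) • e χ g := fun χ g hg =>
  ⟨Submodule.smul_mem _ _ (he χ g hg).1, smul_ne_zero (Units.ne_zero _) (he χ g hg).2⟩

/-- Rescaling a family of generators changes the cocycle by a coboundary. -/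
theorem IsLineFamily.hasProduct_smul {e : (R →ₐ[ℂ] ℂ) → G → A.carrier} (he : A.IsLineFamily e)
    {φ φ' : G × G → Rˣ} {s : G → Rˣ}
    (hs : ∀ χ g h, unitVal χ (φ' (g, h)) * unitVal χ (s (g * h)) =
      unitVal χ (φ (g, h)) * unitVal χ (s g) * unitVal (simAct ρ g⁻¹ χ) (s h))
    (hp : A.HasProduct e φ) : A.HasProduct (fun χ g => (unitVal χ (s g) : ℂ) • e χ g) φ' := by
  intro χ g h hg hh
  have hgh := simAct_mul_fixed ρ hg hh
  have e1 := congrArg Units.val (hs χ g h)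
  rw [simAct_inv_fixed ρ hg] at e1
  simp only [Units.val_mul] at e1
  rw [smul_mul_smul_comm, hp χ g h hg hh, (he.smul s).j_mul hgh, he.j_mul hgh, smul_smul, smul_smul,
    e1]
  congr 1
  ring

theorem IsLineFamily.hasAction_smul {e : (R →ₐ[ℂ] ℂ) → G → A.carrier} (he : A.IsLineFamily e)
    {φ φ' : G × G → Rˣ} {s : G → Rˣ}
    (hs : ∀ χ g h, unitVal χ (φ' (g, h)) * unitVal χ (s (g * h)) =
      unitVal χ (φ (g, h)) * unitVal χ (s g) * unitVal (simAct ρ g⁻¹ χ) (s h))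
    (ha : A.HasAction e φ) : A.HasAction (fun χ g => (unitVal χ (s g) : ℂ) • e χ g) φ' := by
  intro χ g h hh
  have hgh := simAct_conj_fixed ρ g hh
  rw [map_smul, ha χ g h hh, (he.smul s).j_mul hgh, he.j_mul hgh, smul_smul, smul_smul]
  congr 1
  rw [← Units.val_mul, ← Units.val_mul]
  congr 1
  -- Both identities contain s(gh) and s(g) at gχ, and these cancel in the quotient
  -- φ(g,h)/φ(ghg⁻¹,g).
  have e1 := hs (simAct ρ g χ) g h
  have e2 := hs (simAct ρ g χ) (g * h * g⁻¹) g
  have a1 : simAct ρ g⁻¹ (simAct ρ g χ) = χ := (simAct_inv_eq ρ).2 rfl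
  rw [a1] at e1
  rw [simAct_inv_fixed ρ hgh, inv_mul_cancel_right] at e2
  rw [map_div, map_div]
  apply Additive.ofMul.injective
  replace e1 := congrArg Additive.ofMul e1
  replace e2 := congrArg Additive.ofMul e2
  simp only [ofMul_mul, ofMul_div] at *
  linear_combination (norm := module) e2 - e1

/-- Extensions with families of generators that satisfy the same relations are isomorphic. -/
theorem IsLineFamily.exists_isIso [Finite G] {e : (R →ₐ[ℂ] ℂ) → G → A.carrier}
    {e' : (R →ₐ[ℂ] ℂ) → G → B.carrier} (he : A.IsLineFamily e) (he' : B.IsLineFamily e')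
    {φ : G × G → Rˣ} (hφ : IsUnitsCocycle ρ φ) (hφ1 : IsNormalizedCochain φ)
    (hp : A.HasProduct e φ) (hp' : B.HasProduct e' φ) (ha : A.HasAction e φ)
    (ha' : B.HasAction e' φ) : ∃ f : A.carrier ≃ₐ[ℂ] B.carrier, IsIso A B f := by
  obtain ⟨b, hb⟩ := he.exists_basis
  obtain ⟨b', hb'⟩ := he'.exists_basis
  let L : A.carrier ≃ₗ[ℂ] B.carrier := b.equiv b' (Equiv.refl _)
  have hL : ∀ χ g, simAct ρ g χ = χ → L (e χ g) = e' χ g := by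
    intro χ g hg
    rw [← hb ⟨g, χ, hg⟩, Module.Basis.equiv_apply, Equiv.refl_apply, hb']
  have hL' : ∀ χ g, simAct ρ g χ = χ → L.symm (e' χ g) = e χ g := by
    intro χ g hg
    rw [← hL χ g hg, LinearEquiv.symm_apply_apply]
  have hLj' : ∀ χ g, simAct ρ g χ = χ → ∀ u : Rˣ, L (A.j u * e χ g) = B.j u * e' χ g := by
    intro χ g hg u
    rw [he.j_mul hg, he'.j_mul hg, map_smul, hL χ g hg]
  have hE := he.eq_E_of_hasProduct hφ1 hp
  have hE' := he'.eq_E_of_hasProduct hφ1 hp'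
  have hLE : ∀ χ, L (A.E χ) = B.E χ := by
    intro χ
    rw [← hE, ← hE', hL χ 1 (simAct_one ρ χ)]
  have hLj : ∀ r, L (A.j r) = B.j r := by
    intro r
    rw [eq_sum_idem r]
    simp only [map_sum, map_smul]
    exact Finset.sum_congr rfl fun χ _ => congrArg _ (hLE χ)
  have hmul : ∀ x y, L (x * y) = L x * L y := by
    intro x y
    induction x using he.induction with
    | hzero => simp
    | hadd x x' h h' => rw [add_mul, map_add, h, h', map_add, add_mul]
    | hsmul c x h => rw [smul_mul_assoc, map_smul, h, map_smul, smul_mul_assoc]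
    | hgen χ g hg =>
      induction y using he.induction with
      | hzero => simp
      | hadd x x' h h' => rw [mul_add, map_add, h, h', map_add, mul_add]
      | hsmul c x h => rw [mul_smul_comm, map_smul, h, map_smul, mul_smul_comm]
      | hgen χ' h hh =>
        rw [hL χ g hg, hL χ' h hh]
        by_cases hχ : χ = χ'
        · subst hχ
          rw [hp χ g h hg hh, hp' χ g h hg hh, hLj' _ _ (simAct_mul_fixed ρ hg hh)]
        · rw [mul_eq_zero_of_mem_line hχ (he χ g hg).1 (he χ' h hh).1,
            mul_eq_zero_of_mem_line hχ (he' χ g hg).1 (he' χ' h hh).1, map_zero]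
  -- A single η gives both involutions by the same formula, so the linear map matching generators
  -- automatically respects them.
  obtain ⟨η, hη⟩ := exists_positiveTrivialization ρ hφ
  have hs := he.hasStar hφ1 hp hη
  have hs' := he'.hasStar hφ1 hp' hη
  refine ⟨AlgEquiv.ofLinearEquiv L (by rw [← map_one A.j, hLj, map_one]) hmul, ⟨?_, ?_⟩, ?_, ?_,
    hLj⟩
  · intro x
    change lam (L x) = lam x
    induction x using he.induction with
    | hzero => simp
    | hadd x x' h h' => rw [map_add, map_add, h, h', map_add]
    | hsmul c x h => rw [map_smul, map_smul, h, map_smul]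
    | hgen χ g hg =>
      rw [hL χ g hg]
      by_cases h1 : g = 1
      · rw [h1, hE, hE', lam_E, lam_E]
      · rw [A.crossed.lam_eq_zero h1 (mem_line.1 (he χ g hg).1).1,
          B.crossed.lam_eq_zero h1 (mem_line.1 (he' χ g hg).1).1]
  · intro x
    change L (star x) = star (L x)
    induction x using he.induction with
    | hzero => simp
    | hadd x x' h h' => rw [star_add, map_add, h, h', map_add, star_add]
    | hsmul c x h => rw [star_smul_conj, map_smul, h, map_smul, star_smul_conj]
    | hgen χ g hg => rw [hL χ g hg, hs χ g hg, hs' χ g hg, hLj' _ _ (simAct_inv_fixed ρ hg)]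
  · intro g x
    change L x ∈ _ ↔ _
    constructor
    · intro hx
      rw [← L.symm_apply_apply x]
      refine he'.induction_comp (p := fun y => L.symm y ∈ A.crossed.comp g) ?_ ?_ ?_ ?_ hx
      · intro χ hg
        rw [hL' χ g hg]
        exact (mem_line.1 (he χ g hg).1).1
      · simp
      · intro x y h h'
        rw [map_add]
        exact Submodule.add_mem _ h h'
      · intro c x h
        rw [map_smul]
        exact Submodule.smul_mem _ _ h
    · intro hx
      refine he.induction_comp (p := fun y => L y ∈ B.crossed.comp g) ?_ ?_ ?_ ?_ hx
      · intro χ hg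
        rw [hL χ g hg]
        exact (mem_line.1 (he' χ g hg).1).1
      · simp
      · intro x y h h'
        rw [map_add]
        exact Submodule.add_mem _ h h'
      · intro c x h
        rw [map_smul]
        exact Submodule.smul_mem _ _ h
  · intro g x
    change L _ = (B.crossed.act g : B.carrier ≃ₐ[ℂ] B.carrier) (L x)
    induction x using he.induction with
    | hzero => simp
    | hadd x x' h h' => rw [map_add, map_add, h, h', map_add, map_add]
    | hsmul c x h => rw [map_smul, map_smul, h, map_smul, map_smul]
    | hgen χ h hh =>
      rw [hL χ h hh, ha χ g h hh, ha' χ g h hh, hLj' _ _ (simAct_conj_fixed ρ g hh)]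

end StrictCrossedExtension

/-! ### The crossed product -/

section CrossedProduct

variable {G R : Type} [Group G] [CommRing R] [Algebra ℂ R] [FrobeniusStarAlgebra R]

/-- The automorphism of `R` by which `g` acts. -/
def ract (ρ : G →* frobAut R) (g : G) : R ≃ₐ[ℂ] R := (ρ g : R ≃ₐ[ℂ] R)

section

variable (ρ : G →* frobAut R)

theorem ract_one (r : R) : ract ρ 1 r = r := by
  rw [ract, map_one]
  rfl

theorem ract_mul (g h : G) (r : R) : ract ρ (g * h) r = ract ρ g (ract ρ h r) := by
  rw [ract, map_mul]
  rfl

theorem ract_star (g : G) (r : R) : ract ρ g (star r) = star (ract ρ g r) := (ρ g).2.2 r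

theorem lam_ract (g : G) (r : R) : lam (ract ρ g r) = lam r := (ρ g).2.1 r

theorem ract_idem (g : G) (χ : R →ₐ[ℂ] ℂ) : ract ρ g (idem χ) = idem (simAct ρ g χ) :=
  act_idem ρ g χ

end

/-- A normalized 2-cocycle together with a positive trivialization of its squared absolute value. -/
structure PositiveCocycle (ρ : G →* frobAut R) where
  /-- the cocycle -/
  φ : G × G → Rˣ
  isCocycle : IsUnitsCocycle ρ φ
  isNormalized : IsNormalizedCochain φ
  /-- the positive trivialization -/
  η : G → Rˣ
  isPositive : IsPositiveTrivialization ρ φ η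

namespace PositiveCocycle

variable {ρ : G →* frobAut R} (D : PositiveCocycle ρ)

theorem φ_mul (g h k : G) : (D.φ (g * h, k) : R) * D.φ (g, h) =
    ract ρ g (D.φ (h, k)) * D.φ (g, h * k) := by
  let _ := unitsAction ρ
  exact congrArg Units.val (D.isCocycle g h k)

theorem φ_one_left (g : G) : (D.φ (1, g) : R) = 1 := by rw [(D.isNormalized g).1, Units.val_one]

theorem φ_one_right (g : G) : (D.φ (g, 1) : R) = 1 := by rw [(D.isNormalized g).2, Units.val_one]

/-- This is associativity of `u_g u_{g⁻¹} u_g`. -/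
theorem ract_φ_inv (g : G) : ract ρ g (D.φ (g⁻¹, g)) = D.φ (g, g⁻¹) := by
  have h := D.φ_mul g g⁻¹ g
  rwa [mul_inv_cancel, inv_mul_cancel, φ_one_left, φ_one_right, one_mul, mul_one, eq_comm] at h

theorem φ_mul_star (g h : G) : (D.φ (g, h) : R) * star (D.φ (g, h) : R) * D.η (g * h) =
    D.η g * ract ρ g (D.η h) := D.isPositive.2 g h

theorem η_one : (D.η 1 : R) = 1 := by
  have h := D.φ_mul_star 1 1
  rw [φ_one_left, star_one, one_mul, ract_one, mul_one, one_mul] at h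
  exact (D.η 1).isUnit.mul_left_cancel (by rw [← h, mul_one])

/-- Take the positive square root at each character. The factorization turns λ(aa⋆) into a sum of
squared norms. -/
theorem exists_mul_star_eq_η (g : G) : ∃ s : R, IsUnit s ∧ s * star s = D.η g := by
  choose t ht0 ht using D.isPositive.1 g
  obtain ⟨s, hs⟩ := exists_unit fun χ : R →ₐ[ℂ] ℂ =>
    Units.mk0 ((Real.sqrt (t χ) : ℝ) : ℂ) (by exact_mod_cast (Real.sqrt_pos.2 (ht0 χ)).ne')
  have hs' : ∀ χ : R →ₐ[ℂ] ℂ, χ (s : R) = ((Real.sqrt (t χ) : ℝ) : ℂ) := fun χ =>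
    congrArg Units.val (hs χ)
  refine ⟨s, s.isUnit, ext_characters fun χ => ?_⟩
  rw [map_mul, apply_star, hs', ht, Complex.conj_ofReal, ← Complex.ofReal_mul,
    Real.mul_self_sqrt (ht0 χ).le]

theorem star_η (g : G) : star (D.η g : R) = D.η g := by
  obtain ⟨s, -, hs⟩ := D.exists_mul_star_eq_η g
  rw [← hs, star_mul, star_star]

/-- The coefficient of the involution of the crossed product. -/
def κ (g : G) : R := ((D.φ (g, g⁻¹))⁻¹ : Rˣ) * ract ρ g (D.η g⁻¹)

/-- The meaning of `κ g` is u_{g⁻¹}⋆ = κ(g) u_g, because u_{g⁻¹}⁻¹ = φ(g,g⁻¹)⁻¹ u_g and u_{g⁻¹}⋆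
should be u_{g⁻¹}⁻¹ η(g⁻¹). -/
theorem φ_mul_κ (g : G) : (D.φ (g, g⁻¹) : R) * D.κ g = ract ρ g (D.η g⁻¹) := by
  rw [κ, Units.mul_inv_cancel_left]

theorem κ_one : D.κ 1 = 1 := by
  rw [κ, ract_one, inv_one, η_one, (D.isNormalized 1).1]
  simp

/-- This encodes u_g u_g⋆ = η(g). -/
theorem ract_κ_inv (g : G) : ract ρ g (D.κ g⁻¹) * D.φ (g, g⁻¹) = D.η g := by
  have h := congrArg (ract ρ g) (D.φ_mul_κ g⁻¹)
  rw [inv_inv, map_mul, ract_φ_inv, ← ract_mul, mul_inv_cancel, ract_one] at h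
  rw [mul_comm, h]

/-- This encodes u⋆⋆ = u for u = u_{g⁻¹}, after the definition of κ is applied twice. -/
theorem κ_mul_star_κ_inv (g : G) : D.κ g * ract ρ g (star (D.κ g⁻¹)) = 1 := by
  have h1 := D.φ_mul_star g g⁻¹
  have h2 := D.φ_mul_κ g
  have h3 := congrArg star (D.ract_κ_inv g)
  rw [star_mul, star_η, ← ract_star] at h3
  rw [mul_inv_cancel, η_one, mul_one] at h1
  refine ((D.φ (g, g⁻¹)).isUnit.mul (D.φ (g, g⁻¹)).isUnit.star).mul_left_cancel ?_
  linear_combination (star (D.φ (g, g⁻¹) : R) * ract ρ g (star (D.κ g⁻¹))) * h2 +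
    (ract ρ g (D.η g⁻¹) : R) * h3 - h1

/-- This encodes (ab)⋆ = b⋆a⋆ for a = u_h and b = u_{h⁻¹g⁻¹}, as coefficients of u_g. -/
theorem κ_mul_star_φ (g h : G) : D.κ g * ract ρ g (star (D.φ (h, h⁻¹ * g⁻¹) : R)) =
    D.κ (g * h) * ract ρ (g * h) (D.κ h⁻¹) * D.φ (g * h, h⁻¹) := by
  have e1 := congrArg (ract ρ g) (D.φ_mul_star h (h⁻¹ * g⁻¹))
  rw [mul_inv_cancel_left, map_mul, map_mul, map_mul, ← ract_mul] at e1
  have e2 := D.φ_mul (g * h) h⁻¹ h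
  rw [mul_inv_cancel_right, inv_mul_cancel, φ_one_right, mul_one] at e2
  have e3 := D.φ_mul g h (h⁻¹ * g⁻¹)
  rw [mul_inv_cancel_left] at e3
  have e4 := D.φ_mul_κ g
  have e5 := D.φ_mul_κ (g * h)
  rw [mul_inv_rev] at e5
  have e6 := congrArg (ract ρ (g * h)) (D.φ_mul_κ h⁻¹)
  rw [inv_inv, map_mul, ← ract_mul, mul_inv_cancel_right] at e6
  -- Three unit factors clear the inverses hidden in κ; the rest follows from two cocycle identities
  -- and the trivialization of φφ⋆.
  refine (((D.φ (g, g⁻¹)).isUnit.mul (D.φ (g * h, h⁻¹ * g⁻¹)).isUnit).mul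
    ((D.φ (h⁻¹, h)).isUnit.map (ract ρ (g * h)))).mul_left_cancel ?_
  linear_combination (D.φ (g * h, h⁻¹ * g⁻¹) * ract ρ (g * h) (D.φ (h⁻¹, h)) *
      ract ρ g (star (D.φ (h, h⁻¹ * g⁻¹) : R))) * e4 -
    (D.φ (g, g⁻¹) * ract ρ (g * h) (D.φ (h⁻¹, h)) * ract ρ (g * h) (D.κ h⁻¹) *
      D.φ (g * h, h⁻¹)) * e5 -
    (D.φ (g, g⁻¹) * ract ρ (g * h) (D.η (h⁻¹ * g⁻¹)) * D.φ (g * h, h⁻¹)) * e6 -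
    (ract ρ g (D.η g⁻¹) * ract ρ g (star (D.φ (h, h⁻¹ * g⁻¹) : R)) *
      D.φ (g * h, h⁻¹ * g⁻¹)) * e2 +
    (ract ρ g (D.η g⁻¹) * ract ρ g (star (D.φ (h, h⁻¹ * g⁻¹) : R)) * D.φ (g * h, h⁻¹)) * e3 +
    (D.φ (g, g⁻¹) * D.φ (g * h, h⁻¹) : R) * e1

/-- The crossed product of `R` and `G`; the function `a` stands for `∑ g, a g * u g`. -/
def CrossedProduct (_D : PositiveCocycle ρ) : Type := G → R

namespace CrossedProduct

noncomputable instance : AddCommGroup D.CrossedProduct := inferInstanceAs (AddCommGroup (G → R))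

noncomputable instance : Module ℂ D.CrossedProduct := inferInstanceAs (Module ℂ (G → R))

instance [Finite G] : Module.Finite ℂ D.CrossedProduct :=
  inferInstanceAs (Module.Finite ℂ (G → R))

instance : CoeFun D.CrossedProduct fun _ => G → R := ⟨fun a => a⟩

variable {D}

@[ext] theorem ext {a b : D.CrossedProduct} (h : ∀ g, a g = b g) : a = b := funext h

theorem add_apply (a b : D.CrossedProduct) (g : G) : (a + b) g = a g + b g := rfl

theorem zero_apply (g : G) : (0 : D.CrossedProduct) g = 0 := rfl

theorem smul_apply (c : ℂ) (a : D.CrossedProduct) (g : G) : (c • a) g = c • a g := rfl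

open Classical in
variable (D) in
/-- The element `r * u g`. -/
noncomputable def single (g : G) (r : R) : D.CrossedProduct := fun h => if h = g then r else 0

theorem single_self (g : G) (r : R) : single D g r g = r := if_pos rfl

theorem single_of_ne {g h : G} (hne : h ≠ g) (r : R) : single D g r h = 0 := if_neg hne

theorem eq_single {a : D.CrossedProduct} {g : G} (h : ∀ k, k ≠ g → a k = 0) :
    a = single D g (a g) := by
  ext k
  by_cases hk : k = g
  · rw [hk, single_self]
  · rw [single_of_ne hk, h k hk]

noncomputable instance : One D.CrossedProduct := ⟨single D 1 1⟩

theorem one_def : (1 : D.CrossedProduct) = single D 1 1 := rfl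

variable [Fintype G]

noncomputable instance : Mul D.CrossedProduct :=
  ⟨fun a b g => ∑ h, a h * ract ρ h (b (h⁻¹ * g)) * D.φ (h, h⁻¹ * g)⟩

theorem mul_apply (a b : D.CrossedProduct) (g : G) :
    (a * b) g = ∑ h, a h * ract ρ h (b (h⁻¹ * g)) * D.φ (h, h⁻¹ * g) := rfl

theorem single_mul_apply (g : G) (r : R) (b : D.CrossedProduct) (k : G) :
    (single D g r * b) k = r * ract ρ g (b (g⁻¹ * k)) * D.φ (g, g⁻¹ * k) := by
  rw [mul_apply, Finset.sum_eq_single g]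
  · rw [single_self]
  · intro h _ hne
    rw [single_of_ne hne, zero_mul, zero_mul]
  · exact fun h => absurd (Finset.mem_univ g) h

theorem mul_single_apply (a : D.CrossedProduct) (g : G) (r : R) (k : G) :
    (a * single D g r) k = a (k * g⁻¹) * ract ρ (k * g⁻¹) r * D.φ (k * g⁻¹, g) := by
  rw [mul_apply, Finset.sum_eq_single (k * g⁻¹)]
  · rw [mul_inv_rev, inv_inv, inv_mul_cancel_right, single_self]
  · intro h _ hne
    rw [single_of_ne, map_zero, mul_zero, zero_mul]
    rintro rfl
    exact hne (by group)
  · exact fun h => absurd (Finset.mem_univ _) h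

theorem single_mul_single (g h : G) (r s : R) :
    single D g r * single D h s = single D (g * h) (r * ract ρ g s * D.φ (g, h)) := by
  ext k
  rw [single_mul_apply]
  by_cases hk : k = g * h
  · rw [hk, inv_mul_cancel_left, single_self, single_self]
  · rw [single_of_ne hk, single_of_ne, map_zero, mul_zero, zero_mul]
    rintro rfl
    exact hk (mul_inv_cancel_left g k).symm

noncomputable instance : Ring D.CrossedProduct :=
  { (inferInstance : AddCommGroup D.CrossedProduct),
    (inferInstance : Mul D.CrossedProduct), (inferInstance : One D.CrossedProduct) with
    left_distrib := fun a b c => by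
      ext g
      rw [mul_apply, add_apply, mul_apply, mul_apply, ← Finset.sum_add_distrib]
      refine Finset.sum_congr rfl fun h _ => ?_
      rw [add_apply, map_add, mul_add, add_mul]
    right_distrib := fun a b c => by
      ext g
      rw [mul_apply, add_apply, mul_apply, mul_apply, ← Finset.sum_add_distrib]
      refine Finset.sum_congr rfl fun h _ => ?_
      rw [add_apply, add_mul, add_mul]
    zero_mul := fun a => by
      ext g
      rw [mul_apply]
      exact Finset.sum_eq_zero fun h _ => by rw [zero_apply, zero_mul, zero_mul]
    mul_zero := fun a => by
      ext g
      rw [mul_apply]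
      exact Finset.sum_eq_zero fun h _ => by rw [zero_apply, map_zero, mul_zero, zero_mul]
    mul_assoc := fun a b c => by
      ext g
      simp only [mul_apply, Finset.sum_mul, map_sum, Finset.mul_sum]
      rw [Finset.sum_comm]
      refine Finset.sum_congr rfl fun h _ => ?_
      refine Fintype.sum_equiv (Equiv.mulLeft h⁻¹) _ _ fun k => ?_
      have e := D.φ_mul h (h⁻¹ * k) (k⁻¹ * g)
      have a1 : h⁻¹ * k * (k⁻¹ * g) = h⁻¹ * g := by group
      have a2 : (h⁻¹ * k)⁻¹ * (h⁻¹ * g) = k⁻¹ * g := by group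
      rw [mul_inv_cancel_left, a1] at e
      rw [Equiv.coe_mulLeft, a2, map_mul, map_mul, ← ract_mul, mul_inv_cancel_left]
      linear_combination (a h * ract ρ h (b (h⁻¹ * k)) * ract ρ k (c (k⁻¹ * g))) * e
    one_mul := fun a => by
      ext g
      rw [one_def, single_mul_apply, ract_one, inv_one, one_mul, one_mul, φ_one_left, mul_one]
    mul_one := fun a => by
      ext g
      rw [one_def, mul_single_apply, map_one, inv_one, mul_one, mul_one, φ_one_right, mul_one] }

noncomputable instance : Algebra ℂ D.CrossedProduct := Algebra.ofModule
  (fun c a b => by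
    ext g
    rw [mul_apply, smul_apply, mul_apply, Finset.smul_sum]
    refine Finset.sum_congr rfl fun h _ => ?_
    rw [smul_apply, smul_mul_assoc, smul_mul_assoc])
  (fun c a b => by
    ext g
    rw [mul_apply, smul_apply, mul_apply, Finset.smul_sum]
    refine Finset.sum_congr rfl fun h _ => ?_
    rw [smul_apply, map_smul, mul_smul_comm, smul_mul_assoc])

/-- The involution is the one that restricts to `⋆` on `R` and sends u_g to u_g⁻¹ η(g). -/
noncomputable instance : StarRing D.CrossedProduct where
  star a := fun g => D.κ g * ract ρ g (star (a g⁻¹))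
  star_involutive a := by
    ext g
    change D.κ g * ract ρ g (star (D.κ g⁻¹ * ract ρ g⁻¹ (star (a g⁻¹⁻¹)))) = a g
    rw [inv_inv, star_mul, ract_star, star_star, map_mul, ← ract_mul, mul_inv_cancel, ract_one,
      mul_left_comm, κ_mul_star_κ_inv, mul_one]
  star_add a b := by
    ext g
    change D.κ g * ract ρ g (star (a g⁻¹ + b g⁻¹)) = _
    rw [star_add, map_add, mul_add]
    rfl
  star_mul a b := by
    ext g
    change D.κ g * ract ρ g (star ((a * b) g⁻¹)) = ∑ k, (D.κ k * ract ρ k (star (b k⁻¹))) *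
      ract ρ k (D.κ (k⁻¹ * g) * ract ρ (k⁻¹ * g) (star (a (k⁻¹ * g)⁻¹))) * D.φ (k, k⁻¹ * g)
    rw [mul_apply, star_sum, map_sum, Finset.mul_sum]
    refine Fintype.sum_equiv (Equiv.mulLeft g) _ _ fun h => ?_
    have e := D.κ_mul_star_φ g h
    have a1 : (g * h)⁻¹ * g = h⁻¹ := by group
    have a2 : (g * h)⁻¹ = h⁻¹ * g⁻¹ := by group
    rw [Equiv.coe_mulLeft, a1, a2, inv_inv, star_mul, star_mul, ← ract_star, map_mul, map_mul,
      map_mul, ← ract_mul, ← ract_mul, mul_inv_cancel_right]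
    linear_combination (ract ρ (g * h) (star (b (h⁻¹ * g⁻¹))) * ract ρ g (star (a h))) * e

theorem star_apply (a : D.CrossedProduct) (g : G) :
    (star a) g = D.κ g * ract ρ g (star (a g⁻¹)) := rfl

variable (D) in
/-- The unit `u g` of the crossed product. -/
noncomputable def unit (g : G) : (D.CrossedProduct)ˣ where
  val := single D g 1
  inv := single D g⁻¹ ((D.φ (g⁻¹, g))⁻¹ : Rˣ)
  val_inv := by
    rw [single_mul_single, mul_inv_cancel, one_mul, ← D.ract_φ_inv, ← map_mul, Units.inv_mul,
      map_one, one_def]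
  inv_val := by
    rw [single_mul_single, inv_mul_cancel, map_one, mul_one, Units.inv_mul, one_def]

theorem coe_unit (g : G) : (unit D g : D.CrossedProduct) = single D g 1 := rfl

variable (D) in
/-- The embedding of `R` into the crossed product. -/
noncomputable def incl : R →ₐ[ℂ] D.CrossedProduct where
  toFun r := single D 1 r
  map_one' := rfl
  map_mul' r s := by
    rw [single_mul_single, ract_one, φ_one_left, mul_one, mul_one]
  map_zero' := by
    ext g
    by_cases hg : g = 1
    · rw [hg, single_self, zero_apply]
    · rw [single_of_ne hg, zero_apply]
  map_add' r s := by
    ext g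
    rw [add_apply]
    by_cases hg : g = 1
    · rw [hg, single_self, single_self, single_self]
    · rw [single_of_ne hg, single_of_ne hg, single_of_ne hg, add_zero]
  commutes' c := by
    rw [Algebra.algebraMap_eq_smul_one, Algebra.algebraMap_eq_smul_one, one_def]
    ext g
    rw [smul_apply]
    by_cases hg : g = 1
    · rw [hg, single_self, single_self]
    · rw [single_of_ne hg, single_of_ne hg, smul_zero]

theorem incl_apply (r : R) : incl D r = single D 1 r := rfl

theorem incl_mul_single (r s : R) (g : G) : incl D r * single D g s = single D g (r * s) := by
  rw [incl_apply, single_mul_single, ract_one, φ_one_left, one_mul, mul_one]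

theorem incl_mul_apply (r : R) (a : D.CrossedProduct) (g : G) : (incl D r * a) g = r * a g := by
  rw [incl_apply, single_mul_apply, ract_one, inv_one, one_mul, φ_one_left, mul_one]

theorem mul_incl_apply (r : R) (a : D.CrossedProduct) (g : G) :
    (a * incl D r) g = a g * ract ρ g r := by
  rw [incl_apply, mul_single_apply, inv_one, mul_one, φ_one_right, mul_one]

theorem unit_mul_incl (g : G) (r : R) :
    (unit D g : D.CrossedProduct) * incl D r = incl D (ract ρ g r) * unit D g := by
  rw [coe_unit, incl_mul_single, incl_apply, single_mul_single, mul_one, φ_one_right, one_mul,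
    mul_one]

theorem unit_mul_unit (g h : G) :
    (unit D g : D.CrossedProduct) * unit D h = incl D (D.φ (g, h)) * unit D (g * h) := by
  rw [coe_unit, coe_unit, coe_unit, incl_mul_single, single_mul_single, map_one, one_mul, one_mul,
    mul_one]

theorem star_incl (r : R) : star (incl D r) = incl D (star r) := by
  ext g
  rw [star_apply, incl_apply, incl_apply]
  by_cases hg : g = 1
  · rw [hg, inv_one, single_self, single_self, κ_one, ract_one, one_mul]
  · rw [single_of_ne hg, single_of_ne (by rwa [Ne, inv_eq_one]), star_zero, map_zero, mul_zero]

theorem star_unit (g : G) :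
    star (unit D g : D.CrossedProduct) = (↑(unit D g)⁻¹ : D.CrossedProduct) * incl D (D.η g) := by
  change star (single D g 1) = single D g⁻¹ _ * single D 1 _
  rw [single_mul_single, mul_one, φ_one_right, mul_one]
  ext k
  rw [star_apply]
  by_cases hk : k = g⁻¹
  · rw [hk, inv_inv, single_self, single_self, star_one, map_one, mul_one, κ, inv_inv]
  · rw [single_of_ne hk, single_of_ne, star_zero, map_zero, mul_zero]
    rintro rfl
    exact hk (inv_inv k).symm

end CrossedProduct

open CrossedProduct

variable [Fintype G]

/-! ### The centralizer of `R` in the crossed product -/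

/-- The centralizer of `R` in the crossed product. -/
noncomputable def centralizer : Subalgebra ℂ D.CrossedProduct :=
  Subalgebra.centralizer ℂ (Set.range (incl D))

variable {D}

theorem mem_centralizer {a : D.CrossedProduct} :
    a ∈ D.centralizer ↔ ∀ r, incl D r * a = a * incl D r := by
  rw [centralizer, Subalgebra.mem_centralizer_iff]
  simp

/-- The coefficient at g can therefore be nonzero only at characters fixed by g, which is why the
centralizer has the right isotypic lines. -/
theorem mem_centralizer_iff_apply {a : D.CrossedProduct} :
    a ∈ D.centralizer ↔ ∀ g r, r * a g = a g * ract ρ g r := by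
  rw [mem_centralizer]
  constructor
  · intro h g r
    rw [← incl_mul_apply, h, mul_incl_apply]
  · intro h r
    ext g
    rw [incl_mul_apply, mul_incl_apply, h]

theorem incl_mem (r : R) : incl D r ∈ D.centralizer := mem_centralizer.2 fun s => by
  rw [← map_mul, ← map_mul, mul_comm]

theorem star_mem_centralizer {a : D.CrossedProduct} (ha : a ∈ D.centralizer) :
    star a ∈ D.centralizer := mem_centralizer.2 fun r => by
  have h := congrArg star (mem_centralizer.1 ha (star r))
  rw [star_mul, star_mul, star_incl, star_star] at h
  exact h.symm

theorem single_mem {a : D.CrossedProduct} (ha : a ∈ D.centralizer) (g : G) :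
    single D g (a g) ∈ D.centralizer := by
  rw [mem_centralizer_iff_apply] at *
  intro h r
  by_cases hh : h = g
  · rw [hh, single_self, ha]
  · rw [single_of_ne hh, mul_zero, zero_mul]

theorem single_idem_mem {χ : R →ₐ[ℂ] ℂ} {g : G} (hg : simAct ρ g χ = χ) :
    single D g (idem χ) ∈ D.centralizer := by
  rw [mem_centralizer_iff_apply]
  intro h r
  by_cases hh : h = g
  · rw [hh, single_self, mul_comm (idem χ), mul_idem, mul_idem]
    have h2 : χ (ract ρ g r) = simAct ρ g⁻¹ χ r := apply_act ρ g χ r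
    rw [h2, simAct_inv_fixed ρ hg]
  · rw [single_of_ne hh, mul_zero, zero_mul]

noncomputable instance : StarRing D.centralizer where
  star a := ⟨star a.1, star_mem_centralizer a.2⟩
  star_involutive a := Subtype.ext (star_star a.1)
  star_mul a b := Subtype.ext (star_mul a.1 b.1)
  star_add a b := Subtype.ext (star_add a.1 b.1)

theorem coe_star (a : D.centralizer) : ((star a : D.centralizer) : D.CrossedProduct) = star a.1 :=
  rfl

variable (D) in
/-- The class functional of the centralizer. -/
noncomputable def centralizerLam : D.centralizer →ₗ[ℂ] ℂ where
  toFun a := lam (a.1 1)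
  map_add' a b := map_add lam (a.1 1) (b.1 1)
  map_smul' c a := map_smul lam c (a.1 1)

theorem centralizerLam_apply (a : D.centralizer) : centralizerLam D a = lam (a.1 1) := rfl

theorem centralizerLam_mul (a b : D.centralizer) :
    centralizerLam D (a * b) = ∑ h, lam (a.1 h * ract ρ h (b.1 h⁻¹) * D.φ (h, h⁻¹)) := by
  rw [centralizerLam_apply, Subalgebra.coe_mul, mul_apply, map_sum]
  simp only [mul_one]

theorem star_smul_centralizer (c : ℂ) (a : D.centralizer) :
    star (c • a) = (starRingEnd ℂ c) • star a := by
  refine Subtype.ext (CrossedProduct.ext fun g => ?_)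
  change D.κ g * ract ρ g (star (c • a.1 g⁻¹)) =
    (starRingEnd ℂ c) • (D.κ g * ract ρ g (star (a.1 g⁻¹)))
  rw [star_smul_conj, map_smul, mul_smul_comm]

theorem centralizerLam_star (a : D.centralizer) :
    centralizerLam D (star a) = starRingEnd ℂ (centralizerLam D a) := by
  rw [centralizerLam_apply, coe_star, star_apply, κ_one, one_mul, ract_one, inv_one,
    FrobeniusStarAlgebra.lam_star]
  rfl

/-- Writing η(h) = s_h s_h⋆, the relation u_h u_h⋆ = η(h) gives λ(aa⋆) as the sum of the squared
norms of a_h s_h. -/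
theorem centralizerLam_pos {a : D.centralizer} (ha : a ≠ 0) :
    0 < (centralizerLam D (a * star a)).re := by
  choose s hsu hs using D.exists_mul_star_eq_η
  have h1 : ∀ h, lam (a.1 h * ract ρ h ((star a : D.centralizer).1 h⁻¹) * D.φ (h, h⁻¹)) =
      (sqNorm (a.1 h * s h) : ℂ) := by
    intro h
    rw [← lam_mul_star_self, coe_star, star_apply, inv_inv, map_mul (ract ρ h), ← ract_mul,
      mul_inv_cancel, ract_one, star_mul]
    congr 1
    linear_combination (a.1 h * star (a.1 h)) * D.ract_κ_inv h - (a.1 h * star (a.1 h)) * hs h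
  rw [centralizerLam_mul, Finset.sum_congr rfl fun h _ => h1 h, ← Complex.ofReal_sum,
    Complex.ofReal_re]
  obtain ⟨h, hh⟩ : ∃ h, a.1 h ≠ 0 := by
    by_contra! h0
    exact ha (Subtype.ext (CrossedProduct.ext h0))
  refine Finset.sum_pos' (fun k _ => ?_) ⟨h, Finset.mem_univ h, sqNorm_pos ?_⟩
  · by_cases hk : a.1 k * s k = 0
    · simp [hk, sqNorm]
    · exact (sqNorm_pos hk).le
  · rwa [Ne, (hsu h).mul_left_eq_zero]

noncomputable instance : FrobeniusStarAlgebra D.centralizer where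
  finiteDimensional := inferInstance
  star_smul' := star_smul_centralizer
  lam := centralizerLam D
  lam_mul_comm a b := by
    rw [centralizerLam_mul, centralizerLam_mul]
    refine Fintype.sum_equiv (Equiv.inv G) _ _ fun h => ?_
    rw [Equiv.inv_apply, inv_inv, ← lam_ract ρ h (b.1 h⁻¹ * _ * _), map_mul (ract ρ h), map_mul (ract ρ h),
      ← ract_mul, mul_inv_cancel, ract_one, ract_φ_inv, mul_comm (a.1 h)]
  lam_star := centralizerLam_star
  exists_orthonormal_basis := exists_orthonormal_basis_of_pos star_smul_centralizer
    (centralizerLam D) centralizerLam_star fun _ ha => centralizerLam_pos ha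

theorem lam_centralizer (a : D.centralizer) : lam a = lam (a.1 1) := rfl

theorem conj_mem (g : G) {a : D.CrossedProduct} (ha : a ∈ D.centralizer) :
    (unit D g : D.CrossedProduct) * a * (↑(unit D g)⁻¹ : D.CrossedProduct) ∈ D.centralizer := by
  rw [mem_centralizer] at *
  intro r
  have h0 := unit_mul_incl (D := D) g (ract ρ g⁻¹ r)
  rw [← ract_mul, mul_inv_cancel, ract_one] at h0
  have h1 : (↑(unit D g)⁻¹ : D.CrossedProduct) * incl D r =
      incl D (ract ρ g⁻¹ r) * (↑(unit D g)⁻¹ : D.CrossedProduct) := by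
    rw [Units.inv_mul_eq_iff_eq_mul, ← mul_assoc, h0, Units.mul_inv_cancel_right]
  rw [mul_assoc _ _ (incl D r), h1, ← mul_assoc, ← mul_assoc, ← h0, mul_assoc _ _ a, ha,
    mul_assoc, mul_assoc, mul_assoc]

theorem conj_inv_mem (g : G) {a : D.CrossedProduct} (ha : a ∈ D.centralizer) :
    (↑(unit D g)⁻¹ : D.CrossedProduct) * a * (unit D g : D.CrossedProduct) ∈ D.centralizer := by
  rw [mem_centralizer] at *
  intro r
  have h1 : (↑(unit D g)⁻¹ : D.CrossedProduct) * incl D (ract ρ g r) =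
      incl D r * (↑(unit D g)⁻¹ : D.CrossedProduct) := by
    rw [Units.inv_mul_eq_iff_eq_mul, ← mul_assoc, unit_mul_incl, Units.mul_inv_cancel_right]
  rw [mul_assoc _ _ (incl D r), unit_mul_incl, ← mul_assoc, ← mul_assoc, ← h1,
    mul_assoc _ (incl D _) a, ha, mul_assoc, mul_assoc, mul_assoc]

variable (D) in
/-- Conjugation by `u g`, restricted to the centralizer of `R`. -/
noncomputable def conjEquiv (g : G) : D.centralizer ≃ₐ[ℂ] D.centralizer :=
  AlgEquiv.ofLinearEquiv
    { toFun := fun a => ⟨_, conj_mem g a.2⟩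
      invFun := fun a => ⟨_, conj_inv_mem g a.2⟩
      map_add' := fun a b => Subtype.ext (by
        change _ * (a.1 + b.1) * _ = _
        rw [mul_add, add_mul]
        rfl)
      map_smul' := fun c a => Subtype.ext (by
        change _ * (c • a.1) * _ = _
        rw [mul_smul_comm, smul_mul_assoc]
        rfl)
      left_inv := fun a => Subtype.ext (by simp [mul_assoc])
      right_inv := fun a => Subtype.ext (by simp [mul_assoc]) }
    (Subtype.ext (by simp))
    (fun a b => Subtype.ext (by simp [mul_assoc]))

theorem conjEquiv_mul_unit (g : G) (a : D.centralizer) :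
    (conjEquiv D g a).1 * (unit D g : D.CrossedProduct) = unit D g * a.1 :=
  Units.inv_mul_cancel_right _ _

theorem conjEquiv_eq_iff {g : G} {a b : D.centralizer} :
    conjEquiv D g a = b ↔ b.1 * (unit D g : D.CrossedProduct) = unit D g * a.1 := by
  rw [← conjEquiv_mul_unit, (unit D g).isUnit.mul_left_inj, eq_comm]
  exact Subtype.ext_iff

theorem conjEquiv_apply_mul_φ (g : G) (a : D.centralizer) (k : G) :
    (conjEquiv D g a).1 k * D.φ (k, g) = ract ρ g (a.1 (g⁻¹ * k * g)) * D.φ (g, g⁻¹ * k * g) := by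
  have h := congrFun (conjEquiv_mul_unit g a) (k * g)
  rw [coe_unit, mul_single_apply, single_mul_apply, map_one, mul_one, one_mul,
    mul_inv_cancel_right, ← mul_assoc] at h
  exact h

/-- Conjugation acts on the coefficient at 1 through g, which preserves `lam` on `R`. Although u_g⋆
differs from u_g⁻¹ by η(g), this factor lies in `R` and commutes with the centralizer. -/
theorem isFrobeniusStarHom_conjEquiv (g : G) :
    IsFrobeniusStarHom (conjEquiv D g : D.centralizer →ₐ[ℂ] D.centralizer) := by
  refine ⟨fun a => ?_, fun a => ?_⟩
  · have h := conjEquiv_apply_mul_φ g a 1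
    rw [φ_one_left, mul_one, mul_one, inv_mul_cancel, φ_one_right, mul_one] at h
    change lam ((conjEquiv D g a).1 1) = lam (a.1 1)
    rw [h, lam_ract]
  · change conjEquiv D g (star a) = star (conjEquiv D g a)
    rw [conjEquiv_eq_iff, coe_star, coe_star]
    have h := congrArg star (conjEquiv_mul_unit g a)
    have h2 := mem_centralizer.1 (star_mem_centralizer (conjEquiv D g a).2) (D.η g)
    rw [star_mul, star_mul, star_unit, mul_assoc, h2, ← mul_assoc, ← mul_assoc,
      ((D.η g).isUnit.map (incl D)).mul_left_inj] at h
    rw [Units.inv_mul_eq_iff_eq_mul] at h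
    rw [h, mul_assoc, Units.inv_mul_cancel_right]

variable (D) in
/-- The action of `G` on the centralizer of `R` by conjugation. -/
noncomputable def conjAct : G →* frobAut D.centralizer where
  toFun g := ⟨conjEquiv D g, isFrobeniusStarHom_conjEquiv g⟩
  map_one' := Subtype.ext (AlgEquiv.ext fun a => by
    change conjEquiv D 1 a = a
    rw [conjEquiv_eq_iff, coe_unit, ← one_def, mul_one, one_mul])
  map_mul' g h := Subtype.ext (AlgEquiv.ext fun a => by
    change conjEquiv D (g * h) a = conjEquiv D g (conjEquiv D h a)
    rw [conjEquiv_eq_iff]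
    have e1 : (conjEquiv D g (conjEquiv D h a)).1 *
        ((unit D g : D.CrossedProduct) * unit D h) = unit D g * unit D h * a.1 := by
      rw [← mul_assoc, conjEquiv_mul_unit, mul_assoc, conjEquiv_mul_unit, mul_assoc]
    -- The factor φ(g,h) lies in `R`, hence commutes with the centralizer and cancels; the
    -- projective relation among the u_g thus yields an honest action.
    rw [unit_mul_unit, ← mul_assoc, ← mem_centralizer.1 (conjEquiv D g (conjEquiv D h a)).2,
      mul_assoc, mul_assoc] at e1
    exact ((D.φ (g, h)).isUnit.map (incl D)).mul_left_cancel e1)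

variable (D) in
/-- The homogeneous components of the centralizer. -/
def component (g : G) : Submodule ℂ D.centralizer where
  carrier := {a | ∀ k, k ≠ g → a.1 k = 0}
  add_mem' := fun {a b} ha hb k hk => by
    change a.1 k + b.1 k = 0
    rw [ha k hk, hb k hk, add_zero]
  zero_mem' := fun _ _ => rfl
  smul_mem' c a ha k hk := by
    change c • a.1 k = 0
    rw [ha k hk, smul_zero]

theorem eq_single_of_mem {g : G} {a : D.centralizer} (ha : a ∈ component D g) :
    a.1 = single D g (a.1 g) := CrossedProduct.eq_single ha

open Classical in
theorem isInternal_component : DirectSum.IsInternal (component D) := by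
  rw [DirectSum.isInternal_submodule_iff_iSupIndep_and_iSup_eq_top]
  constructor
  · intro g
    rw [Submodule.disjoint_def]
    intro a ha ha'
    let ev : D.centralizer →ₗ[ℂ] R :=
      { toFun := fun a => a.1 g
        map_add' := fun _ _ => rfl
        map_smul' := fun _ _ => rfl }
    have hle : (⨆ h, ⨆ (_ : h ≠ g), component D h) ≤ LinearMap.ker ev :=
      iSup_le fun h => iSup_le fun hne => fun b hb => hb g hne.symm
    have h0 : a.1 g = 0 := hle ha'
    refine Subtype.ext (CrossedProduct.ext fun k => ?_)
    by_cases hk : k = g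
    · rw [hk, h0]
      rfl
    · exact ha k hk
  · rw [eq_top_iff]
    intro a _
    have h1 : a = ∑ g, ⟨single D g (a.1 g), single_mem a.2 g⟩ := by
      refine Subtype.ext (CrossedProduct.ext fun k => ?_)
      let ev : D.centralizer →ₗ[ℂ] R :=
        { toFun := fun a => a.1 k
          map_add' := fun _ _ => rfl
          map_smul' := fun _ _ => rfl }
      change ev a = ev _
      rw [map_sum, Finset.sum_eq_single k]
      · exact (single_self (D := D) k _).symm
      · intro g _ hg
        exact single_of_ne (D := D) hg.symm _
      · exact fun h => absurd (Finset.mem_univ k) h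
    rw [h1]
    refine Submodule.sum_mem _ fun g _ => Submodule.mem_iSup_of_mem g fun k hk => ?_
    exact single_of_ne (D := D) hk _

variable (D) in
/-- The crossed structure on the centralizer of `R`. -/
noncomputable def crossedCentralizer : CrossedFrobeniusStarAlgebra G D.centralizer where
  comp := component D
  isInternal := isInternal_component
  one_mem k hk := single_of_ne (D := D) hk 1
  mul_mem {g h a b} ha hb k hk := by
    rw [Subalgebra.coe_mul, eq_single_of_mem ha, eq_single_of_mem hb, single_mul_single,
      single_of_ne hk]
  lam_eq_zero {g a} hg ha := by
    rw [lam_centralizer, ha 1 hg.symm, map_zero]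
  star_mem {g a} ha k hk := by
    rw [coe_star, star_apply, ha k⁻¹ (fun h => hk (by rw [← h, inv_inv])), star_zero, map_zero,
      mul_zero]
  act := conjAct D
  act_mem g {h a} ha k hk := by
    have e := conjEquiv_apply_mul_φ g a k
    rw [ha (g⁻¹ * k * g) (by
      rintro rfl
      exact hk (by group)), map_zero, zero_mul] at e
    exact ((D.φ (k, g)).isUnit.mul_left_eq_zero).1 e
  crossed_comm {g a} ha b := by
    refine Subtype.ext ?_
    change a.1 * b.1 = (conjEquiv D g b).1 * a.1
    -- A homogeneous element is r u_g; then ab = r g(b) u_g, and r commutes with g(b).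
    have h1 : a.1 = incl D (a.1 g) * unit D g := by
      rw [coe_unit, incl_mul_single, mul_one]
      exact eq_single_of_mem ha
    rw [h1, mul_assoc, ← conjEquiv_mul_unit, ← mul_assoc, ← mul_assoc,
      mem_centralizer.1 (conjEquiv D g b).2]

variable (D) in
/-- The embedding of `R` into its centralizer. -/
noncomputable def inclCentralizer : R →ₐ[ℂ] D.centralizer :=
  (incl D).codRestrict D.centralizer incl_mem

theorem coe_inclCentralizer (r : R) : (inclCentralizer D r).1 = incl D r := rfl

theorem inclCentralizer_mem (r : R) : inclCentralizer D r ∈ component D 1 := fun _ hk =>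
  single_of_ne (D := D) hk r

theorem eq_inclCentralizer {a : D.centralizer} (ha : a ∈ component D 1) :
    a = inclCentralizer D (a.1 1) := Subtype.ext (eq_single_of_mem ha)

theorem conjEquiv_inclCentralizer (g : G) (r : R) :
    conjEquiv D g (inclCentralizer D r) = inclCentralizer D (ract ρ g r) := by
  rw [conjEquiv_eq_iff, coe_inclCentralizer, coe_inclCentralizer, unit_mul_incl]

/-- The χ-part of degree g consists of multiples of `idem χ * u_g`, and a nonzero such multiple
centralizes `R` exactly when g fixes χ. -/
theorem isStrict_crossedCentralizer : (crossedCentralizer D).IsStrict := by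
  intro g
  ext χ'
  let ι : R →ₐ[ℂ] (crossedCentralizer D).one :=
    (inclCentralizer D).codRestrict _ inclCentralizer_mem
  have hι : ∀ s : (crossedCentralizer D).one, ∃ r, ι r = s := fun s =>
    ⟨s.1.1 1, Subtype.ext (eq_inclCentralizer s.2).symm⟩
  let χ : R →ₐ[ℂ] ℂ := χ'.comp ι
  have hχ : ∀ r, χ' (ι r) = χ r := fun r => rfl
  have hfix : χ'.comp ((crossedCentralizer D).actOne g⁻¹) = χ' ↔ simAct ρ g χ = χ := by
    have h1 : ∀ r, χ' ((crossedCentralizer D).actOne g⁻¹ (ι r)) = simAct ρ g χ r := fun r =>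
      congrArg χ' (Subtype.ext (conjEquiv_inclCentralizer g⁻¹ r))
    constructor
    · intro h
      refine AlgHom.ext fun r => ?_
      rw [← h1, ← hχ]
      exact DFunLike.congr_fun h (ι r)
    · intro h
      refine AlgHom.ext fun s => ?_
      obtain ⟨r, rfl⟩ := hι s
      rw [hχ, ← h]
      exact h1 r
  have hiso := (crossedCentralizer D).partialAction_iso_iff g χ' (E := ι (idem χ))
    (by rw [hχ, apply_idem_self]) (by
      intro s
      obtain ⟨r, rfl⟩ := hι s
      rw [hχ, ← map_mul, mul_idem, map_smul])
  refine hiso.trans (Iff.trans ?_ hfix.symm)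
  constructor
  · rintro ⟨v, hv, hv0, hEv, -⟩
    have h1 : v.1 = single D g (v.1 g) := eq_single_of_mem hv
    have h2 : idem χ * v.1 g = v.1 g := by
      rw [← incl_mul_apply]
      exact congrArg (fun x : D.centralizer => x.1 g) hEv
    rw [mul_comm, mul_idem] at h2
    have h3 : χ (v.1 g) ≠ 0 := by
      intro h
      refine hv0 (Subtype.ext (CrossedProduct.ext fun k => ?_))
      by_cases hk : k = g
      · rw [hk, ← h2, h, zero_smul]
        rfl
      · exact hv k hk
    have h4 : simAct ρ g⁻¹ χ = χ := by
      refine AlgHom.ext fun r => ?_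
      have h5 := congrArg χ (mem_centralizer_iff_apply.1 v.2 g r)
      rw [map_mul, map_mul, mul_comm] at h5
      rw [← apply_act]
      exact (mul_left_cancel₀ h3 h5).symm
    exact ((simAct_inv_eq ρ).1 h4).symm
  · intro hg
    refine ⟨⟨single D g (idem χ), single_idem_mem hg⟩, fun k hk => single_of_ne (D := D) hk _, ?_, ?_, ?_⟩
    · intro h
      have h1 := congrArg (fun x : D.centralizer => x.1 g) h
      refine idem_ne_zero χ ?_
      rw [← single_self (D := D) g (idem χ)]
      exact h1
    · refine Subtype.ext ?_
      change incl D (idem χ) * single D g (idem χ) = single D g (idem χ)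
      rw [incl_mul_single, idem_mul_self]
    · intro m hm
      refine ⟨χ (m.1 g), Subtype.ext (CrossedProduct.ext fun k => ?_)⟩
      change (incl D (idem χ) * m.1) k = χ (m.1 g) • single D g (idem χ) k
      rw [incl_mul_apply]
      by_cases hk : k = g
      · rw [hk, single_self, mul_comm, mul_idem]
      · rw [single_of_ne hk, hm k hk, mul_zero, smul_zero]

variable (D) in
/-- The strict crossed extension of `R` given by the cocycle. -/
noncomputable def extension : StrictCrossedExtension ρ where
  carrier := D.centralizer
  crossed := crossedCentralizer D
  strict := isStrict_crossedCentralizer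
  j := inclCentralizer D
  j_hom := ⟨fun r => congrArg lam (single_self (D := D) 1 r), fun r =>
    Subtype.ext (star_incl r).symm⟩
  j_injective r s h := by
    have h1 := congrArg (fun x : D.centralizer => x.1 1) h
    rw [← single_self (D := D) 1 r, ← single_self (D := D) 1 s]
    exact h1
  j_range := by
    ext a
    constructor
    · rintro ⟨r, rfl⟩
      exact inclCentralizer_mem r
    · intro ha
      exact ⟨a.1 1, (eq_inclCentralizer ha).symm⟩
  j_act g r := conjEquiv_inclCentralizer g r

open Classical in
variable (D) in
/-- The generators `idem χ * u g` of the isotypic lines of the extension. -/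
noncomputable def family (χ : R →ₐ[ℂ] ℂ) (g : G) : (extension D).carrier :=
  if h : simAct ρ g χ = χ then (⟨single D g (idem χ), single_idem_mem h⟩ : D.centralizer)
  else (0 : D.centralizer)

theorem family_of_fixed {χ : R →ₐ[ℂ] ℂ} {g : G} (h : simAct ρ g χ = χ) :
    family D χ g = (⟨single D g (idem χ), single_idem_mem h⟩ : D.centralizer) := dif_pos h

theorem isLineFamily_family : (extension D).IsLineFamily (family D) := by
  intro χ g hg
  rw [family_of_fixed hg]
  refine ⟨StrictCrossedExtension.mem_line.2 ⟨fun k hk => single_of_ne (D := D) hk _, Subtype.ext ?_⟩, fun h => ?_⟩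
  · change incl D (idem χ) * single D g (idem χ) = single D g (idem χ)
    rw [incl_mul_single, idem_mul_self]
  · have h1 := congrArg (fun x : D.centralizer => x.1 g) h
    refine idem_ne_zero χ ?_
    rw [← single_self (D := D) g (idem χ)]
    exact h1

theorem hasProduct_family : (extension D).HasProduct (family D) D.φ := by
  intro χ g h hg hh
  rw [family_of_fixed hg, family_of_fixed hh, family_of_fixed (simAct_mul_fixed ρ hg hh)]
  refine Subtype.ext ?_
  change single D g (idem χ) * single D h (idem χ) =
    incl D (D.φ (g, h)) * single D (g * h) (idem χ)
  rw [single_mul_single, ract_idem, hg, idem_mul_self, incl_mul_single, mul_comm]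

theorem hasAction_family : (extension D).HasAction (family D) D.φ := by
  intro χ g h hh
  rw [family_of_fixed hh, family_of_fixed (simAct_conj_fixed ρ g hh)]
  refine (conjEquiv_eq_iff (D := D)).2 ?_
  change incl D _ * single D (g * h * g⁻¹) (idem (simAct ρ g χ)) * single D g 1 =
    single D g 1 * single D h (idem χ)
  rw [incl_mul_single, single_mul_single, single_mul_single, ract_idem, map_one, mul_one, one_mul,
    inv_mul_cancel_right, div_eq_mul_inv, Units.val_mul]
  congr 1
  linear_combination (D.φ (g, h) * idem (simAct ρ g χ) : R) *
    (D.φ (g * h * g⁻¹, g)).inv_mul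

end PositiveCocycle

end CrossedProduct

/-! ### The bijection with the second cohomology group -/

section Classification

open StrictCrossedExtension

variable {G R : Type} [Group G] [CommRing R] [Algebra ℂ R] [FrobeniusStarAlgebra R]
  {ρ : G →* frobAut R}

/-- The class `c` is represented by a cocycle that describes the products of some family of
generators of the isotypic lines of `A`. -/
def HasClass (A : StrictCrossedExtension ρ) (c : H2Units ρ) : Prop :=
  ∃ (e : (R →ₐ[ℂ] ℂ) → G → A.carrier) (φ : G × G → Rˣ) (hφ : IsUnitsCocycle ρ φ),
    A.IsLineFamily e ∧ A.HasProduct e φ ∧ H2Units.mk hφ = c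

theorem exists_normalizedFamily [Finite G] (A : StrictCrossedExtension ρ) :
    ∃ (e : (R →ₐ[ℂ] ℂ) → G → A.carrier) (φ : G × G → Rˣ), IsUnitsCocycle ρ φ ∧
      IsNormalizedCochain φ ∧ A.IsLineFamily e ∧ A.HasProduct e φ ∧ A.HasAction e φ := by
  have h : ∀ (χ : R →ₐ[ℂ] ℂ) (g : G), ∃ x, simAct ρ g χ = χ →
      A.crossed.IsNormalizedTwistedCharacter (A.sim χ) g⁻¹ x := by
    intro χ g
    by_cases hg : simAct ρ g χ = χ
    · obtain ⟨x, hx⟩ := exists_normalizedTwistedCharacter (A := A) hg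
      exact ⟨x, fun _ => hx⟩
    · exact ⟨0, fun h => absurd h hg⟩
  choose e he using h
  have he' : A.IsLineFamily e := fun χ g hg =>
    ⟨normalizedTwisted_mem_line (he χ g hg), normalizedTwisted_ne_zero (he χ g hg) hg⟩
  obtain ⟨φ, h1, h2, h3, h4⟩ := he'.exists_cocycle fun χ =>
    normalizedTwisted_one_eq (by simpa using he χ 1 (simAct_one ρ χ))
  exact ⟨e, φ, h1, h2, he', h3, h4⟩

theorem exists_hasClass [Finite G] (A : StrictCrossedExtension ρ) : ∃ c, HasClass A c := by
  obtain ⟨e, φ, hφ, -, he, hp, -⟩ := exists_normalizedFamily A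
  exact ⟨_, e, φ, hφ, he, hp, rfl⟩

theorem HasClass.unique {A : StrictCrossedExtension ρ} {c c' : H2Units ρ} (h : HasClass A c)
    (h' : HasClass A c') : c = c' := by
  obtain ⟨e, φ, hφ, he, hp, rfl⟩ := h
  obtain ⟨e', φ', hφ', he', hp', rfl⟩ := h'
  exact he.mk_eq_mk he' hφ hφ' hp hp'

theorem HasClass.of_isIso {A B : StrictCrossedExtension ρ} {c : H2Units ρ} (h : HasClass A c)
    (hAB : A ≈ B) : HasClass B c := by
  obtain ⟨e, φ, hφ, he, hp, hc⟩ := h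
  obtain ⟨f, hf⟩ := hAB
  exact ⟨_, φ, hφ, he.map hf, hp.map hf, hc⟩

/-- Equal classes mean that the cocycles of two normalized families differ by a coboundary;
rescaling one family by the cochain gives both the same product and action relations. -/
theorem HasClass.isIso [Finite G] {A B : StrictCrossedExtension ρ} {c : H2Units ρ}
    (hA : HasClass A c) (hB : HasClass B c) : A ≈ B := by
  obtain ⟨e, φ, hφ, hφ1, he, hp, ha⟩ := exists_normalizedFamily A
  obtain ⟨e', φ', hφ', hφ1', he', hp', ha'⟩ := exists_normalizedFamily B
  have h1 : H2Units.mk hφ = c := HasClass.unique ⟨e, φ, hφ, he, hp, rfl⟩ hA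
  have h2 : H2Units.mk hφ' = c := HasClass.unique ⟨e', φ', hφ', he', hp', rfl⟩ hB
  obtain ⟨s, hs⟩ := (H2Units.mk_eq_mk_iff hφ hφ').1 (h1.trans h2.symm)
  exact (he.smul s).exists_isIso he' hφ' hφ1' (he.hasProduct_smul hs hp) hp'
    (he.hasAction_smul hs ha) ha'

theorem exists_extension [Finite G] {φ : G × G → Rˣ} (hφ : IsUnitsCocycle ρ φ)
    (hφ1 : IsNormalizedCochain φ) :
    ∃ (A : StrictCrossedExtension ρ) (e : (R →ₐ[ℂ] ℂ) → G → A.carrier),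
      A.IsLineFamily e ∧ A.HasProduct e φ ∧ A.HasAction e φ := by
  have : Fintype G := Fintype.ofFinite G
  obtain ⟨η, hη⟩ := exists_positiveTrivialization ρ hφ
  let D : PositiveCocycle ρ := ⟨φ, hφ, hφ1, η, hη⟩
  exact ⟨D.extension, D.family, PositiveCocycle.isLineFamily_family,
    PositiveCocycle.hasProduct_family, PositiveCocycle.hasAction_family⟩

variable (ρ) in
/-- The bijection between isomorphism classes of extensions and cohomology classes. -/
theorem exists_classification [Finite G] : ∃ F : Frob ρ ≃ H2Units ρ,
    ∀ (A : StrictCrossedExtension ρ) (c : H2Units ρ), HasClass A c → F (Frob.mk A) = c := by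
  choose cl hcl using exists_hasClass (ρ := ρ)
  let F : Frob ρ → H2Units ρ := Quotient.lift cl fun A B hAB =>
    ((hcl A).of_isIso hAB).unique (hcl B)
  have hF : ∀ (A : StrictCrossedExtension ρ) (c : H2Units ρ), HasClass A c → F (Frob.mk A) = c :=
    fun A c h => (hcl A).unique h
  refine ⟨Equiv.ofBijective F ⟨?_, fun c => ?_⟩, hF⟩
  · intro x y
    induction x, y using Quotient.inductionOn₂ with
    | h A B =>
      intro h
      exact Quotient.sound ((hcl A).isIso (show HasClass B (cl A) from
        (show cl A = cl B from h) ▸ hcl B))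
  · obtain ⟨φ, hφ, hφ1, rfl⟩ := exists_normalized_cocycle c
    obtain ⟨A, e, he, hp, -⟩ := exists_extension hφ hφ1
    exact ⟨Frob.mk A, hF A _ ⟨e, φ, hφ, he, hp, rfl⟩⟩

end Classification

theorem theorem1p1 {G R : Type} [Group G] [Finite G] [CommRing R] [Algebra ℂ R]
    [FrobeniusStarAlgebra R] (ρ : G →* frobAut R) :
    ∃ F : Frob ρ ≃ H2Units ρ,
      (∀ A : StrictCrossedExtension ρ,
        (∀ (χ : R →ₐ[ℂ] ℂ) (g : G), simAct ρ g χ = χ →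
          ∃ x, A.crossed.IsNormalizedTwistedCharacter (A.sim χ) g⁻¹ x) ∧
        (∀ e : (R →ₐ[ℂ] ℂ) → G → A.carrier,
          (∀ (χ : R →ₐ[ℂ] ℂ) (g : G), simAct ρ g χ = χ →
            A.crossed.IsNormalizedTwistedCharacter (A.sim χ) g⁻¹ (e χ g)) →
          A.IsAdaptedBasis e ∧
          (∃ φ : G × G → Rˣ, IsUnitsCocycle ρ φ ∧ IsNormalizedCochain φ ∧
            A.HasProduct e φ ∧ A.HasAction e φ) ∧
          (∀ (φ : G × G → Rˣ) (hφ : IsUnitsCocycle ρ φ),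
            A.HasProduct e φ → F (Frob.mk A) = H2Units.mk hφ))) ∧
      (∀ (φ : G × G → Rˣ) (hφ : IsUnitsCocycle ρ φ), IsNormalizedCochain φ →
        (∃ η : G → Rˣ, IsPositiveTrivialization ρ φ η) ∧
        ∃ (A : StrictCrossedExtension ρ) (e : (R →ₐ[ℂ] ℂ) → G → A.carrier),
          A.IsAdaptedBasis e ∧ A.HasProduct e φ ∧ A.HasAction e φ ∧
          (∀ η : G → Rˣ, IsPositiveTrivialization ρ φ η → A.HasStar e φ η) ∧
          F (Frob.mk A) = H2Units.mk hφ) := by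
  obtain ⟨F, hF⟩ := exists_classification ρ
  refine ⟨F, fun A => ⟨fun χ g hg =>
    StrictCrossedExtension.exists_normalizedTwistedCharacter hg, fun e he => ?_⟩,
    fun φ hφ hφ1 => ⟨exists_positiveTrivialization ρ hφ, ?_⟩⟩
  · have he' : A.IsLineFamily e := fun χ g hg =>
      ⟨StrictCrossedExtension.normalizedTwisted_mem_line (he χ g hg),
        StrictCrossedExtension.normalizedTwisted_ne_zero (he χ g hg) hg⟩
    refine ⟨he'.isAdaptedBasis, he'.exists_cocycle fun χ => ?_, fun φ hφ hp =>
      hF A _ ⟨e, φ, hφ, he', hp, rfl⟩⟩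
    exact StrictCrossedExtension.normalizedTwisted_one_eq
      (by simpa using he χ 1 (simAct_one ρ χ))
  -- The construction fixes one η, but the involution formula holds for every admissible η, since
  -- the product alone determines the norms.
  · obtain ⟨A, e, he, hp, ha⟩ := exists_extension hφ hφ1
    exact ⟨A, e, he.isAdaptedBasis, hp, ha, fun η hη => he.hasStar hφ1 hp hη,
      hF A _ ⟨e, φ, hφ, he, hp, rfl⟩⟩
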